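/- **Setting.** Let $S=\mathbb R/2\pi\mathbb Z$. Let $\alpha_j=-\frac{3\pi}4+j\frac\pi2$ ($j\in\mathbb Z$), and let $J:\mathbb R\to\mathbb R$ be the convex piecewise linear function with $$J(\varphi)=\tfrac\pi4\big(|\varphi-\tfrac{3\pi}4|+|\varphi-\tfrac\pi4|+|\varphi+\tfrac\pi4|+|\varphi+\tfrac{3\pi}4|\big)\quad\text{for }\varphi\in[-\pi,\pi],\qquad J(\varphi+2\pi)=J(\varphi)+2\pi\varphi+2\pi^2,$$ so that $\partial J(\varphi+2\pi)=\partial J(\varphi)+2\pi$; its corners are the $\alpha_j$. An *angle function* on $S$ is a multifunction $\phi:\mathbb R\to2^{\mathbb R}$ with $\phi(s+2\pi)=\phi(s)+2\pi$ that is *maximal TV*: it is obtained from a function $p$ of locally bounded variation by letting $\phi(s)$ be the segment between $p(s^-)$ and $p(s^+)$. Put $$\Xi_j(\phi)=\{s\in\mathbb R:\alpha_j\in\phi(s)\},\qquad \Xi(\phi)=\bigcup_{j\in\mathbb Z}\Xi_j(\phi),$$ and let $K(\phi)$ be the number of connected components of the image of $\Xi(\phi)$ in $S$. We say that $\phi$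 is *J-regular*, $\phi\in\mathrm{J\mbox{-}R}$, if $K(\phi)<\infty$ and on each connected subset of $\mathbb R\setminus\Xi(\phi)$ the values of $\phi$ lie in one interval $(\alpha_j,\alpha_{j+1})$. Put $\|\phi\|_{\mathrm{J\mbox{-}R}}=\|\phi\|_{TV(S)}+K(\phi)$, where $\|\phi\|_{TV(S)}$ is the total variation over one turn of the circle (the jump at the base point is counted once). A *profile* is an absolutely continuous $\lambda:S\to\mathbb R$ whose derivative has bounded variation; $\lambda_s+s$ denotes the angle function whose value at $s$ is the segment between the one-sided derivatives of $\lambda+\frac12s^2$ at $s$. For $h>0$ and $T>0$, a *solution of the semi-discretization* with initial profile $\lambda^0$ is a sequence of profiles $\lambda^k$, $0\le k\le[T/h]$, starting with $\lambda^0$, with $$\frac{\lambda^k-\lambda^{k-1}}h\in\frac{d}{ds}\,\partial J(\lambda^k_s+s)\quad\text{on }S,\qquad 1\le k\le[T/h],$$ which means: there is a locally absolutely continuous $\omega^k:\mathbb R\to\mathbb R$ such that $\omega^k(s)-s$ is $2\pi$-periodic, $\omega^k(s)\in\partial J(\lambda^k_s(s)+s)$ and $\frac{\lambda^k(s)-\lambda^{k-1}(s)}h=\frac{d}{ds}\omega^k(s)$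 for a.e. $s$. **Theorem.** Let $\phi_0\in\mathrm{J\mbox{-}R}$. There are a constant $C\ge0$ and a function $V\ge0$ with $V(s)\to0$ as $s\to0^+$, depending only on $\phi_0$, such that for every profile $\lambda^0$ with $\lambda^0_s+s=\phi_0$ and all $h,T>0$ the following holds. The semi-discretization with initial profile $\lambda^0$ has a solution $(\lambda^k)_{0\le k\le[T/h]}$, and it is unique. Writing $\phi_k=\lambda^k_s+s$ and $\Xi^k_j=\Xi_j(\phi_k)$, $\Xi^k=\Xi(\phi_k)$, for every $0\le k\le[T/h]$ $$\phi_k\in\mathrm{J\mbox{-}R},\qquad \|\phi_k\|_{\mathrm{J\mbox{-}R}}\le\|\phi_0\|_{\mathrm{J\mbox{-}R}},$$ and for every $1\le k\le[T/h]$: 1. $\|\phi_k\|_{\mathrm{J\mbox{-}R}}\le\|\phi_{k-1}\|_{\mathrm{J\mbox{-}R}}$; 2. $\Xi^{k-1}\subset\Xi^k$ and $K(\phi_k)\le K(\phi_{k-1})$; 3. $|\Xi^k_l\setminus\Xi^{k-1}_l|\le C\,(V(h)+h^{1/2})$ for every $l\in\mathbb Z$ (Lebesgue measure on $\mathbb R$);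 4. for every $\omega^k$ as in the definition of a solution, $\frac{d}{ds}\omega^k$ (the value of $\frac{d}{ds}\partial J(\lambda^k_s+s)$) exists and is constant on each connected component of $\Xi^{k-1}\setminus\bigcup_{l\in\mathbb Z}(\Xi^k_l\setminus\Xi^{k-1}_l)$. -/

import Mathlib

open Real Set Filter Topology MeasureTheory

/-!
Functions and angles on the unit circle `S` are written on its universal cover `ℝ`:
a profile `lam : S → ℝ` is a `2π`-periodic function on `ℝ`, and an angle `φ = lam_s + s` satisfies
`φ (s + 2π) = φ s + 2π`.
-/

noncomputable section

/-! ### The energy density -/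

/-- The four-corner energy density, with corners at `-3π/4, -π/4, π/4, 3π/4`. -/
def crystalJ₀ (φ : ℝ) : ℝ :=
  π / 4 * (|φ - 3 * π / 4| + |φ - π / 4| + |φ + π / 4| + |φ + 3 * π / 4|)

/-- The energy density on all angles. It equals `crystalJ₀` on `[-π, π]` and satisfies
`J (φ + 2π) = J φ + 2π φ + 2π²`, that is `∂J (φ + 2π) = ∂J φ + 2π`, so that the evolution
equation makes sense on the circle, along which the angle increases by `2π`.
Its corners are the angles `-3π/4 + j π/2`, `j ∈ ℤ`, and `∂J` jumps by `π/2` at each of them. -/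
def crystalJ (φ : ℝ) : ℝ :=
  crystalJ₀ (toIcoMod two_pi_pos (-π) φ) + (φ ^ 2 - (toIcoMod two_pi_pos (-π) φ) ^ 2) / 2

theorem crystalJ_add_two_pi (φ : ℝ) :
    crystalJ (φ + 2 * π) = crystalJ φ + 2 * π * φ + 2 * π ^ 2 := by
  unfold crystalJ
  rw [toIcoMod_add_right]
  ring

theorem crystalJ_eq_of_mem_Ico {φ : ℝ} (hφ : φ ∈ Ico (-π) π) : crystalJ φ = crystalJ₀ φ := by
  have h : toIcoMod two_pi_pos (-π) φ = φ := by
    rw [toIcoMod_eq_self]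
    exact ⟨hφ.1, by linarith [hφ.2]⟩
  unfold crystalJ
  rw [h]
  ring

/-- The subdifferential of a function on the line. -/
def subdiff (J : ℝ → ℝ) (x : ℝ) : Set ℝ :=
  {p | ∀ y, J x + p * (y - x) ≤ J y}

/-- The preferred angles `α_j = -3π/4 + j π/2`; those with `j = 0, 1, 2, 3` are the basic ones, all
others are obtained from them by adding multiples of `2π`. -/
def prefAngle (j : ℤ) : ℝ := -(3 * π / 4) + j * (π / 2)

/-! ### Multivalued angle functions -/

/-- A maximal TV multifunction on the line: the graph of a function of (locally) bounded variation,
with every jump filled in by the segment between the one-sided limits. -/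
def IsMaximalTV (φ : ℝ → Set ℝ) : Prop :=
  ∃ p : ℝ → ℝ, LocallyBoundedVariationOn p univ ∧
    ∀ s, φ s = uIcc (Function.leftLim p s) (Function.rightLim p s)

/-- The set `Ξ_j` of parameters at which the multifunction attains the preferred angle `α_j`. -/
def facetSet (φ : ℝ → Set ℝ) (j : ℤ) : Set ℝ := {s | prefAngle j ∈ φ s}

/-- The set `Ξ` of parameters at which the multifunction attains some preferred angle. -/
def facets (φ : ℝ → Set ℝ) : Set ℝ := ⋃ j : ℤ, facetSet φ j

/-- The set `Ξ` as a subset of the circle. -/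
def circleFacets (φ : ℝ → Set ℝ) : Set (AddCircle (2 * π)) :=
  (fun s : ℝ => (s : AddCircle (2 * π))) '' facets φ

/-- The number `K` of connected components of `Ξ` on the circle. -/
def facetCount (φ : ℝ → Set ℝ) : ℕ := Nat.card (ConnectedComponents (circleFacets φ))

/-- The class `J-R` of `J`-regular angle functions on the circle. -/
structure IsJR (φ : ℝ → Set ℝ) : Prop where
  maximalTV : IsMaximalTV φ
  angle_add_two_pi : ∀ s, φ (s + 2 * π) = (fun x => x + 2 * π) '' φ s
  finite_components : Finite (ConnectedComponents (circleFacets φ))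
  between : ∀ I : Set ℝ, I ⊆ (facets φ)ᶜ → IsPreconnected I →
    ∃ j : ℤ, ∀ s ∈ I, φ s ⊆ Ioo (prefAngle j) (prefAngle (j + 1))

/-- The total variation over one turn of the circle. It is computed with the selection `max φ`; for
a maximal TV multifunction every selection `q` with `q (s + 2π) = q s + 2π` gives the same value,
which counts the jump at the base point of the circle once. -/
def circleTV (φ : ℝ → Set ℝ) : ENNReal :=
  eVariationOn (fun s => sSup (φ s)) (Icc 0 (2 * π))

/-- The `J-R` norm: total variation plus the number of components of `Ξ`. -/
def jrNorm (φ : ℝ → Set ℝ) : ENNReal := circleTV φ + (facetCount φ : ENNReal)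

/-! ### Profiles and the implicit time discretization -/

/-- A profile on the circle: absolutely continuous, with derivative of bounded variation. -/
structure IsProfile (lam : ℝ → ℝ) : Prop where
  periodic : Function.Periodic lam (2 * π)
  deriv_TV : ∃ p : ℝ → ℝ, LocallyBoundedVariationOn p univ ∧
    ∀ s, lam s = lam 0 + ∫ x in (0 : ℝ)..s, p x

/-- The multivalued derivative of `w`: the segment between the left and the right derivative. -/
def hullDeriv (w : ℝ → ℝ) (s : ℝ) : Set ℝ :=
  uIcc (derivWithin w (Iio s) s) (derivWithin w (Ioi s) s)

/-- The multivalued angle `lam_s + s`, the derivative of `lam + s ^ 2 / 2`. -/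
def angle (lam : ℝ → ℝ) : ℝ → Set ℝ := hullDeriv (fun s => lam s + s ^ 2 / 2)

/-- `om` is an absolutely continuous selection of `∂J (u_s + s)` that realizes
`(u - v) / h ∈ d/ds ∂J (u_s + s)` on the circle: `om s - s` is `2π`-periodic,
`om s ∈ ∂J (u_s + s)` and `(u - v) / h = d/ds om` almost everywhere. -/
structure IsFlux (h : ℝ) (v u om : ℝ → ℝ) : Prop where
  add_two_pi : ∀ s, om (s + 2 * π) = om s + 2 * π
  absCont : ∀ a b, AbsolutelyContinuousOnInterval om a b
  mem_subdiff : ∀ᵐ s : ℝ, om s ∈ subdiff crystalJ (deriv u s + s)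
  hasDerivAt : ∀ᵐ s : ℝ, HasDerivAt om ((u s - v s) / h) s

/-- The profiles `lam 0, …, lam N` solve the implicit time discretization with step `h` and initial
profile `lam₀`. -/
structure IsSemiDiscrete (h : ℝ) (N : ℕ) (lam₀ : ℝ → ℝ) (lam : ℕ → ℝ → ℝ) : Prop where
  initial : lam 0 = lam₀
  profile : ∀ k ≤ N, IsProfile (lam k)
  step : ∀ k < N, ∃ om : ℝ → ℝ, IsFlux h (lam k) (lam (k + 1)) om

/-- The part of the old set `Ξ` that is left after removing all points that have newly entered one
of the sets `Ξ_j`. -/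
def oldFacets (φ ψ : ℝ → Set ℝ) : Set ℝ :=
  facets φ \ ⋃ j : ℤ, (facetSet ψ j \ facetSet φ j)

end

/-!
Differentiating the scheme turns it into an implicit inclusion for the angles: with `P` and `Q` the
old and the new angle, regarded as functions of bounded variation normalized at their jumps
(`IsAngleFn`), the flux `om` solves `h om'' = Q - P` with `om ∈ ∂J(Q)` (`IsFluxStep`). Everything is
derived from this inclusion, one step at a time.

*Contraction and regularity.* Multiplying the difference of two inclusions by the sign of the
difference of the fluxes shows that the step is a contraction of the angles in the mean
(`IsFluxStep.integral_abs_sub_le`), whence uniqueness (`IsFlux.unique`). Comparing a solution with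
its translates bounds the mean differences of `Q` by those of `P`; a function with linearly bounded
mean differences has a representative of bounded variation, so that the total variation does not
increase (`IsFluxStep.eVariationOn_le`).

*Existence.* The inverse of `∂J` is the staircase with values `α_j`. For a Lipschitz regularization
of the staircase, with a small zeroth order term, the equation is solved on the line by a fixed point
of the resolvent of the second derivative; its solutions satisfy uniform bounds, and a limit along an
ultrafilter solves the inclusion (`exists_isFluxStep`).

*Facets.* Off the new facets `∂J(Q)` is a single slope, so that `om` is locally constant and the
angle has not changed (`IsFluxStep.filledGraph_eq`); hence facets persist. If a new facet point in a
gap of the old facets had points off the new facets on both sides, `om` would take the same slope at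
both of them, and the maximum principle would make it constant in between, which leaves the angle
unchanged there. So every component of the new facets meets the old ones
(`IsFluxStep.exists_uIcc_subset_facets`), and their number does not increase. Where no new facet has
entered an old one, `Q = P`, so that `om'` is constant
(`IsFluxStep.W_eq_of_mem_connectedComponentIn`).

*Growth of the facets.* The angle changes only where it jumps to a preferred angle. Off its facets
the old angle is still the initial one, so that such a point is either displaced by at least `η`, or
the initial angle is there within `η` of a preferred angle without being equal to it
(`IsFluxStep.volume_ne_le`). The measure of the latter set tends to `0` with `η`. The former set is
estimated by the mean displacement: averaging `h om'' = Q - P` twice over a length `δ` gives second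
differences of the bounded function `om(s) - s`, with an error of order `δ` times the variation
(`IsFluxStep.integral_abs_displacement_le`). With `δ = η²` and `h = η⁶` everything is of order `η`.
-/

noncomputable section

/-! ### The subdifferential of the energy density -/

/-- The slope `(j - 1) π / 2` of `crystalJ` between the corners `α_j` and `α_{j+1}`; it is also the
midpoint of these corners. -/
def facetSlope (j : ℤ) : ℝ := (j - 1) * (π / 2)

theorem prefAngle_eq (j : ℤ) : prefAngle j = facetSlope j - π / 4 := by
  unfold prefAngle facetSlope; ring

theorem prefAngle_add_one (j : ℤ) : prefAngle (j + 1) = facetSlope j + π / 4 := by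
  unfold prefAngle facetSlope; push_cast; ring

theorem facetSlope_sub_one (j : ℤ) : facetSlope (j - 1) = prefAngle j - π / 4 := by
  unfold prefAngle facetSlope; push_cast; ring

theorem prefAngle_strictMono : StrictMono prefAngle := by
  intro i j hij
  have : (i : ℝ) < j := by exact_mod_cast hij
  unfold prefAngle
  nlinarith [pi_pos]

theorem pi_div_two_le_abs_prefAngle_sub {i j : ℤ} (hij : i ≠ j) :
    π / 2 ≤ |prefAngle i - prefAngle j| := by
  have h1 : prefAngle i - prefAngle j = ((i - j : ℤ) : ℝ) * (π / 2) := by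
    unfold prefAngle; push_cast; ring
  have h2 : (1 : ℝ) ≤ |((i - j : ℤ) : ℝ)| := by
    exact_mod_cast Int.one_le_abs (sub_ne_zero.2 hij)
  rw [h1, abs_mul, abs_of_pos (by positivity : 0 < π / 2)]
  nlinarith [pi_pos]

theorem prefAngle_add_four (j : ℤ) : prefAngle (j + 4) = prefAngle j + 2 * π := by
  unfold prefAngle; push_cast; ring

theorem exists_mem_Ico_prefAngle (x : ℝ) :
    ∃ j : ℤ, x ∈ Ico (prefAngle j) (prefAngle (j + 1)) := by
  have hp : 0 < π / 2 := by positivity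
  refine ⟨⌊(x + 3 * π / 4) / (π / 2)⌋, ?_, ?_⟩
  · have := (le_div_iff₀ hp).1 (Int.floor_le ((x + 3 * π / 4) / (π / 2)))
    unfold prefAngle; linarith
  · have := (div_lt_iff₀ hp).1 (Int.lt_floor_add_one ((x + 3 * π / 4) / (π / 2)))
    unfold prefAngle; push_cast; linarith

theorem crystalJ_of_abs_le {j : ℤ} {x : ℝ} (hx : |x - facetSlope j| ≤ π / 4) :
    crystalJ x = facetSlope j * x - facetSlope j ^ 2 / 2 + π ^ 2 / 2 := by
  have hpi := pi_pos
  obtain ⟨h1, h2⟩ := abs_le.1 hx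
  set t := toIcoMod two_pi_pos (-π) x with ht
  set n := toIcoDiv two_pi_pos (-π) x with hn
  have hmem := toIcoMod_mem_Ico two_pi_pos (-π) x
  rw [← ht] at hmem
  obtain ⟨h3, h4⟩ := hmem
  have hxt : x = t + n * (2 * π) := by
    have := toIcoMod_add_toIcoDiv_zsmul two_pi_pos (-π) x
    rw [← ht, ← hn, zsmul_eq_mul] at this
    exact this.symm
  obtain ⟨i, rfl⟩ : ∃ i : ℤ, j = i + 1 + 4 * n := ⟨j - 1 - 4 * n, by ring⟩
  have hs : facetSlope (i + 1 + 4 * n) = i * (π / 2) + n * (2 * π) := by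
    unfold facetSlope; push_cast; ring
  have key : crystalJ₀ t = i * (π / 2) * t - (i * (π / 2)) ^ 2 / 2 + π ^ 2 / 2 := by
    rw [hs, hxt] at h1 h2
    have hi1 : -3 < i := by
      by_contra! hc
      have : (i : ℝ) ≤ -3 := by exact_mod_cast hc
      nlinarith
    have hi2 : i < 3 := by
      by_contra! hc
      have : (3 : ℝ) ≤ i := by exact_mod_cast hc
      nlinarith
    unfold crystalJ₀
    interval_cases i <;> push_cast at *
    · rw [abs_of_nonpos (a := t - 3 * π / 4), abs_of_nonpos (a := t - π / 4),
        abs_of_nonpos (a := t + π / 4), abs_of_nonpos (a := t + 3 * π / 4)] <;> linarith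
    · rw [abs_of_nonpos (a := t - 3 * π / 4), abs_of_nonpos (a := t - π / 4),
        abs_of_nonpos (a := t + π / 4), abs_of_nonneg (a := t + 3 * π / 4)] <;> linarith
    · rw [abs_of_nonpos (a := t - 3 * π / 4), abs_of_nonpos (a := t - π / 4),
        abs_of_nonneg (a := t + π / 4), abs_of_nonneg (a := t + 3 * π / 4)] <;> linarith
    · rw [abs_of_nonpos (a := t - 3 * π / 4), abs_of_nonneg (a := t - π / 4),
        abs_of_nonneg (a := t + π / 4), abs_of_nonneg (a := t + 3 * π / 4)] <;> linarith
    · rw [abs_of_nonneg (a := t - 3 * π / 4), abs_of_nonneg (a := t - π / 4),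
        abs_of_nonneg (a := t + π / 4), abs_of_nonneg (a := t + 3 * π / 4)] <;> linarith
  unfold crystalJ
  rw [← ht, key, hs, hxt]
  ring

theorem le_crystalJ (j : ℤ) (x : ℝ) :
    facetSlope j * x - facetSlope j ^ 2 / 2 + π ^ 2 / 2 ≤ crystalJ x := by
  obtain ⟨i, h1, h2⟩ := exists_mem_Ico_prefAngle x
  rw [prefAngle_eq] at h1
  rw [prefAngle_add_one] at h2
  have hx : |x - facetSlope i| ≤ π / 4 := abs_le.2 ⟨by linarith, by linarith⟩
  rcases eq_or_ne i j with rfl | hij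
  · exact (crystalJ_of_abs_le hx).ge
  rw [crystalJ_of_abs_le hx]
  suffices (x - facetSlope i) ^ 2 ≤ (x - facetSlope j) ^ 2 by nlinarith
  apply sq_le_sq.2
  refine hx.trans ?_
  have := pi_div_two_le_abs_prefAngle_sub hij
  rw [prefAngle_eq, prefAngle_eq] at this
  have h3 : |facetSlope i - facetSlope j| ≤ |x - facetSlope i| + |x - facetSlope j| := by
    rw [abs_sub_comm x (facetSlope i)]
    exact (congrArg _ (by ring)).trans_le (abs_add_le (facetSlope i - x) (x - facetSlope j))
  rw [show facetSlope i - π / 4 - (facetSlope j - π / 4) = facetSlope i - facetSlope j by ring]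
    at this
  linarith

theorem facetSlope_mem_subdiff {j : ℤ} {x : ℝ}
    (hx : x ∈ Icc (prefAngle j) (prefAngle (j + 1))) : facetSlope j ∈ subdiff crystalJ x := by
  intro y
  rw [prefAngle_eq, prefAngle_add_one] at hx
  rw [crystalJ_of_abs_le (j := j) (abs_le.2 ⟨by linarith [hx.1], by linarith [hx.2]⟩)]
  linarith [le_crystalJ j y]

theorem mem_subdiff_prefAngle {j : ℤ} {p : ℝ}
    (hp : p ∈ Icc (prefAngle j - π / 4) (prefAngle j + π / 4)) :
    p ∈ subdiff crystalJ (prefAngle j) := by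
  intro y
  have h1 := facetSlope_mem_subdiff (j := j) (x := prefAngle j)
    ⟨le_rfl, prefAngle_strictMono.monotone (by simp)⟩ y
  have h2 := facetSlope_mem_subdiff (j := j - 1) (x := prefAngle j)
    ⟨prefAngle_strictMono.monotone (by simp), by simp⟩ y
  rw [facetSlope_sub_one] at h2
  have h3 := prefAngle_eq j
  rcases le_total (prefAngle j) y with h | h
  · nlinarith [hp.2]
  · nlinarith [hp.1]

theorem subdiff_monotone {J : ℝ → ℝ} {x y p q : ℝ} (hp : p ∈ subdiff J x)
    (hq : q ∈ subdiff J y) : 0 ≤ (p - q) * (x - y) := by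
  have h1 := hp y
  have h2 := hq x
  nlinarith

theorem le_of_mem_subdiff {j : ℤ} {x p : ℝ} (hp : p ∈ subdiff crystalJ x)
    (hx : prefAngle j < x) : facetSlope j ≤ p := by
  obtain ⟨y, hy1, hy2⟩ := exists_between
    (lt_min hx (prefAngle_strictMono (by lia : j < j + 1)))
  have h := subdiff_monotone hp
    (facetSlope_mem_subdiff ⟨hy1.le, (hy2.trans_le (min_le_right _ _)).le⟩)
  have : 0 < x - y := by linarith [min_le_left x (prefAngle (j + 1))]
  nlinarith

theorem ge_of_mem_subdiff {j : ℤ} {x p : ℝ} (hp : p ∈ subdiff crystalJ x)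
    (hx : x < prefAngle (j + 1)) : p ≤ facetSlope j := by
  obtain ⟨y, hy1, hy2⟩ := exists_between
    (max_lt hx (prefAngle_strictMono (by lia : j < j + 1)))
  have h := subdiff_monotone hp
    (facetSlope_mem_subdiff ⟨((le_max_right _ _).trans_lt hy1).le, hy2.le⟩)
  have : x - y < 0 := by linarith [le_max_left x (prefAngle j)]
  nlinarith

theorem eq_facetSlope_of_mem_subdiff {j : ℤ} {x p : ℝ} (hp : p ∈ subdiff crystalJ x)
    (hx : x ∈ Ioo (prefAngle j) (prefAngle (j + 1))) : p = facetSlope j :=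
  le_antisymm (ge_of_mem_subdiff hp hx.2) (le_of_mem_subdiff hp hx.1)

/-- Off the slopes of `crystalJ`, a flux value forces the angle to be a preferred one. -/
theorem exists_eq_prefAngle_of_mem_subdiff {x p : ℝ} (hp : p ∈ subdiff crystalJ x)
    (h : ∀ j, p ≠ facetSlope j) : ∃ j, x = prefAngle j := by
  obtain ⟨j, h1, h2⟩ := exists_mem_Ico_prefAngle x
  rcases h1.eq_or_lt with h1 | h1
  · exact ⟨j, h1.symm⟩
  · exact absurd (eq_facetSlope_of_mem_subdiff hp ⟨h1, h2⟩) (h j)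

theorem abs_sub_le_of_mem_subdiff {x p : ℝ} (hp : p ∈ subdiff crystalJ x) : |p - x| ≤ π / 4 := by
  obtain ⟨j, h1, h2⟩ := exists_mem_Ico_prefAngle x
  have h3 := ge_of_mem_subdiff hp h2
  have e1 := prefAngle_eq j
  have e2 := prefAngle_add_one j
  rcases h1.eq_or_lt with h1 | h1
  · have := le_of_mem_subdiff (j := j - 1) hp
      (h1 ▸ prefAngle_strictMono (by lia : j - 1 < j))
    rw [facetSlope_sub_one] at this
    exact abs_le.2 ⟨by linarith, by linarith⟩
  · have := le_of_mem_subdiff hp h1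
    exact abs_le.2 ⟨by linarith, by linarith⟩

/-! ### Functions of bounded variation and their one-sided limits -/

theorem frequently_nhdsLT_of_ae {q : ℝ → Prop} (hq : ∀ᵐ x, q x) (s : ℝ) : ∃ᶠ x in 𝓝[<] s, q x := by
  intro h
  obtain ⟨a, ha, hsub⟩ := mem_nhdsLT_iff_exists_Ioo_subset.1 h
  have h0 : volume (Ioo a s) = 0 := measure_mono_null hsub hq
  rw [Real.volume_Ioo, ENNReal.ofReal_eq_zero] at h0
  exact absurd h0 (not_le.2 (sub_pos.2 ha))

theorem frequently_nhdsGT_of_ae {q : ℝ → Prop} (hq : ∀ᵐ x, q x) (s : ℝ) : ∃ᶠ x in 𝓝[>] s, q x := by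
  intro h
  obtain ⟨a, ha, hsub⟩ := mem_nhdsGT_iff_exists_Ioo_subset.1 h
  have h0 : volume (Ioo s a) = 0 := measure_mono_null hsub hq
  rw [Real.volume_Ioo, ENNReal.ofReal_eq_zero] at h0
  exact absurd h0 (not_le.2 (sub_pos.2 ha))

section BV

variable {P Q : ℝ → ℝ}

theorem LocallyBoundedVariationOn.exists_monotone_sub (hP : LocallyBoundedVariationOn P univ) :
    ∃ f g : ℝ → ℝ, Monotone f ∧ Monotone g ∧ P = f - g := by
  obtain ⟨f, g, hf, hg, h⟩ := hP.exists_monotoneOn_sub_monotoneOn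
  exact ⟨f, g, monotoneOn_univ.1 hf, monotoneOn_univ.1 hg, h⟩

theorem LocallyBoundedVariationOn.tendsto_nhdsLT (hP : LocallyBoundedVariationOn P univ) (s : ℝ) :
    Tendsto P (𝓝[<] s) (𝓝 (Function.leftLim P s)) := by
  obtain ⟨f, g, hf, hg, rfl⟩ := hP.exists_monotone_sub
  exact tendsto_leftLim_of_tendsto ⟨_, (hf.tendsto_leftLim s).sub (hg.tendsto_leftLim s)⟩

theorem LocallyBoundedVariationOn.tendsto_nhdsGT (hP : LocallyBoundedVariationOn P univ) (s : ℝ) :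
    Tendsto P (𝓝[>] s) (𝓝 (Function.rightLim P s)) := by
  obtain ⟨f, g, hf, hg, rfl⟩ := hP.exists_monotone_sub
  exact tendsto_rightLim_of_tendsto ⟨_, (hf.tendsto_rightLim s).sub (hg.tendsto_rightLim s)⟩

theorem LocallyBoundedVariationOn.measurable (hP : LocallyBoundedVariationOn P univ) :
    Measurable P := by
  obtain ⟨f, g, hf, hg, rfl⟩ := hP.exists_monotone_sub
  exact hf.measurable.sub hg.measurable

theorem LocallyBoundedVariationOn.intervalIntegrable (hP : LocallyBoundedVariationOn P univ)
    (a b : ℝ) : IntervalIntegrable P volume a b := by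
  obtain ⟨f, g, hf, hg, rfl⟩ := hP.exists_monotone_sub
  exact hf.intervalIntegrable.sub hg.intervalIntegrable

theorem LocallyBoundedVariationOn.ae_continuousAt (hP : LocallyBoundedVariationOn P univ) :
    ∀ᵐ s, ContinuousAt P s := by
  filter_upwards [hP.ae_differentiableAt] with s hs using hs.continuousAt

theorem LocallyBoundedVariationOn.leftLim_congr (hP : LocallyBoundedVariationOn P univ)
    (hQ : LocallyBoundedVariationOn Q univ) {O : Set ℝ} {s : ℝ} (hO : O ∈ 𝓝 s)
    (h : ∀ᵐ x, x ∈ O → P x = Q x) : Function.leftLim P s = Function.leftLim Q s := by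
  refine tendsto_nhds_unique_of_frequently_eq (hP.tendsto_nhdsLT s) (hQ.tendsto_nhdsLT s) ?_
  exact ((frequently_nhdsLT_of_ae h s).and_eventually (mem_nhdsWithin_of_mem_nhds hO)).mono
    fun x hx => hx.1 hx.2

theorem LocallyBoundedVariationOn.rightLim_congr (hP : LocallyBoundedVariationOn P univ)
    (hQ : LocallyBoundedVariationOn Q univ) {O : Set ℝ} {s : ℝ} (hO : O ∈ 𝓝 s)
    (h : ∀ᵐ x, x ∈ O → P x = Q x) : Function.rightLim P s = Function.rightLim Q s := by
  refine tendsto_nhds_unique_of_frequently_eq (hP.tendsto_nhdsGT s) (hQ.tendsto_nhdsGT s) ?_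
  exact ((frequently_nhdsGT_of_ae h s).and_eventually (mem_nhdsWithin_of_mem_nhds hO)).mono
    fun x hx => hx.1 hx.2

/-- The variation does not increase if every value of a function is replaced by a cluster value at
the same point. -/
theorem eVariationOn_le_of_mapClusterPt {f g : ℝ → ℝ} {s : Set ℝ}
    (hg : ∀ x ∈ s, MapClusterPt (g x) (𝓝[s] x) f) : eVariationOn g s ≤ eVariationOn f s := by
  rw [eVariationOn.eVariationOn_eq_strictMonoOn]
  apply iSup_le
  rintro ⟨n, u, u_mono, u_mem⟩
  apply le_of_forall_lt (fun c hc ↦ ?_)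
  have : ∀ᶠ (b : ℕ → ℝ) in 𝓝 (fun i ↦ g (u i)),
      c < ∑ i ∈ Finset.range n, edist (b (i + 1)) (b i) := by
    have : Continuous (fun (v : ℕ → ℝ) ↦ ∑ i ∈ Finset.range n, edist (v (i + 1)) (v i)) := by
      fun_prop
    exact (tendsto_order.1 (this.continuousAt (x := fun i ↦ g (u i))).tendsto).1 c hc
  rw [nhds_pi] at this
  obtain ⟨I, I_fin, t, t_mem, ht⟩ := mem_pi.1 this
  have : ∀ᶠ b in 𝓝 u, ∀ i ∈ ((Finset.Iic n) ×ˢ (Finset.Iic n)).filter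
      (fun i ↦ i.1 < i.2), b i.1 < b i.2 := by
    rw [Filter.eventually_all_finset]
    intro i hi
    apply IsOpen.mem_nhds ?_ (by grind [StrictMonoOn])
    exact isOpen_lt (by fun_prop) (by fun_prop)
  rw [nhds_pi] at this
  obtain ⟨J, J_fin, k, k_mem, hk⟩ := mem_pi.1 this
  have A i (hi : i ∈ Iic n) : ∃ x, (f x ∈ t i ∧ x ∈ k i) ∧ x ∈ s :=
    ((((mapClusterPt_iff_frequently.1 (hg (u i) (u_mem i hi)) (t i) (t_mem i))).and_eventually
      (mem_nhdsWithin_of_mem_nhds (k_mem i))).and_eventually self_mem_nhdsWithin).exists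
  choose! v hv h'v using A
  have : c < ∑ i ∈ Finset.range n, edist (f (v (i + 1))) (f (v i)) := by
    let f' i := if i ∈ Iic n then f (v i) else g (u i)
    have : ∑ i ∈ Finset.range n, edist (f (v (i + 1))) (f (v i)) =
        ∑ i ∈ Finset.range n, edist (f' (i + 1)) (f' i) :=
      Finset.sum_congr rfl (fun i hi ↦ by grind)
    rw [this]
    suffices H : f' ∈ I.pi t from ht H
    have A i : g (u i) ∈ t i := mem_of_mem_nhds (t_mem i)
    grind
  apply this.trans_le
  have v_mono : StrictMonoOn v (Iic n) := by
    let w i := if i ∈ Iic n then v i else u i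
    suffices w ∈ J.pi k by
      have := hk this
      simp only [Finset.mem_filter, Finset.mem_product, Finset.mem_Iic, and_imp, Prod.forall,
        mem_ofPred_eq] at this
      grind [StrictMonoOn]
    have A i : u i ∈ k i := mem_of_mem_nhds (k_mem i)
    grind
  exact eVariationOn.sum_le_of_monotoneOn_Iic v_mono.monotoneOn (by grind)

/-- The largest selection of the multifunction obtained by filling the jumps of `P`. -/
def upperSelection (P : ℝ → ℝ) (s : ℝ) : ℝ := max (Function.leftLim P s) (Function.rightLim P s)

theorem LocallyBoundedVariationOn.leftLim_eq (hP : LocallyBoundedVariationOn P univ) {s : ℝ}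
    (hs : ContinuousAt P s) : Function.leftLim P s = P s :=
  tendsto_nhds_unique (hP.tendsto_nhdsLT s) (hs.tendsto.mono_left nhdsWithin_le_nhds)

theorem LocallyBoundedVariationOn.rightLim_eq (hP : LocallyBoundedVariationOn P univ) {s : ℝ}
    (hs : ContinuousAt P s) : Function.rightLim P s = P s :=
  tendsto_nhds_unique (hP.tendsto_nhdsGT s) (hs.tendsto.mono_left nhdsWithin_le_nhds)

theorem LocallyBoundedVariationOn.upperSelection_eq (hP : LocallyBoundedVariationOn P univ) {s : ℝ}
    (hs : ContinuousAt P s) : upperSelection P s = P s := by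
  rw [upperSelection, hP.leftLim_eq hs, hP.rightLim_eq hs, max_self]

theorem LocallyBoundedVariationOn.upperSelection_ae_eq (hP : LocallyBoundedVariationOn P univ) :
    upperSelection P =ᵐ[volume] P := by
  filter_upwards [hP.ae_continuousAt] with s hs using hP.upperSelection_eq hs

theorem LocallyBoundedVariationOn.mapClusterPt_upperSelection
    (hP : LocallyBoundedVariationOn P univ) {s : ℝ} {O : Set ℝ} (hO : O ∈ 𝓝 s) :
    MapClusterPt (upperSelection P s) (𝓝[O] s) P := by
  rw [nhdsWithin_eq_nhds.2 hO]
  rcases max_choice (Function.leftLim P s) (Function.rightLim P s) with h | h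
  · rw [upperSelection, h]
    exact (hP.tendsto_nhdsLT s).mapClusterPt.mono nhdsWithin_le_nhds
  · rw [upperSelection, h]
    exact (hP.tendsto_nhdsGT s).mapClusterPt.mono nhdsWithin_le_nhds

theorem LocallyBoundedVariationOn.upperSelection (hP : LocallyBoundedVariationOn P univ) :
    LocallyBoundedVariationOn (upperSelection P) univ := by
  intro a b _ _
  rw [univ_inter]
  have h1 : eVariationOn (_root_.upperSelection P) (Ioo (a - 1) (b + 1)) ≤
      eVariationOn P (Ioo (a - 1) (b + 1)) :=
    eVariationOn_le_of_mapClusterPt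
      fun x hx => hP.mapClusterPt_upperSelection (isOpen_Ioo.mem_nhds hx)
  have h2 := hP (a - 1) (b + 1) (mem_univ _) (mem_univ _)
  rw [univ_inter] at h2
  refine ne_top_of_le_ne_top h2 ?_
  calc _ ≤ eVariationOn (_root_.upperSelection P) (Ioo (a - 1) (b + 1)) :=
        eVariationOn.mono _ fun x hx => ⟨by linarith [hx.1], by linarith [hx.2]⟩
    _ ≤ _ := h1.trans (eVariationOn.mono _ Ioo_subset_Icc_self)

/-- On a compact interval the upper selection has at most the variation of the function, provided
that the function is continuous at the end points. -/
theorem LocallyBoundedVariationOn.eVariationOn_upperSelection_le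
    (hP : LocallyBoundedVariationOn P univ) {a b : ℝ} (ha : ContinuousAt P a)
    (hb : ContinuousAt P b) :
    eVariationOn (_root_.upperSelection P) (Icc a b) ≤ eVariationOn P (Icc a b) := by
  refine eVariationOn_le_of_mapClusterPt fun x hx => ?_
  have key : ∀ y ∈ Icc a b, ContinuousAt P y →
      MapClusterPt (_root_.upperSelection P y) (𝓝[Icc a b] y) P := by
    intro y hy hc
    rw [hP.upperSelection_eq hc]
    have : (𝓝[Icc a b] y).NeBot := mem_closure_iff_nhdsWithin_neBot.1 (subset_closure hy)
    exact (hc.tendsto.mono_left nhdsWithin_le_nhds).mapClusterPt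
  rcases hx.1.eq_or_lt with rfl | h1
  · exact key _ hx ha
  rcases hx.2.eq_or_lt with rfl | h2
  · exact key _ hx hb
  exact hP.mapClusterPt_upperSelection (Icc_mem_nhds h1 h2)

/-- The multifunction obtained from `P` by filling each jump with a segment. -/
def filledGraph (P : ℝ → ℝ) (s : ℝ) : Set ℝ := uIcc (Function.leftLim P s) (Function.rightLim P s)

theorem sSup_filledGraph (P : ℝ → ℝ) (s : ℝ) : sSup (filledGraph P s) = upperSelection P s :=
  csSup_Icc min_le_max

theorem LocallyBoundedVariationOn.filledGraph_congr (hP : LocallyBoundedVariationOn P univ)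
    (hQ : LocallyBoundedVariationOn Q univ) {O : Set ℝ} {s : ℝ} (hO : O ∈ 𝓝 s)
    (h : ∀ᵐ x, x ∈ O → P x = Q x) : filledGraph P s = filledGraph Q s := by
  rw [filledGraph, filledGraph, hP.leftLim_congr hQ hO h, hP.rightLim_congr hQ hO h]

theorem LocallyBoundedVariationOn.filledGraph_eq (hP : LocallyBoundedVariationOn P univ) {s : ℝ}
    (hs : ContinuousAt P s) : filledGraph P s = {P s} := by
  rw [filledGraph, hP.leftLim_eq hs, hP.rightLim_eq hs, uIcc_self]

theorem isMaximalTV_filledGraph (hP : LocallyBoundedVariationOn P univ) :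
    IsMaximalTV (filledGraph P) := ⟨P, hP, fun _ => rfl⟩

/-- Upper semicontinuity of the filled graph. -/
theorem LocallyBoundedVariationOn.eventually_filledGraph_subset
    (hP : LocallyBoundedVariationOn P univ) {s a b : ℝ} (h : filledGraph P s ⊆ Ioo a b) :
    ∀ᶠ t in 𝓝 s, filledGraph P t ⊆ Ioo a b := by
  have hl := h left_mem_uIcc
  have hr := h right_mem_uIcc
  obtain ⟨a', ha1, ha2⟩ := exists_between (lt_min hl.1 hr.1)
  obtain ⟨b', hb1, hb2⟩ := exists_between (max_lt hl.2 hr.2)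
  have hsub : ∀ t, Function.leftLim P t ∈ Icc a' b' → Function.rightLim P t ∈ Icc a' b' →
      filledGraph P t ⊆ Ioo a b := fun t h1 h2 =>
    ((convex_Icc a' b').ordConnected.uIcc_subset h1 h2).trans (Icc_subset_Ioo ha1 hb2)
  have hL : ∀ᶠ x in 𝓝[<] s, P x ∈ Icc a' b' :=
    (hP.tendsto_nhdsLT s).eventually (Icc_mem_nhds (lt_min_iff.1 ha2).1 (max_lt_iff.1 hb1).1)
  have hR : ∀ᶠ x in 𝓝[>] s, P x ∈ Icc a' b' :=
    (hP.tendsto_nhdsGT s).eventually (Icc_mem_nhds (lt_min_iff.1 ha2).2 (max_lt_iff.1 hb1).2)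
  have hev : ∀ t, (∀ᶠ x in 𝓝 t, P x ∈ Icc a' b') → filledGraph P t ⊆ Ioo a b := fun t ht =>
    hsub t (isClosed_Icc.mem_of_tendsto (hP.tendsto_nhdsLT t) (ht.filter_mono nhdsWithin_le_nhds))
      (isClosed_Icc.mem_of_tendsto (hP.tendsto_nhdsGT t) (ht.filter_mono nhdsWithin_le_nhds))
  obtain ⟨l, hls, hl'⟩ := mem_nhdsLT_iff_exists_Ioo_subset.1 hL
  obtain ⟨r, hrs, hr'⟩ := mem_nhdsGT_iff_exists_Ioo_subset.1 hR
  filter_upwards [Ioo_mem_nhds hls hrs] with t ht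
  rcases lt_trichotomy t s with hts | rfl | hts
  · exact hev t (mem_of_superset (Ioo_mem_nhds ht.1 hts) hl')
  · exact h
  · exact hev t (mem_of_superset (Ioo_mem_nhds hts ht.2) hr')

end BV

/-! ### Angle functions and their canonical selections -/

/-- Single-valued angle functions on the circle, normalized to take the larger of the two one-sided
limits at each point, so that they are determined by their values almost everywhere. -/
structure IsAngleFn (P : ℝ → ℝ) : Prop where
  bv : LocallyBoundedVariationOn P univ
  add_two_pi : ∀ s, P (s + 2 * π) = P s + 2 * π
  upperSelection_eq : upperSelection P = P

theorem upperSelection_congr {P Q : ℝ → ℝ} (hP : LocallyBoundedVariationOn P univ)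
    (hQ : LocallyBoundedVariationOn Q univ) (h : P =ᵐ[volume] Q) :
    upperSelection P = upperSelection Q := by
  funext s
  have h' : ∀ᵐ x, x ∈ (univ : Set ℝ) → P x = Q x := by filter_upwards [h] with x hx _ using hx
  rw [upperSelection, upperSelection, hP.leftLim_congr hQ univ_mem h',
    hP.rightLim_congr hQ univ_mem h']

theorem IsAngleFn.ext {P Q : ℝ → ℝ} (hP : IsAngleFn P) (hQ : IsAngleFn Q) (h : P =ᵐ[volume] Q) :
    P = Q := by
  rw [← hP.upperSelection_eq, ← hQ.upperSelection_eq, upperSelection_congr hP.bv hQ.bv h]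

theorem leftLim_add_two_pi {P : ℝ → ℝ} (hP : LocallyBoundedVariationOn P univ)
    (h : ∀ᵐ s, P (s + 2 * π) = P s + 2 * π) (s : ℝ) :
    Function.leftLim P (s + 2 * π) = Function.leftLim P s + 2 * π := by
  have h1 : Tendsto (fun x => P (x + 2 * π)) (𝓝[<] s) (𝓝 (Function.leftLim P (s + 2 * π))) := by
    refine (hP.tendsto_nhdsLT _).comp ?_
    refine tendsto_nhdsWithin_iff.2 ⟨?_, ?_⟩
    · exact (continuous_add_const _).continuousAt.tendsto.mono_left nhdsWithin_le_nhds
    · filter_upwards [self_mem_nhdsWithin] with x hx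
      simpa using hx
  exact tendsto_nhds_unique_of_frequently_eq h1 ((hP.tendsto_nhdsLT s).add_const (2 * π))
    (frequently_nhdsLT_of_ae h s)

theorem rightLim_add_two_pi {P : ℝ → ℝ} (hP : LocallyBoundedVariationOn P univ)
    (h : ∀ᵐ s, P (s + 2 * π) = P s + 2 * π) (s : ℝ) :
    Function.rightLim P (s + 2 * π) = Function.rightLim P s + 2 * π := by
  have h1 : Tendsto (fun x => P (x + 2 * π)) (𝓝[>] s) (𝓝 (Function.rightLim P (s + 2 * π))) := by
    refine (hP.tendsto_nhdsGT _).comp ?_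
    refine tendsto_nhdsWithin_iff.2 ⟨?_, ?_⟩
    · exact (continuous_add_const _).continuousAt.tendsto.mono_left nhdsWithin_le_nhds
    · filter_upwards [self_mem_nhdsWithin] with x hx
      simpa using hx
  exact tendsto_nhds_unique_of_frequently_eq h1 ((hP.tendsto_nhdsGT s).add_const (2 * π))
    (frequently_nhdsGT_of_ae h s)

theorem isAngleFn_upperSelection {P : ℝ → ℝ} (hP : LocallyBoundedVariationOn P univ)
    (h : ∀ᵐ s, P (s + 2 * π) = P s + 2 * π) : IsAngleFn (upperSelection P) where
  bv := hP.upperSelection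
  add_two_pi s := by
    rw [upperSelection, leftLim_add_two_pi hP h, rightLim_add_two_pi hP h, max_add_add_right]
    rfl
  upperSelection_eq := upperSelection_congr hP.upperSelection hP hP.upperSelection_ae_eq

theorem IsAngleFn.filledGraph_add_two_pi {P : ℝ → ℝ} (hP : IsAngleFn P) (s : ℝ) :
    filledGraph P (s + 2 * π) = (fun x => x + 2 * π) '' filledGraph P s := by
  rw [filledGraph, filledGraph, leftLim_add_two_pi hP.bv (.of_forall hP.add_two_pi),
    rightLim_add_two_pi hP.bv (.of_forall hP.add_two_pi), image_add_const_uIcc]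

theorem IsAngleFn.circleTV_filledGraph {P : ℝ → ℝ} (hP : IsAngleFn P) :
    circleTV (filledGraph P) = eVariationOn P (Icc 0 (2 * π)) := by
  unfold circleTV
  congr 1
  funext s
  rw [sSup_filledGraph, hP.upperSelection_eq]

/-! ### Profiles and their angle functions -/

theorem eVariationOn_Icc_le {f G : ℝ → ℝ} {a b : ℝ}
    (h : ∀ x ∈ Icc a b, ∀ y ∈ Icc a b, x ≤ y → |f y - f x| ≤ G y - G x) :
    eVariationOn f (Icc a b) ≤ ENNReal.ofReal (G b - G a) := by
  apply iSup_le
  rintro ⟨n, u, hu, hmem⟩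
  have hG : ∀ x ∈ Icc a b, ∀ y ∈ Icc a b, x ≤ y → G x ≤ G y := fun x hx y hy hxy => by
    linarith [abs_nonneg (f y - f x), h x hx y hy hxy]
  have hab : a ≤ b := (hmem 0).1.trans (hmem 0).2
  calc ∑ i ∈ Finset.range n, edist (f (u (i + 1))) (f (u i))
      ≤ ∑ i ∈ Finset.range n, ENNReal.ofReal (G (u (i + 1)) - G (u i)) := by
        refine Finset.sum_le_sum fun i _ => ?_
        rw [edist_dist, Real.dist_eq]
        exact ENNReal.ofReal_le_ofReal (h _ (hmem i) _ (hmem (i + 1)) (hu (Nat.le_succ i)))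
    _ = ENNReal.ofReal (G (u n) - G (u 0)) := by
        rw [← ENNReal.ofReal_sum_of_nonneg, Finset.sum_range_sub (fun i => G (u i))]
        intro i _
        linarith [hG _ (hmem i) _ (hmem (i + 1)) (hu (Nat.le_succ i))]
    _ ≤ _ := by
        refine ENNReal.ofReal_le_ofReal ?_
        linarith [hG _ (hmem n) b ⟨hab, le_rfl⟩ (hmem n).2, hG a ⟨le_rfl, hab⟩ _ (hmem 0) (hmem 0).1]

theorem Monotone.locallyBoundedVariationOn_sub {f g : ℝ → ℝ} (hf : Monotone f) (hg : Monotone g) :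
    LocallyBoundedVariationOn (fun x => f x - g x) univ := by
  intro a b _ _
  rw [univ_inter]
  refine ne_top_of_le_ne_top ENNReal.ofReal_ne_top
    (eVariationOn_Icc_le (G := fun x => f x + g x) fun x _ y _ hxy => ?_)
  have h1 := hf hxy
  have h2 := hg hxy
  exact abs_le.2 ⟨by linarith, by linarith⟩

theorem LocallyBoundedVariationOn.locallyIntegrable {P : ℝ → ℝ}
    (hP : LocallyBoundedVariationOn P univ) : LocallyIntegrable P volume := by
  obtain ⟨f, g, hf, hg, rfl⟩ := hP.exists_monotone_sub
  exact hf.locallyIntegrable.sub hg.locallyIntegrable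

theorem hasDerivWithinAt_integral_Iio {P : ℝ → ℝ} (hP : LocallyBoundedVariationOn P univ)
    (a s : ℝ) :
    HasDerivWithinAt (fun x => ∫ y in a..x, P y) (Function.leftLim P s) (Iio s) s := by
  refine (intervalIntegral.integral_hasDerivWithinAt_of_tendsto_ae_right (t := Iic s)
    (s := Iic s) (hP.intervalIntegrable a s)
    hP.measurable.stronglyMeasurable.stronglyMeasurableAtFilter ?_).mono Iio_subset_Iic_self
  refine (hP.tendsto_nhdsLT s).mono_left ?_
  rw [← Iic_sdiff_right, sdiff_eq, nhdsWithin_inter']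
  exact inf_le_inf_left _ (le_principal_iff.2 (compl_mem_ae_iff.2 (measure_singleton s)))

theorem hasDerivWithinAt_integral_Ioi {P : ℝ → ℝ} (hP : LocallyBoundedVariationOn P univ)
    (a s : ℝ) :
    HasDerivWithinAt (fun x => ∫ y in a..x, P y) (Function.rightLim P s) (Ioi s) s := by
  refine (intervalIntegral.integral_hasDerivWithinAt_of_tendsto_ae_right (t := Ioi s)
    (s := Ici s) (hP.intervalIntegrable a s)
    hP.measurable.stronglyMeasurable.stronglyMeasurableAtFilter ?_).mono Ioi_subset_Ici_self
  exact (hP.tendsto_nhdsGT s).mono_left inf_le_left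

/-- `P` is a density of `lam + s² / 2`. -/
def IsAngleDensity (lam P : ℝ → ℝ) : Prop :=
  ∀ a b, lam b + b ^ 2 / 2 - (lam a + a ^ 2 / 2) = ∫ x in a..b, P x

theorem IsAngleDensity.congr {lam P Q : ℝ → ℝ} (h : IsAngleDensity lam P) (hPQ : P =ᵐ[volume] Q) :
    IsAngleDensity lam Q := by
  intro a b
  rw [h a b]
  refine intervalIntegral.integral_congr_ae ?_
  filter_upwards [hPQ] with x hx _ using hx

theorem IsAngleDensity.eq {lam P : ℝ → ℝ} (h : IsAngleDensity lam P) :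
    (fun s => lam s + s ^ 2 / 2) = fun s => (∫ x in (0 : ℝ)..s, P x) + lam 0 := by
  funext s
  rw [← h 0 s]; ring

theorem IsAngleDensity.angle_eq {lam P : ℝ → ℝ} (h : IsAngleDensity lam P)
    (hP : LocallyBoundedVariationOn P univ) : angle lam = filledGraph P := by
  funext s
  unfold angle hullDeriv filledGraph
  rw [h.eq, ((hasDerivWithinAt_integral_Iio hP 0 s).add_const _).derivWithin
    (uniqueDiffWithinAt_Iio s), ((hasDerivWithinAt_integral_Ioi hP 0 s).add_const _).derivWithin
    (uniqueDiffWithinAt_Ioi s)]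

theorem IsAngleDensity.ae_hasDerivAt {lam P : ℝ → ℝ} (h : IsAngleDensity lam P)
    (hP : LocallyIntegrable P volume) : ∀ᵐ s, HasDerivAt lam (P s - s) s := by
  filter_upwards [LocallyIntegrable.ae_hasDerivAt_integral hP] with s hs
  have h1 : HasDerivAt (fun s => lam s + s ^ 2 / 2) (P s) s := by
    rw [h.eq]; exact (hs 0).add_const _
  have h2 : HasDerivAt (fun s : ℝ => s ^ 2 / 2) s s := by
    simpa using (hasDerivAt_pow 2 s).div_const 2
  simpa [Pi.sub_def] using h1.sub h2

theorem ae_add_two_pi {q : ℝ → Prop} (h : ∀ᵐ s, q s) (c : ℝ) : ∀ᵐ s, q (s + c) :=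
  (measurePreserving_add_right volume c).quasiMeasurePreserving.ae h

/-- Every profile has a normalized angle function. -/
theorem IsProfile.exists_isAngleFn {lam : ℝ → ℝ} (h : IsProfile lam) :
    ∃ P, IsAngleFn P ∧ IsAngleDensity lam P := by
  obtain ⟨p, hp, hlam⟩ := h.deriv_TV
  have hbv : LocallyBoundedVariationOn (fun s => p s + s) univ := by
    obtain ⟨f, g, hf, hg, rfl⟩ := hp.exists_monotone_sub
    have h1 : Monotone (fun s => f s + s) := hf.add monotone_id
    convert h1.locallyBoundedVariationOn_sub hg using 1
    funext s; simp only [Pi.sub_apply]; ring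
  have hden : IsAngleDensity lam (fun s => p s + s) := by
    intro a b
    rw [intervalIntegral.integral_add (hp.intervalIntegrable a b)
      (continuous_id'.intervalIntegrable a b), integral_id, hlam a, hlam b]
    have := intervalIntegral.integral_add_adjacent_intervals (hp.intervalIntegrable 0 a)
      (hp.intervalIntegrable a b)
    linarith
  have hd := hden.ae_hasDerivAt hbv.locallyIntegrable
  have hper : ∀ᵐ s, p (s + 2 * π) + (s + 2 * π) = p s + s + 2 * π := by
    filter_upwards [hd, ae_add_two_pi hd (2 * π)] with s h1 h2
    have h3 := h2.comp_add_const s (2 * π)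
    have h4 : (fun x => lam (x + 2 * π)) = lam := funext h.periodic
    rw [h4] at h3
    have := h1.unique h3
    linarith
  exact ⟨_, isAngleFn_upperSelection hbv hper, hden.congr hbv.upperSelection_ae_eq.symm⟩

theorem isProfile_of_isAngleDensity {u Q : ℝ → ℝ} (hQ : LocallyBoundedVariationOn Q univ)
    (h : IsAngleDensity u Q) (hper : Function.Periodic u (2 * π)) : IsProfile u where
  periodic := hper
  deriv_TV := by
    refine ⟨fun s => Q s - s, ?_, fun s => ?_⟩
    · obtain ⟨f, g, hf, hg, rfl⟩ := hQ.exists_monotone_sub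
      convert hf.locallyBoundedVariationOn_sub (hg.add monotone_id) using 1
      funext s; simp only [Pi.sub_apply, id]; ring
    · rw [intervalIntegral.integral_sub (hQ.intervalIntegrable 0 s)
        (continuous_id'.intervalIntegrable 0 s), integral_id, ← h 0 s]
      ring

/-! ### Contraction in the mean -/

/-- The derivative of a function vanishes almost everywhere on its zero set. -/
theorem ae_deriv_eq_zero_of_eq_zero {f f' : ℝ → ℝ} (hf : ∀ᵐ s, HasDerivAt f (f' s) s) :
    ∀ᵐ s, f s = 0 → f' s = 0 := by
  have hc := (countable_setOfPred_isolated_right_within (s := {x | f x = 0})).ae_notMem volume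
  filter_upwards [hf, hc] with s hs hiso h0
  have hne : (𝓝[{x | f x = 0} ∩ Ioi s] s).NeBot := ⟨fun hb => hiso ⟨h0, hb⟩⟩
  have h1 : Tendsto (slope f s) (𝓝[{x | f x = 0} ∩ Ioi s] s) (𝓝 (f' s)) :=
    (hasDerivAt_iff_tendsto_slope.1 hs).mono_left (nhdsWithin_mono _ fun x hx => hx.2.ne')
  refine tendsto_nhds_unique h1 (tendsto_const_nhds.congr' ?_)
  filter_upwards [self_mem_nhdsWithin] with x hx
  have hx0 : f x = 0 := hx.1
  simp [slope_def_field, hx0, h0]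

theorem MeasureTheory.LocallyIntegrable.intervalIntegrable' {f : ℝ → ℝ}
    (hf : LocallyIntegrable f volume) (a b : ℝ) : IntervalIntegrable f volume a b :=
  intervalIntegrable_iff.mpr <| (hf.integrableOn_isCompact isCompact_uIcc).mono_set uIoc_subset_uIcc

theorem locallyIntegrable_of_intervalIntegrable {f : ℝ → ℝ}
    (hf : ∀ a b, IntervalIntegrable f volume a b) : LocallyIntegrable f volume := fun x =>
  ⟨Ioc (x - 1) (x + 1), Ioc_mem_nhds (by linarith) (by linarith),
    (intervalIntegrable_iff_integrableOn_Ioc_of_le (by linarith)).1 (hf _ _)⟩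

theorem MeasureTheory.LocallyIntegrable.comp_add {f : ℝ → ℝ} (hf : LocallyIntegrable f volume)
    (c : ℝ) : LocallyIntegrable (fun x => f (x + c)) volume :=
  locallyIntegrable_of_intervalIntegrable fun a b => by
    simpa using (hf.intervalIntegrable' (a + c) (b + c)).comp_add_right c

theorem ae_hasDerivAt_of_sub_eq_integral {e g : ℝ → ℝ} (he : ∀ a b, e b - e a = ∫ x in a..b, g x)
    (hg : LocallyIntegrable g volume) : ∀ᵐ s, HasDerivAt e (g s) s := by
  have : e = fun x => (∫ y in (0 : ℝ)..x, g y) + e 0 := by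
    funext x; rw [← he 0 x]; ring
  filter_upwards [LocallyIntegrable.ae_hasDerivAt_integral hg] with s hs
  rw [this]
  exact (hs 0).add_const _

theorem absolutelyContinuous_of_sub_eq_integral {e g : ℝ → ℝ}
    (he : ∀ a b, e b - e a = ∫ x in a..b, g x) (hg : LocallyIntegrable g volume) (a b : ℝ) :
    AbsolutelyContinuousOnInterval e a b := by
  have : e = fun x => (∫ y in a..x, g y) + e a := by
    funext x; rw [← he a x]; ring
  rw [this]
  refine ((hg.intervalIntegrable' a b).absolutelyContinuousOnInterval_intervalIntegral
    left_mem_uIcc).add ?_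
  exact (LipschitzWith.const (e a)).lipschitzOnWith.absolutelyContinuousOnInterval

theorem continuous_of_sub_eq_integral {e g : ℝ → ℝ}
    (he : ∀ a b, e b - e a = ∫ x in a..b, g x) (hg : LocallyIntegrable g volume) :
    Continuous e := by
  have : e = fun x => (∫ y in (0 : ℝ)..x, g y) + e 0 := by
    funext x; rw [← he 0 x]; ring
  rw [this]
  exact (intervalIntegral.continuous_primitive hg.intervalIntegrable' 0).add continuous_const

theorem absolutelyContinuous_of_hasDerivAt {f f' : ℝ → ℝ} (hf : ∀ s, HasDerivAt f (f' s) s)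
    (hf' : Continuous f') (a b : ℝ) : AbsolutelyContinuousOnInterval f a b := by
  refine absolutelyContinuous_of_sub_eq_integral (g := f') (fun a b => ?_)
    hf'.locallyIntegrable a b
  rw [intervalIntegral.integral_eq_sub_of_hasDerivAt (fun x _ => hf x)
    (hf'.intervalIntegrable a b)]

/-- Integration by parts: for a `C¹` function `k`, the second derivative `g` of `d` satisfies
`∫ k(d) g = [k(d) d'] - ∫ k'(d) (d')²`. -/
theorem integral_comp_mul_second_deriv {d e g k k' : ℝ → ℝ} (hd : ∀ s, HasDerivAt d (e s) s)
    (he : ∀ a b, e b - e a = ∫ x in a..b, g x) (hg : LocallyIntegrable g volume)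
    (hk : ∀ x, HasDerivAt k (k' x) x) (hk' : Continuous k') (a b : ℝ) :
    ∫ s in a..b, k (d s) * g s =
      k (d b) * e b - k (d a) * e a - ∫ s in a..b, k' (d s) * e s ^ 2 := by
  have hec := continuous_of_sub_eq_integral he hg
  have hdc : Continuous d := continuous_iff_continuousAt.2 fun s => (hd s).continuousAt
  have hkd : ∀ s, HasDerivAt (fun s => k (d s)) (k' (d s) * e s) s := fun s => (hk _).comp s (hd s)
  have h1 := (absolutelyContinuous_of_hasDerivAt hkd ((hk'.comp hdc).mul hec) a b
    ).integral_mul_deriv_eq_deriv_mul (absolutelyContinuous_of_sub_eq_integral he hg a b)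
  have h2 : ∫ s in a..b, k (d s) * deriv e s = ∫ s in a..b, k (d s) * g s := by
    refine intervalIntegral.integral_congr_ae ?_
    filter_upwards [ae_hasDerivAt_of_sub_eq_integral he hg] with s hs _
    rw [hs.deriv]
  rw [← h2, h1]
  congr 1
  refine intervalIntegral.integral_congr fun s _ => ?_
  simp only [(hkd s).deriv]
  ring

/-- If `d` is periodic with second derivative `g`, then `∫ sign(d) g ≤ 0` over a period. -/
theorem integral_sign_mul_second_deriv_nonpos {d e g : ℝ → ℝ} {T : ℝ} (hT : 0 ≤ T)
    (hd : ∀ s, HasDerivAt d (e s) s) (he : ∀ a b, e b - e a = ∫ x in a..b, g x)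
    (hg : LocallyIntegrable g volume) (hdT : d T = d 0) (heT : e T = e 0) :
    ∫ s in (0 : ℝ)..T, Real.sign (d s) * g s ≤ 0 := by
  have hec := continuous_of_sub_eq_integral he hg
  have hdc : Continuous d := continuous_iff_continuousAt.2 fun s => (hd s).continuousAt
  have hn : ∀ n : ℕ, ∫ s in (0 : ℝ)..T, Real.arctan (n * d s) * g s ≤ 0 := by
    intro n
    have hk : ∀ x : ℝ, HasDerivAt (fun x => Real.arctan (n * x)) (1 / (1 + (n * x) ^ 2) * n) x :=
      fun x => (Real.hasDerivAt_arctan _).comp x (by simpa using (hasDerivAt_id x).const_mul (n : ℝ))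
    have hk' : Continuous fun x : ℝ => 1 / (1 + (n * x) ^ 2) * (n : ℝ) := by
      refine (continuous_const.div (by fun_prop) fun x => ?_).mul continuous_const
      positivity
    rw [integral_comp_mul_second_deriv hd he hg hk hk' 0 T, hdT, heT, sub_self, zero_sub,
      neg_nonpos]
    refine intervalIntegral.integral_nonneg hT fun s _ => ?_
    positivity
  have hlim : Tendsto (fun n : ℕ => ∫ s in (0 : ℝ)..T, Real.arctan (n * d s) * g s) atTop
      (𝓝 (∫ s in (0 : ℝ)..T, π / 2 * (Real.sign (d s) * g s))) := by
    refine intervalIntegral.tendsto_integral_filter_of_dominated_convergence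
      (fun s => π / 2 * |g s|) ?_ ?_ ?_ ?_
    · refine .of_forall fun n => ?_
      exact ((Real.continuous_arctan.comp (continuous_const.mul hdc)).aestronglyMeasurable).mul
        (hg.intervalIntegrable' 0 T).def'.aestronglyMeasurable
    · refine .of_forall fun n => .of_forall fun s _ => ?_
      rw [norm_mul, Real.norm_eq_abs, Real.norm_eq_abs]
      gcongr
      exact abs_le.2 ⟨(Real.neg_pi_div_two_lt_arctan _).le, (Real.arctan_lt_pi_div_two _).le⟩
    · exact ((hg.intervalIntegrable' 0 T).norm).const_mul _
    · refine .of_forall fun s _ => ?_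
      rw [← mul_assoc]
      refine Tendsto.mul_const _ ?_
      rcases lt_trichotomy (d s) 0 with h | h | h
      · rw [Real.sign_of_neg h, mul_neg_one]
        exact (tendsto_nhds_of_tendsto_nhdsWithin Real.tendsto_arctan_atBot).comp
          (tendsto_natCast_atTop_atTop.atTop_mul_const_of_neg h)
      · simp [h]
      · rw [Real.sign_of_pos h, mul_one]
        exact (tendsto_nhds_of_tendsto_nhdsWithin Real.tendsto_arctan_atTop).comp
          (tendsto_natCast_atTop_atTop.atTop_mul_const h)
  have := le_of_tendsto' hlim hn
  rw [intervalIntegral.integral_const_mul] at this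
  exact nonpos_of_mul_nonpos_right this (by positivity)

theorem measurable_real_sign : Measurable Real.sign := by
  unfold Real.sign
  exact Measurable.ite measurableSet_Iio measurable_const
    (Measurable.ite measurableSet_Ioi measurable_const measurable_const)

/-- If `d'' = a - b` with `d` periodic and `a d ≥ 0`, then `∫ |a| ≤ ∫ |b|`. -/
theorem integral_abs_le_of_mul_nonneg {d e a b : ℝ → ℝ} {T : ℝ} (hT : 0 ≤ T)
    (hd : ∀ s, HasDerivAt d (e s) s) (he : ∀ x y, e y - e x = ∫ s in x..y, (a s - b s))
    (ha : LocallyIntegrable a volume) (hb : LocallyIntegrable b volume) (hdT : d T = d 0)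
    (heT : e T = e 0) (had : ∀ᵐ s, 0 ≤ a s * d s) :
    ∫ s in (0 : ℝ)..T, |a s| ≤ ∫ s in (0 : ℝ)..T, |b s| := by
  have hg : LocallyIntegrable (fun s => a s - b s) volume := ha.sub hb
  have hec := continuous_of_sub_eq_integral he hg
  have hdc : Continuous d := continuous_iff_continuousAt.2 fun s => (hd s).continuousAt
  have h1 := integral_sign_mul_second_deriv_nonpos hT hd he hg hdT heT
  have hz1 := ae_deriv_eq_zero_of_eq_zero (.of_forall hd)
  have hz2 := ae_deriv_eq_zero_of_eq_zero (ae_hasDerivAt_of_sub_eq_integral he hg)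
  have hsign : ∀ x, |Real.sign x| ≤ 1 := by
    intro x; rcases Real.sign_apply_eq x with h | h | h <;> simp [h]
  have hint : IntervalIntegrable (fun s => Real.sign (d s) * (a s - b s)) volume 0 T := by
    refine (hg.intervalIntegrable' 0 T).mono_fun ?_ (.of_forall fun s => ?_)
    · exact (measurable_real_sign.comp hdc.measurable).aestronglyMeasurable.mul
        (hg.intervalIntegrable' 0 T).def'.aestronglyMeasurable
    · simp only [norm_mul]
      exact mul_le_of_le_one_left (norm_nonneg _) (hsign _)
  have h2 : ∫ s in (0 : ℝ)..T, (|a s| - |b s|) ≤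
      ∫ s in (0 : ℝ)..T, Real.sign (d s) * (a s - b s) := by
    refine intervalIntegral.integral_mono_ae hT
      ((ha.intervalIntegrable' 0 T).abs.sub (hb.intervalIntegrable' 0 T).abs) hint ?_
    filter_upwards [had, hz1, hz2] with s h3 h4 h5
    rcases lt_trichotomy (d s) 0 with h | h | h
    · rw [Real.sign_of_neg h]
      have : a s ≤ 0 := by nlinarith
      rw [abs_of_nonpos this]
      linarith [neg_abs_le (b s)]
    · have := h5 (h4 h)
      rw [this, mul_zero, sub_eq_zero.1 this, sub_self]
    · rw [Real.sign_of_pos h]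
      have : 0 ≤ a s := by nlinarith
      rw [abs_of_nonneg this]
      linarith [le_abs_self (b s)]
  rw [intervalIntegral.integral_sub (ha.intervalIntegrable' 0 T).abs
    (hb.intervalIntegrable' 0 T).abs] at h2
  linarith

/-- One step of the implicit scheme in terms of angles: the flux `om` has the derivative `W`, the
new angle is `Q = P + h W'`, and `om` is a selection of `∂J(Q)`. -/
structure IsFluxStep (h : ℝ) (P Q om W : ℝ → ℝ) : Prop where
  hasDerivAt : ∀ s, HasDerivAt om (W s) s
  sub_eq : ∀ a b, h * (W b - W a) = ∫ s in a..b, (Q s - P s)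
  add_two_pi : ∀ s, om (s + 2 * π) = om s + 2 * π
  mem_subdiff : ∀ᵐ s, om s ∈ subdiff crystalJ (Q s)
  locInt_old : LocallyIntegrable P volume
  locInt_new : LocallyIntegrable Q volume

namespace IsFluxStep

variable {h : ℝ} {P Q om W : ℝ → ℝ}

theorem continuous_flux (H : IsFluxStep h P Q om W) : Continuous om :=
  continuous_iff_continuousAt.2 fun s => (H.hasDerivAt s).continuousAt

theorem W_periodic (H : IsFluxStep h P Q om W) (s : ℝ) : W (s + 2 * π) = W s := by
  have h1 := (H.hasDerivAt (s + 2 * π)).comp_add_const s (2 * π)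
  rw [funext H.add_two_pi] at h1
  exact h1.unique ((H.hasDerivAt s).add_const _)

theorem locallyIntegrable_sub (H : IsFluxStep h P Q om W) :
    LocallyIntegrable (fun s => Q s - P s) volume := H.locInt_new.sub H.locInt_old

theorem comp_add (H : IsFluxStep h P Q om W) (c : ℝ) :
    IsFluxStep h (fun s => P (s + c)) (fun s => Q (s + c)) (fun s => om (s + c))
      (fun s => W (s + c)) where
  hasDerivAt s := (H.hasDerivAt (s + c)).comp_add_const s c
  sub_eq a b := by
    rw [H.sub_eq, intervalIntegral.integral_comp_add_right (fun s => Q s - P s)]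
  add_two_pi s := by rw [← H.add_two_pi]; ring_nf
  mem_subdiff := ae_add_two_pi H.mem_subdiff c
  locInt_old := H.locInt_old.comp_add c
  locInt_new := H.locInt_new.comp_add c

/-- The scheme is a contraction of the angles in the mean. -/
theorem integral_abs_sub_le {P' Q' om' W' : ℝ → ℝ} (hh : 0 < h) (H : IsFluxStep h P Q om W)
    (H' : IsFluxStep h P' Q' om' W') :
    ∫ s in (0 : ℝ)..2 * π, |Q s - Q' s| ≤ ∫ s in (0 : ℝ)..2 * π, |P s - P' s| := by
  refine integral_abs_le_of_mul_nonneg (d := fun s => h * (om s - om' s))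
    (e := fun s => h * (W s - W' s)) two_pi_pos.le
    (fun s => ((H.hasDerivAt s).sub (H'.hasDerivAt s)).const_mul h) (fun x y => ?_)
    (H.locInt_new.sub H'.locInt_new) (H.locInt_old.sub H'.locInt_old) ?_ ?_ ?_
  · rw [show h * (W y - W' y) - h * (W x - W' x) = h * (W y - W x) - h * (W' y - W' x) by ring,
      H.sub_eq, H'.sub_eq, ← intervalIntegral.integral_sub
      (H.locallyIntegrable_sub.intervalIntegrable' x y)
      (H'.locallyIntegrable_sub.intervalIntegrable' x y)]
    refine intervalIntegral.integral_congr fun s _ => ?_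
    ring
  · have h1 := H.add_two_pi 0
    have h2 := H'.add_two_pi 0
    rw [zero_add] at h1 h2
    simp only [h1, h2]; ring
  · have h1 := H.W_periodic 0
    have h2 := H'.W_periodic 0
    rw [zero_add] at h1 h2
    simp only [h1, h2]
  · filter_upwards [H.mem_subdiff, H'.mem_subdiff] with s h1 h2
    have := subdiff_monotone h1 h2
    change 0 ≤ (Q s - Q' s) * (h * (om s - om' s))
    nlinarith

end IsFluxStep

/-! ### Total variation and mean differences -/

theorem exists_tendsto_hyperfilter {x : ℕ → ℝ} {C : ℝ} (h : ∀ n, |x n| ≤ C) :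
    ∃ l, Tendsto x (hyperfilter ℕ) (𝓝 l) := by
  have hmem : ∀ᶠ n in (hyperfilter ℕ : Filter ℕ), x n ∈ Icc (-C) C :=
    .of_forall fun n => abs_le.1 (h n)
  obtain ⟨l, _, hl⟩ := (isCompact_Icc (a := -C) (b := C)).ultrafilter_le_nhds
    ((hyperfilter ℕ).map x) (le_principal_iff.2 hmem)
  exact ⟨l, hl⟩

theorem eVariationOn_shift {f : ℝ → ℝ} (hf : ∀ s, f (s + 2 * π) = f s + 2 * π) (a b : ℝ) :
    eVariationOn f (Icc (a + 2 * π) (b + 2 * π)) = eVariationOn f (Icc a b) := by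
  have h1 := eVariationOn.comp_eq_of_monotoneOn f (t := Icc a b) (fun x => x + 2 * π)
    (fun x _ y _ hxy => by simpa using hxy)
  rw [image_add_const_Icc] at h1
  rw [← h1]
  unfold eVariationOn
  simp only [Function.comp_apply, hf, edist_add_right]

/-- The variation over one turn does not depend on the base point. -/
theorem eVariationOn_period {f : ℝ → ℝ} (hf : ∀ s, f (s + 2 * π) = f s + 2 * π) {c : ℝ}
    (hc : c ∈ Icc 0 (2 * π)) :
    eVariationOn f (Icc c (c + 2 * π)) = eVariationOn f (Icc 0 (2 * π)) := by
  have h1 := eVariationOn.Icc_add_Icc f (s := univ) hc.1 hc.2 (mem_univ c)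
  have h2 := eVariationOn.Icc_add_Icc f (s := univ) (a := c) (b := 2 * π) (c := c + 2 * π) hc.2
    (by linarith [hc.1]) (mem_univ _)
  simp only [univ_inter] at h1 h2
  rw [← h1, ← h2, add_comm]
  congr 1
  have := eVariationOn_shift hf 0 c
  rwa [zero_add] at this

/-- The total variation of an angle function over one turn. -/
def turnVar (P : ℝ → ℝ) : ℝ := (eVariationOn P (Icc 0 (2 * π))).toReal

namespace IsAngleFn

variable {P : ℝ → ℝ}

theorem eVariationOn_ne_top (hP : IsAngleFn P) (a b : ℝ) : eVariationOn P (Icc a b) ≠ ⊤ := by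
  simpa [BoundedVariationOn] using hP.bv a b (mem_univ _) (mem_univ _)

theorem variation_sub (hP : IsAngleFn P) {a b : ℝ} (hab : a ≤ b) :
    variationOnFromTo P univ 0 b - variationOnFromTo P univ 0 a =
      (eVariationOn P (Icc a b)).toReal := by
  rw [variationOnFromTo.sub_right hP.bv (mem_univ _) (mem_univ _) (mem_univ _),
    variationOnFromTo.eq_of_le _ _ hab, univ_inter]

theorem variation_monotone (hP : IsAngleFn P) : Monotone (variationOnFromTo P univ 0) :=
  monotoneOn_univ.1 (variationOnFromTo.monotoneOn hP.bv (mem_univ _))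

theorem abs_sub_le (hP : IsAngleFn P) {a b : ℝ} (hab : a ≤ b) :
    |P b - P a| ≤ variationOnFromTo P univ 0 b - variationOnFromTo P univ 0 a :=
  variationOnFromTo.abs_sub_le_sub_of_le hP.bv (mem_univ _) (mem_univ _) (mem_univ _) hab

theorem variation_add_two_pi (hP : IsAngleFn P) (s : ℝ) :
    variationOnFromTo P univ 0 (s + 2 * π) = variationOnFromTo P univ 0 s + turnVar P := by
  have h0 : variationOnFromTo P univ 0 (2 * π) = turnVar P := by
    rw [variationOnFromTo.eq_of_le _ _ two_pi_pos.le, univ_inter]; rfl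
  have h1 : ∀ a b, a ≤ b → variationOnFromTo P univ 0 (b + 2 * π) -
      variationOnFromTo P univ 0 (a + 2 * π) =
      variationOnFromTo P univ 0 b - variationOnFromTo P univ 0 a := by
    intro a b hab
    rw [hP.variation_sub hab, hP.variation_sub (by linarith), eVariationOn_shift hP.add_two_pi]
  have h2 := variationOnFromTo.self P univ (0 : ℝ)
  rcases le_total 0 s with h | h
  · have := h1 0 s h
    rw [zero_add] at this
    linarith
  · have := h1 s 0 h
    rw [zero_add] at this
    linarith

theorem locallyIntegrable (hP : IsAngleFn P) : LocallyIntegrable P volume := hP.bv.locallyIntegrable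

theorem integral_variation_translate_sub (hP : IsAngleFn P) (t : ℝ) :
    ∫ s in (0 : ℝ)..2 * π, (variationOnFromTo P univ 0 (s + t) - variationOnFromTo P univ 0 s) =
      t * turnVar P := by
  set v := variationOnFromTo P univ 0 with hv
  have hvi : ∀ a b, IntervalIntegrable v volume a b := fun a b =>
    hP.variation_monotone.intervalIntegrable
  have hvt : ∀ c a b, IntervalIntegrable (fun s => v (s + c)) volume a b := fun c a b =>
    (hP.variation_monotone.comp (monotone_id.add_const c)).intervalIntegrable
  calc ∫ s in (0 : ℝ)..2 * π, (v (s + t) - v s)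
      = ∫ s in (0 : ℝ)..t, (v (s + 2 * π) - v s) := by
        rw [intervalIntegral.integral_sub (hvt _ _ _) (hvi _ _),
          intervalIntegral.integral_sub (hvt _ _ _) (hvi _ _),
          intervalIntegral.integral_comp_add_right, intervalIntegral.integral_comp_add_right]
        have h1 := intervalIntegral.integral_add_adjacent_intervals (hvi 0 t) (hvi t (2 * π + t))
        have h2 := intervalIntegral.integral_add_adjacent_intervals (hvi 0 (2 * π))
          (hvi (2 * π) (2 * π + t))
        rw [zero_add, zero_add, add_comm t (2 * π)]
        linarith
    _ = t * turnVar P := by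
        rw [intervalIntegral.integral_congr (g := fun _ => turnVar P)
          (fun s _ => by simp only [hv, hP.variation_add_two_pi]; ring)]
        simp

theorem intervalIntegrable_variation_translate_sub (hP : IsAngleFn P) (t a b : ℝ) :
    IntervalIntegrable
      (fun s => variationOnFromTo P univ 0 (s + t) - variationOnFromTo P univ 0 s) volume a b :=
  (hP.variation_monotone.comp (monotone_id.add_const t)).intervalIntegrable.sub
    hP.variation_monotone.intervalIntegrable

/-- Translations of an angle function are Lipschitz in the mean, with its variation as constant. -/
theorem integral_abs_translate_sub_le (hP : IsAngleFn P) {t : ℝ} (ht : 0 ≤ t) :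
    ∫ s in (0 : ℝ)..2 * π, |P (s + t) - P s| ≤ t * turnVar P := by
  rw [← hP.integral_variation_translate_sub t]
  exact intervalIntegral.integral_mono_on two_pi_pos.le
    (((hP.locallyIntegrable.comp_add t).sub hP.locallyIntegrable).intervalIntegrable' _ _).abs
    (hP.intervalIntegrable_variation_translate_sub t _ _) fun s _ => hP.abs_sub_le (by linarith)

theorem exists_abs_sub_id_le (hP : IsAngleFn P) : ∃ B, ∀ s, |P s - s| ≤ B := by
  refine ⟨turnVar P + |P 0| + 2 * π, fun s => ?_⟩
  have hper : Function.Periodic (fun s => P s - s) (2 * π) := fun s => by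
    simp only [hP.add_two_pi]; ring
  obtain ⟨y, hy, hys⟩ := hper.exists_mem_Ico₀ two_pi_pos s
  rw [hys]
  have h1 := hP.abs_sub_le hy.1
  have h2 := hP.variation_monotone hy.2.le
  have h3 := hP.variation_add_two_pi 0
  rw [variationOnFromTo.self, zero_add, zero_add] at h3
  rw [variationOnFromTo.self] at h1
  have h4 : |P y - y| ≤ |P y - P 0| + |P 0| + |y| := by
    calc |P y - y| = |(P y - P 0) + P 0 - y| := by ring_nf
      _ ≤ _ := (abs_sub _ _).trans (add_le_add_left (abs_add_le _ _) _)
  rw [abs_of_nonneg hy.1] at h4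
  linarith [hy.2]

end IsAngleFn

/-- A function whose translations are Lipschitz in the mean agrees almost everywhere with an angle
function whose variation is controlled by the Lipschitz constant. -/
theorem exists_isAngleFn_of_integral_translate_le {f : ℝ → ℝ} {B M : ℝ}
    (hf : LocallyIntegrable f volume) (hper : ∀ s, f (s + 2 * π) = f s + 2 * π)
    (hB : ∀ s, |f s - s| ≤ B)
    (hle : ∀ t > 0, ∫ s in (0 : ℝ)..2 * π, |f (s + t) - f s| ≤ t * M) :
    ∃ Q, IsAngleFn Q ∧ Q =ᵐ[volume] f ∧ eVariationOn Q (Icc 0 (2 * π)) ≤ ENNReal.ofReal M := by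
  set τ : ℕ → ℝ := fun n => 1 / ((n : ℝ) + 1) with hτ
  have hτ0 : ∀ n, 0 < τ n := fun n => by positivity
  have hτ1 : ∀ n, τ n ≤ 1 := fun n => by
    rw [hτ]; exact (div_le_one (by positivity)).2 (by linarith [Nat.cast_nonneg (α := ℝ) n])
  set D : ℕ → ℝ → ℝ := fun n t => (τ n)⁻¹ * ∫ s in t..t + τ n, f s with hD
  have hfi := hf.intervalIntegrable'
  -- the averages are bounded locally
  have hDb : ∀ t n, |D n t| ≤ B + |t| + 1 := by
    intro t n
    have h1 : ‖∫ s in t..t + τ n, f s‖ ≤ (B + |t| + 1) * |t + τ n - t| := by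
      refine intervalIntegral.norm_integral_le_of_norm_le_const fun s hs => ?_
      rw [uIoc_of_le (by linarith [hτ0 n])] at hs
      have h2 := abs_sub_abs_le_abs_sub (f s) s
      have h3 : |s| ≤ |t| + 1 := by
        have := abs_add_le t (s - t)
        rw [add_sub_cancel, abs_of_pos (a := s - t) (by linarith [hs.1])] at this
        linarith [hs.2, hτ1 n]
      rw [Real.norm_eq_abs]
      linarith [hB s]
    rw [add_sub_cancel_left, abs_of_pos (hτ0 n), Real.norm_eq_abs] at h1
    rw [hD]
    simp only
    rw [abs_mul, abs_of_pos (inv_pos.2 (hτ0 n)), inv_mul_le_iff₀ (hτ0 n), mul_comm (τ n)]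
    exact h1
  choose q hq using fun t => exists_tendsto_hyperfilter (hDb t)
  -- the variation of the averages
  have hgi : ∀ n a b, IntervalIntegrable (fun s => |f (s + τ n) - f s|) volume a b :=
    fun n a b => (((hf.comp_add (τ n)).sub hf).intervalIntegrable' a b).abs
  have hDvar : ∀ n a b, eVariationOn (D n) (Icc a b) ≤
      ENNReal.ofReal ((τ n)⁻¹ * ∫ s in a..b, |f (s + τ n) - f s|) := by
    intro n a b
    refine (eVariationOn_Icc_le (G := fun x => (τ n)⁻¹ * ∫ s in a..x, |f (s + τ n) - f s|)
      fun x _ y _ hxy => ?_).trans_eq (by simp)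
    have h1 : D n y - D n x = (τ n)⁻¹ * ∫ s in x..y, (f (s + τ n) - f s) := by
      rw [intervalIntegral.integral_sub ((hf.comp_add (τ n)).intervalIntegrable' x y) (hfi x y),
        intervalIntegral.integral_comp_add_right]
      have h2 := intervalIntegral.integral_add_adjacent_intervals (hfi x y) (hfi y (y + τ n))
      have h3 := intervalIntegral.integral_add_adjacent_intervals (hfi x (x + τ n))
        (hfi (x + τ n) (y + τ n))
      simp only [hD]
      rw [← mul_sub]
      congr 1
      linarith
    rw [h1, abs_mul, abs_of_pos (inv_pos.2 (hτ0 n)), ← mul_sub,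
      intervalIntegral.integral_interval_sub_left (hgi _ _ _) (hgi _ _ _)]
    exact mul_le_mul_of_nonneg_left (intervalIntegral.abs_integral_le_integral_abs hxy)
      (inv_pos.2 (hτ0 n)).le
  have hgper : ∀ n, Function.Periodic (fun s => |f (s + τ n) - f s|) (2 * π) := fun n s => by
    simp only
    rw [show s + 2 * π + τ n = s + τ n + 2 * π by ring, hper, hper]
    ring_nf
  have hDturn : ∀ n c, (τ n)⁻¹ * ∫ s in c..c + 2 * π, |f (s + τ n) - f s| ≤ M := fun n c => by
    rw [(hgper n).intervalIntegral_add_eq c 0, zero_add, inv_mul_le_iff₀ (hτ0 n)]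
    exact hle _ (hτ0 n)
  have hqvar : ∀ (a b : ℝ) (K : ℝ), (∀ n, (τ n)⁻¹ * ∫ s in a..b, |f (s + τ n) - f s| ≤ K) →
      eVariationOn q (Icc a b) ≤ ENNReal.ofReal K := by
    intro a b K hK
    refine le_of_forall_lt fun v hv => ?_
    obtain ⟨n, hn⟩ := (eVariationOn.lowerSemicontinuous_aux (s := Icc a b)
      (fun x _ => hq x) hv).exists
    exact hn.trans_le ((hDvar n a b).trans (ENNReal.ofReal_le_ofReal (hK n)))
  have hqturn : ∀ c, eVariationOn q (Icc c (c + 2 * π)) ≤ ENNReal.ofReal M := fun c =>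
    hqvar _ _ _ fun n => hDturn n c
  have hqbv : LocallyBoundedVariationOn q univ := by
    intro a b _ _
    rw [univ_inter]
    obtain ⟨N, hN⟩ := exists_nat_gt ((b - a) / (2 * π))
    rw [div_lt_iff₀ two_pi_pos] at hN
    refine ne_top_of_le_ne_top (ENNReal.ofReal_ne_top (r := N * M))
      ((eVariationOn.mono _ (Icc_subset_Icc_right (by linarith : b ≤ a + N * (2 * π)))).trans
        (hqvar _ _ _ fun n => ?_))
    have h1 := (hgper n).intervalIntegral_add_zsmul_eq N a (fun t₁ t₂ => hgi n t₁ t₂)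
    simp only [zsmul_eq_mul, Int.cast_natCast] at h1
    rw [h1, mul_left_comm]
    exact mul_le_mul_of_nonneg_left (hDturn n a) (Nat.cast_nonneg N)
  have hqf : q =ᵐ[volume] f := by
    filter_upwards [LocallyIntegrable.ae_hasDerivAt_integral hf] with t ht
    have h1 := hasDerivAt_iff_tendsto_slope_zero.1 (ht t)
    have h2 : Tendsto τ atTop (𝓝[≠] 0) :=
      tendsto_nhdsWithin_iff.2 ⟨tendsto_one_div_add_atTop_nhds_zero_nat,
        .of_forall fun n => (hτ0 n).ne'⟩
    have h3 : Tendsto (fun n => D n t) atTop (𝓝 (f t)) := by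
      refine (h1.comp h2).congr fun n => ?_
      simp [hD]
    exact tendsto_nhds_unique (hq t) (h3.mono_left Nat.hyperfilter_le_atTop)
  have hqper : ∀ᵐ s, q (s + 2 * π) = q s + 2 * π := by
    filter_upwards [hqf, ae_add_two_pi hqf (2 * π)] with s h1 h2
    rw [h1, h2, hper]
  have hQ := isAngleFn_upperSelection hqbv hqper
  refine ⟨_, hQ, hqbv.upperSelection_ae_eq.trans hqf, ?_⟩
  -- a base point at which the variation of the averages controls that of the selection
  obtain ⟨c, ⟨hc1, hc2⟩, hc3⟩ : ∃ c, (ContinuousAt q c ∧ ContinuousAt q (c + 2 * π)) ∧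
      c ∈ Ioo 0 (2 * π) := by
    have := (hqbv.ae_continuousAt.and (ae_add_two_pi hqbv.ae_continuousAt (2 * π)))
    have hne : volume (Ioo 0 (2 * π)) ≠ 0 := by simp [pi_pos]
    obtain ⟨c, hc, hc'⟩ := (((frequently_ae_mem_iff).2 hne).and_eventually this).exists
    exact ⟨c, hc', hc⟩
  rw [← eVariationOn_period hQ.add_two_pi (Ioo_subset_Icc_self hc3)]
  exact (hqbv.eVariationOn_upperSelection_le hc1 hc2).trans (hqturn c)

theorem IsAngleFn.ofReal_turnVar {P : ℝ → ℝ} (hP : IsAngleFn P) :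
    ENNReal.ofReal (turnVar P) = eVariationOn P (Icc 0 (2 * π)) :=
  ENNReal.ofReal_toReal (hP.eVariationOn_ne_top _ _)

namespace IsFluxStep

variable {h : ℝ} {P Q om W : ℝ → ℝ}

/-- Regularity of the new angle: it has a normalized representative, whose variation is at most
that of the old angle. -/
theorem exists_isAngleFn (hh : 0 < h) (H : IsFluxStep h P Q om W) (hP : IsAngleFn P) {B : ℝ}
    (hper : ∀ s, Q (s + 2 * π) = Q s + 2 * π) (hB : ∀ s, |Q s - s| ≤ B) :
    ∃ Q', IsAngleFn Q' ∧ Q' =ᵐ[volume] Q ∧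
      eVariationOn Q' (Icc 0 (2 * π)) ≤ eVariationOn P (Icc 0 (2 * π)) := by
  rw [← hP.ofReal_turnVar]
  exact exists_isAngleFn_of_integral_translate_le H.locInt_new hper hB fun t ht =>
    ((H.comp_add t).integral_abs_sub_le hh H).trans (hP.integral_abs_translate_sub_le ht.le)

theorem eVariationOn_le (hh : 0 < h) (H : IsFluxStep h P Q om W) (hP : IsAngleFn P)
    (hQ : IsAngleFn Q) : eVariationOn Q (Icc 0 (2 * π)) ≤ eVariationOn P (Icc 0 (2 * π)) := by
  obtain ⟨B, hB⟩ := hQ.exists_abs_sub_id_le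
  obtain ⟨Q', h1, h2, h3⟩ := H.exists_isAngleFn hh hP hQ.add_two_pi hB
  rwa [h1.ext hQ h2] at h3

theorem congr_new (H : IsFluxStep h P Q om W) {Q' : ℝ → ℝ} (hQ : Q' =ᵐ[volume] Q)
    (hQ' : LocallyIntegrable Q' volume) : IsFluxStep h P Q' om W where
  hasDerivAt := H.hasDerivAt
  sub_eq a b := by
    rw [H.sub_eq]
    refine intervalIntegral.integral_congr_ae ?_
    filter_upwards [hQ] with s hs _
    rw [hs]
  add_two_pi := H.add_two_pi
  mem_subdiff := by
    filter_upwards [H.mem_subdiff, hQ] with s h1 h2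
    rwa [h2]
  locInt_old := H.locInt_old
  locInt_new := hQ'

theorem ae_hasDerivAt_W (hh : 0 < h) (H : IsFluxStep h P Q om W) :
    ∀ᵐ s, HasDerivAt W ((Q s - P s) / h) s := by
  have h1 : ∀ a b, h * W b - h * W a = ∫ s in a..b, (Q s - P s) := fun a b => by
    rw [← H.sub_eq]; ring
  filter_upwards [ae_hasDerivAt_of_sub_eq_integral h1 H.locallyIntegrable_sub] with s hs
  have := hs.const_mul h⁻¹
  rwa [← div_eq_inv_mul, show (fun y => h⁻¹ * (h * W y)) = W by funext y; field_simp] at this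

theorem continuous_W (hh : 0 < h) (H : IsFluxStep h P Q om W) : Continuous W := by
  have h1 : ∀ a b, h * W b - h * W a = ∫ s in a..b, (Q s - P s) := fun a b => by
    rw [← H.sub_eq]; ring
  have := (continuous_of_sub_eq_integral h1 H.locallyIntegrable_sub).const_mul h⁻¹
  simpa [← mul_assoc, hh.ne'] using this

/-- Where the flux takes a fixed value, the angle does not change. -/
theorem ae_eq_of_eq (hh : 0 < h) (H : IsFluxStep h P Q om W) (c : ℝ) :
    ∀ᵐ s, om s = c → Q s = P s := by
  have h1 := ae_deriv_eq_zero_of_eq_zero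
    (.of_forall fun s => (H.hasDerivAt s).sub_const c : ∀ᵐ s, HasDerivAt (fun s => om s - c) (W s) s)
  filter_upwards [h1, ae_deriv_eq_zero_of_eq_zero (H.ae_hasDerivAt_W hh)] with s h2 h3 h4
  have h5 := h3 (h2 (sub_eq_zero.2 h4))
  rw [div_eq_zero_iff, or_iff_left hh.ne'] at h5
  linarith

/-- The new angle differs from the old one only at preferred angles. -/
theorem ae_eq_or_exists_prefAngle (hh : 0 < h) (H : IsFluxStep h P Q om W) :
    ∀ᵐ s, Q s = P s ∨ ∃ j, Q s = prefAngle j := by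
  filter_upwards [H.mem_subdiff, ae_all_iff.2 fun j => H.ae_eq_of_eq hh (facetSlope j)] with s h1 h2
  by_cases h3 : ∃ j, om s = facetSlope j
  · obtain ⟨j, hj⟩ := h3
    exact .inl (h2 j hj)
  · exact .inr (exists_eq_prefAngle_of_mem_subdiff h1 fun j hj => h3 ⟨j, hj⟩)

end IsFluxStep

/-! ### The scheme for profiles and the scheme for angles -/

theorem IsAngleDensity.continuous {lam P : ℝ → ℝ} (h : IsAngleDensity lam P)
    (hP : LocallyIntegrable P volume) : Continuous lam := by
  have h1 := (continuous_of_sub_eq_integral (e := fun s => lam s + s ^ 2 / 2) h hP).sub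
    (by fun_prop : Continuous fun s : ℝ => s ^ 2 / 2)
  simpa [Pi.sub_def] using h1

theorem IsFlux.isFluxStep {h : ℝ} (hh : 0 < h) {v u om P Q : ℝ → ℝ} (H : IsFlux h v u om)
    (hP : LocallyIntegrable P volume) (hQ : LocallyIntegrable Q volume) (hv : IsAngleDensity v P)
    (hu : IsAngleDensity u Q) : IsFluxStep h P Q om (fun s => (u s - v s) / h) where
  hasDerivAt s := by
    have hc : Continuous fun s => (u s - v s) / h :=
      ((hu.continuous hQ).sub (hv.continuous hP)).div_const h
    have : om = fun x => (∫ y in (0 : ℝ)..x, (u y - v y) / h) + om 0 := by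
      funext x
      have h1 := (H.absCont 0 x).integral_deriv_eq_sub
      rw [← sub_eq_iff_eq_add, ← h1]
      refine intervalIntegral.integral_congr_ae ?_
      filter_upwards [H.hasDerivAt] with y hy _ using hy.deriv
    rw [this]
    exact (intervalIntegral.integral_hasDerivAt_right (hc.intervalIntegrable _ _)
      hc.aestronglyMeasurable.stronglyMeasurableAtFilter hc.continuousAt).add_const _
  sub_eq a b := by
    rw [intervalIntegral.integral_sub (hQ.intervalIntegrable' a b) (hP.intervalIntegrable' a b),
      ← hu a b, ← hv a b]
    field_simp
    ring
  add_two_pi := H.add_two_pi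
  mem_subdiff := by
    filter_upwards [H.mem_subdiff, hu.ae_hasDerivAt hQ] with s h1 h2
    rwa [h2.deriv, sub_add_cancel] at h1
  locInt_old := hP
  locInt_new := hQ

theorem IsFluxStep.isAngleDensity {h : ℝ} {v om W P Q : ℝ → ℝ} (H : IsFluxStep h P Q om W)
    (hv : IsAngleDensity v P) : IsAngleDensity (fun s => v s + h * W s) Q := by
  intro a b
  have h1 := H.sub_eq a b
  rw [intervalIntegral.integral_sub (H.locInt_new.intervalIntegrable' a b)
    (H.locInt_old.intervalIntegrable' a b), ← hv a b] at h1
  linarith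

theorem IsFluxStep.isFlux {h : ℝ} (hh : 0 < h) {v om W P Q : ℝ → ℝ} (H : IsFluxStep h P Q om W)
    (hv : IsAngleDensity v P) : IsFlux h v (fun s => v s + h * W s) om where
  add_two_pi := H.add_two_pi
  absCont a b := absolutelyContinuous_of_hasDerivAt H.hasDerivAt (H.continuous_W hh) a b
  mem_subdiff := by
    filter_upwards [H.mem_subdiff, (H.isAngleDensity hv).ae_hasDerivAt H.locInt_new] with s h1 h2
    rwa [h2.deriv, sub_add_cancel]
  hasDerivAt := .of_forall fun s => by
    rw [add_sub_cancel_left, mul_div_cancel_left₀ _ hh.ne']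
    exact H.hasDerivAt s

/-- The scheme determines the new profile. -/
theorem IsFlux.unique {h : ℝ} (hh : 0 < h) {v u u' om om' : ℝ → ℝ} (hv : IsProfile v)
    (hu : IsProfile u) (hu' : IsProfile u') (H : IsFlux h v u om) (H' : IsFlux h v u' om') :
    u = u' := by
  obtain ⟨P, hP, hvP⟩ := hv.exists_isAngleFn
  obtain ⟨Q, hQ, huQ⟩ := hu.exists_isAngleFn
  obtain ⟨Q', hQ', huQ'⟩ := hu'.exists_isAngleFn
  have S := H.isFluxStep hh hP.locallyIntegrable hQ.locallyIntegrable hvP huQ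
  have S' := H'.isFluxStep hh hP.locallyIntegrable hQ'.locallyIntegrable hvP huQ'
  -- the angles agree in the mean, hence everywhere
  have h1 := S.integral_abs_sub_le hh S'
  simp only [sub_self, abs_zero, intervalIntegral.integral_zero] at h1
  have hint := (hQ.locallyIntegrable.sub hQ'.locallyIntegrable).intervalIntegrable' 0 (2 * π)
  have hconst : ∀ x ∈ Icc 0 (2 * π), u x - u' x = u 0 - u' 0 := by
    intro x hx
    have h2 := huQ 0 x
    have h3 := huQ' 0 x
    have h4 : |∫ s in (0 : ℝ)..x, (Q s - Q' s)| ≤ 0 := by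
      refine (intervalIntegral.abs_integral_le_integral_abs hx.1).trans (le_trans ?_ h1)
      exact intervalIntegral.integral_mono_interval le_rfl hx.1 hx.2
        (.of_forall fun s => abs_nonneg _) hint.abs
    have h5 := abs_nonpos_iff.1 h4
    rw [intervalIntegral.integral_sub (hQ.locallyIntegrable.intervalIntegrable' 0 x)
      (hQ'.locallyIntegrable.intervalIntegrable' 0 x)] at h5
    linarith
  -- the difference of the fluxes is periodic with constant derivative, so this constant vanishes
  have hzero : u 0 - u' 0 = 0 := by
    have h2 : ∀ s ∈ uIcc 0 (2 * π), HasDerivAt (fun s => om s - om' s) ((u 0 - u' 0) / h) s := by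
      intro s hs
      rw [uIcc_of_le two_pi_pos.le] at hs
      have h3 := (S.hasDerivAt s).sub (S'.hasDerivAt s)
      rwa [← sub_div, sub_sub_sub_cancel_right, hconst s hs] at h3
    have h3 := intervalIntegral.integral_eq_sub_of_hasDerivAt h2 intervalIntegrable_const
    have h4 := H.add_two_pi 0
    have h5 := H'.add_two_pi 0
    rw [zero_add] at h4 h5
    rw [intervalIntegral.integral_const, h4, h5, smul_eq_mul, sub_zero] at h3
    have h6 : 2 * π * ((u 0 - u' 0) / h) = 0 := by rw [h3]; ring
    have h7 := (mul_eq_zero.1 h6).resolve_left two_pi_pos.ne'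
    exact (div_eq_zero_iff.1 h7).resolve_right hh.ne'
  have hper : Function.Periodic (fun s => u s - u' s) (2 * π) := fun s => by
    simp only [hu.periodic s, hu'.periodic s]
  funext s
  obtain ⟨y, hy, hys⟩ := hper.exists_mem_Ico₀ two_pi_pos s
  have := hconst y (Ico_subset_Icc_self hy)
  linarith

/-! ### The resolvent of the second derivative on the line -/

/-- The bounded solution `A` of `A' = k A - f`. -/
def expAverage (k : ℝ) (f : ℝ → ℝ) (s : ℝ) : ℝ := ∫ t in Ioi 0, exp (-k * t) * f (s + t)

section Resolvent

variable {k C : ℝ} {f g : ℝ → ℝ}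

theorem integrableOn_exp_mul_of_bounded (hk : 0 < k) (hf : Measurable f) (hC : ∀ s, |f s| ≤ C)
    (a : ℝ) : IntegrableOn (fun t => exp (-k * t) * f t) (Ioi a) volume :=
  (integrableOn_exp_mul_Ioi (neg_lt_zero.2 hk) a).mul_bdd
    hf.aestronglyMeasurable (.of_forall hC)

theorem abs_expAverage_le (hk : 0 < k) (hC : ∀ s, |f s| ≤ C) (s : ℝ) :
    |expAverage k f s| ≤ C / k := by
  have h1 : ∫ t in Ioi (0 : ℝ), exp (-k * t) * C = C / k := by
    rw [integral_mul_const, integral_exp_mul_Ioi (neg_lt_zero.2 hk)]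
    simp; ring
  rw [← h1, ← Real.norm_eq_abs]
  refine norm_integral_le_of_norm_le
    ((integrableOn_exp_mul_Ioi (neg_lt_zero.2 hk) 0).mul_const C) (.of_forall fun t => ?_)
  rw [norm_mul, Real.norm_eq_abs, Real.norm_eq_abs, abs_of_pos (exp_pos _)]
  exact mul_le_mul_of_nonneg_left (hC _) (exp_pos _).le

theorem expAverage_eq (k : ℝ) (f : ℝ → ℝ) (s : ℝ) :
    expAverage k f s = exp (k * s) * ∫ t in Ioi s, exp (-k * t) * f t := by
  have h1 := (measurePreserving_add_left volume s).setIntegral_preimage_emb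
    (measurableEmbedding_addLeft s) (fun t => exp (-k * t) * f t) (Ioi s)
  have h2 : (fun x => s + x) ⁻¹' Ioi s = Ioi 0 := by ext x; simp
  rw [h2] at h1
  rw [← h1, ← integral_const_mul]
  unfold expAverage
  congr 1
  funext t
  rw [← mul_assoc, ← exp_add]
  ring_nf

theorem locallyIntegrable_of_bounded (hf : Measurable f) (hC : ∀ s, |f s| ≤ C) :
    LocallyIntegrable f volume :=
  locallyIntegrable_of_intervalIntegrable fun _ _ =>
    (intervalIntegrable_const (c := C)).mono_fun' hf.aestronglyMeasurable (.of_forall hC)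

theorem expAverage_sub (hk : 0 < k) (hf : Measurable f) (hC : ∀ s, |f s| ≤ C) (a b : ℝ) :
    expAverage k f b - expAverage k f a = ∫ s in a..b, (k * expAverage k f s - f s) := by
  set E : ℝ → ℝ := fun s => ∫ t in Ioi s, exp (-k * t) * f t with hE
  have hint := integrableOn_exp_mul_of_bounded hk hf hC
  have hgi : LocallyIntegrable (fun t => -(exp (-k * t) * f t)) volume :=
    locallyIntegrable_of_intervalIntegrable fun a b => by
      refine IntervalIntegrable.neg ⟨(hint a).mono_set Ioc_subset_Ioi_self,
        (hint b).mono_set Ioc_subset_Ioi_self⟩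
  have hEsub : ∀ a b, E b - E a = ∫ t in a..b, -(exp (-k * t) * f t) := by
    intro a b
    rw [intervalIntegral.integral_neg, ← intervalIntegral.integral_Ioi_sub_Ioi' (hint a) (hint b)]
    ring
  have hd : ∀ s, HasDerivAt (fun s => exp (k * s)) (exp (k * s) * k) s := fun s => by
    simpa using ((hasDerivAt_id s).const_mul k).exp
  have h1 := (absolutelyContinuous_of_hasDerivAt hd (by fun_prop) a b).integral_deriv_mul_eq_sub
    (absolutelyContinuous_of_sub_eq_integral hEsub hgi a b)
  rw [expAverage_eq, expAverage_eq, ← h1]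
  refine intervalIntegral.integral_congr_ae ?_
  filter_upwards [ae_hasDerivAt_of_sub_eq_integral hEsub hgi] with s hs _
  rw [(hd s).deriv, hs.deriv, expAverage_eq]
  have : exp (k * s) * exp (-k * s) = 1 := by rw [← exp_add]; simp
  linear_combination -(f s) * this

/-- The bounded solution `θ` of `m θ - h θ'' = f`. -/
def lineResolvent (m h : ℝ) (f : ℝ → ℝ) (s : ℝ) : ℝ :=
  (expAverage √(m / h) f s + expAverage √(m / h) (fun t => f (-t)) (-s)) / (2 * (√(m / h) * h))

variable {m h : ℝ}

theorem abs_resolvent_le (hm : 0 < m) (hh : 0 < h) (hC : ∀ s, |f s| ≤ C) (s : ℝ) :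
    |lineResolvent m h f s| ≤ C / m := by
  have hk : 0 < √(m / h) := Real.sqrt_pos.2 (div_pos hm hh)
  have hkk : √(m / h) * √(m / h) = m / h := Real.mul_self_sqrt (div_pos hm hh).le
  have h1 := abs_expAverage_le hk hC s
  have h2 := abs_expAverage_le (f := fun t => f (-t)) hk (fun t => hC (-t)) (-s)
  rw [lineResolvent, abs_div, abs_of_pos (a := 2 * (√(m / h) * h)) (by positivity),
    div_le_iff₀ (by positivity)]
  calc _ ≤ C / √(m / h) + C / √(m / h) := (abs_add_le _ _).trans (add_le_add h1 h2)
    _ = C / m * (2 * (√(m / h) * h)) := by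
      have : m = √(m / h) * √(m / h) * h := by rw [hkk]; field_simp
      set k := √(m / h)
      rw [this]
      field_simp
      norm_num

theorem expAverage_sub_fun (hk : 0 < k) {C' : ℝ} (hf : Measurable f) (hC : ∀ s, |f s| ≤ C)
    (hg : Measurable g) (hC' : ∀ s, |g s| ≤ C') (s : ℝ) :
    expAverage k (fun t => f t - g t) s = expAverage k f s - expAverage k g s := by
  rw [expAverage_eq, expAverage_eq, expAverage_eq, ← mul_sub, ← integral_sub
    (integrableOn_exp_mul_of_bounded hk hf hC s) (integrableOn_exp_mul_of_bounded hk hg hC' s)]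
  simp only [mul_sub]

theorem resolvent_sub_fun (hm : 0 < m) (hh : 0 < h) {C' : ℝ} (hf : Measurable f)
    (hC : ∀ s, |f s| ≤ C) (hg : Measurable g) (hC' : ∀ s, |g s| ≤ C') (s : ℝ) :
    lineResolvent m h (fun t => f t - g t) s = lineResolvent m h f s - lineResolvent m h g s := by
  have hk : 0 < √(m / h) := Real.sqrt_pos.2 (div_pos hm hh)
  unfold lineResolvent
  rw [expAverage_sub_fun hk hf hC hg hC', expAverage_sub_fun (f := fun t => f (-t))
    (g := fun t => g (-t)) hk (hf.comp measurable_neg) (fun t => hC (-t)) (hg.comp measurable_neg)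
    (fun t => hC' (-t))]
  ring

theorem resolvent_comp_add (m h : ℝ) (f : ℝ → ℝ) (c s : ℝ) :
    lineResolvent m h (fun t => f (t + c)) s = lineResolvent m h f (s + c) := by
  unfold lineResolvent expAverage
  congr 3 <;> funext t <;> ring_nf

theorem exists_hasDerivAt_resolvent (hm : 0 < m) (hh : 0 < h) (hf : Measurable f)
    (hC : ∀ s, |f s| ≤ C) :
    ∃ W : ℝ → ℝ, (∀ s, HasDerivAt (lineResolvent m h f) (W s) s) ∧
      ∀ a b, h * (W b - W a) = ∫ s in a..b, (m * lineResolvent m h f s - f s) := by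
  set k := √(m / h) with hkdef
  have hk : 0 < k := Real.sqrt_pos.2 (div_pos hm hh)
  have hkk : k * k = m / h := Real.mul_self_sqrt (div_pos hm hh).le
  set A := expAverage k f with hA
  set B := fun s => expAverage k (fun t => f (-t)) (-s) with hB
  have hfi := locallyIntegrable_of_bounded hf hC
  have hgi := locallyIntegrable_of_bounded (hf.comp measurable_neg) (fun t => hC (-t))
  have hAs : ∀ a b, A b - A a = ∫ s in a..b, (k * A s - f s) := expAverage_sub hk hf hC
  have hBs : ∀ a b, B b - B a = ∫ s in a..b, (f s - k * B s) := by
    intro a b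
    simp only [hB]
    rw [expAverage_sub (f := fun t => f (-t)) hk (hf.comp measurable_neg) (fun t => hC (-t)),
      intervalIntegral.integral_symm, ← intervalIntegral.integral_comp_neg,
      ← intervalIntegral.integral_neg]
    simp
  -- continuity, from the Lipschitz estimates that the two identities give
  have hlip : ∀ {G F : ℝ → ℝ} (K : ℝ), (∀ a b, G b - G a = ∫ s in a..b, F s) → (∀ s, |F s| ≤ K) →
      Continuous G := by
    intro G F K h1 h2
    have : LipschitzWith K.toNNReal G := LipschitzWith.of_dist_le_mul fun x y => by
      rw [Real.dist_eq, h1 y x, Real.dist_eq]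
      exact intervalIntegral.norm_integral_le_of_norm_le_const (f := F) fun s _ =>
        (h2 s).trans (Real.le_coe_toNNReal K)
    exact this.continuous
  have hAb := abs_expAverage_le (f := f) hk hC
  have hBb := abs_expAverage_le (f := fun t => f (-t)) hk (fun t => hC (-t))
  have hAc : Continuous A := hlip (k * (C / k) + C) hAs fun s => (abs_sub _ _).trans
    (add_le_add (by rw [abs_mul, abs_of_pos hk]; exact mul_le_mul_of_nonneg_left (hAb s) hk.le)
      (hC s))
  have hBc : Continuous B := hlip (C + k * (C / k)) hBs fun s => (abs_sub _ _).trans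
    (add_le_add (hC s)
      (by rw [abs_mul, abs_of_pos hk]; exact mul_le_mul_of_nonneg_left (hBb (-s)) hk.le))
  have hAi : ∀ a b, IntervalIntegrable (fun s => k * A s) volume a b :=
    fun a b => (hAc.const_mul k).intervalIntegrable a b
  have hBi : ∀ a b, IntervalIntegrable (fun s => k * B s) volume a b :=
    fun a b => (hBc.const_mul k).intervalIntegrable a b
  have hres : ∀ s, lineResolvent m h f s = (A s + B s) / (2 * (k * h)) := fun s => rfl
  refine ⟨fun s => (A s - B s) / (2 * h), fun s => ?_, fun a b => ?_⟩
  · have h1 : ∀ x, lineResolvent m h f x =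
        (∫ t in (0 : ℝ)..x, (A t - B t) / (2 * h)) + lineResolvent m h f 0 := by
      intro x
      have h2 : ∫ t in (0 : ℝ)..x, (A t - B t) / (2 * h) =
          (A x - A 0 + (B x - B 0)) / (2 * (k * h)) := by
        rw [hAs, hBs, ← intervalIntegral.integral_add ((hAi _ _).sub (hfi.intervalIntegrable' _ _))
          ((hfi.intervalIntegrable' _ _).sub (hBi _ _)), ← intervalIntegral.integral_div]
        refine intervalIntegral.integral_congr fun t _ => ?_
        field_simp
        ring
      rw [h2, hres, hres]
      ring
    rw [show lineResolvent m h f = _ from funext h1]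
    have hc : Continuous fun t => (A t - B t) / (2 * h) := (hAc.sub hBc).div_const _
    exact (intervalIntegral.integral_hasDerivAt_right (hc.intervalIntegrable _ _)
      hc.aestronglyMeasurable.stronglyMeasurableAtFilter hc.continuousAt).add_const _
  · rw [show h * ((A b - B b) / (2 * h) - (A a - B a) / (2 * h)) =
      ((A b - A a) - (B b - B a)) / 2 by field_simp; ring, hAs, hBs, ← intervalIntegral.integral_sub
        ((hAi _ _).sub (hfi.intervalIntegrable' _ _)) ((hfi.intervalIntegrable' _ _).sub (hBi _ _)),
        ← intervalIntegral.integral_div]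
    refine intervalIntegral.integral_congr fun t _ => ?_
    have : m = k * k * h := by rw [hkk]; field_simp
    simp only [hres]
    rw [this]
    field_simp
    ring

end Resolvent

/-! ### Existence for a regularized inclusion -/

open BoundedContinuousFunction in
/-- Solution of `h θ'' = β(θ + s) + ε θ - P(s)` for a Lipschitz increasing `β`, as the fixed point of
a contraction. The bound on the solution does not depend on `K`, `ε` and `h`. -/
theorem exists_regularized_solution {β P : ℝ → ℝ} {K ε h B : ℝ} (hK : 0 < K) (hε : 0 < ε)
    (hh : 0 < h) (hβ : ∀ x y, x ≤ y → 0 ≤ β y - β x ∧ β y - β x ≤ K * (y - x))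
    (hβper : ∀ x, β (x + 2 * π) = β x + 2 * π) (hβid : ∀ x, |β x - x| ≤ 2)
    (hPm : Measurable P) (hPper : ∀ s, P (s + 2 * π) = P s + 2 * π) (hPB : ∀ s, |P s - s| ≤ B) :
    ∃ θ W : ℝ → ℝ, (∀ s, HasDerivAt θ (W s) s) ∧
      (∀ a b, h * (W b - W a) = ∫ s in a..b, (β (θ s + s) + ε * θ s - P s)) ∧
      (∀ s, θ (s + 2 * π) = θ s) ∧ ∀ s, |θ s| ≤ 2 + B := by
  have hm : 0 < K + ε := by positivity
  have hβm : Measurable β := (show Monotone β from fun x y hxy => by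
    linarith [(hβ x y hxy).1]).measurable
  -- the right-hand side of the fixed point equation
  set F : (ℝ → ℝ) → ℝ → ℝ := fun θ t => K * θ t - β (θ t + t) + P t with hF
  have hFm : ∀ θ : ℝ →ᵇ ℝ, Measurable (F θ) := fun θ => by
    have := θ.continuous.measurable
    exact ((this.const_mul K).sub (hβm.comp (this.add measurable_id))).add hPm
  have hFb : ∀ (θ : ℝ →ᵇ ℝ) t, |F θ t| ≤ (K - 1) * ‖θ‖ + (2 + B) := by
    intro θ t
    have h1 := abs_le.1 (θ.norm_coe_le_norm t)
    have h2 := (hβ _ _ (by linarith [h1.2] : θ t + t ≤ ‖θ‖ + t)).2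
    have h3 := (hβ _ _ (by linarith [h1.1] : -‖θ‖ + t ≤ θ t + t)).2
    have h4 := abs_le.1 (hβid (‖θ‖ + t))
    have h5 := abs_le.1 (hβid (-‖θ‖ + t))
    have h6 := abs_le.1 (hPB t)
    simp only [hF]
    exact abs_le.2 ⟨by linarith [h5.2, h6.1], by linarith [h4.1, h6.2]⟩
  have hFsub : ∀ (θ η : ℝ →ᵇ ℝ) t, |F θ t - F η t| ≤ K * dist θ η := by
    intro θ η t
    have h0 : |θ t - η t| ≤ dist θ η := by
      rw [← Real.dist_eq]; exact BoundedContinuousFunction.dist_coe_le_dist t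
    have h0' := abs_le.1 h0
    simp only [hF]
    rcases le_total (θ t) (η t) with hle | hle
    · have h1 := hβ _ _ (add_le_add_left hle t)
      exact abs_le.2 ⟨by nlinarith, by nlinarith⟩
    · have h1 := hβ _ _ (add_le_add_left hle t)
      exact abs_le.2 ⟨by nlinarith, by nlinarith⟩
  have hres := fun θ : ℝ →ᵇ ℝ => exists_hasDerivAt_resolvent hm hh (hFm θ) (hFb θ)
  set T : (ℝ →ᵇ ℝ) → (ℝ →ᵇ ℝ) := fun θ =>
    BoundedContinuousFunction.ofNormedAddCommGroup (lineResolvent (K + ε) h (F θ))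
      (continuous_iff_continuousAt.2 fun s => ((hres θ).choose_spec.1 s).continuousAt)
      (((K - 1) * ‖θ‖ + (2 + B)) / (K + ε)) (abs_resolvent_le hm hh (hFb θ)) with hT
  have hTapp : ∀ θ s, T θ s = lineResolvent (K + ε) h (F θ) s := fun θ s => rfl
  have hKε : K / (K + ε) < 1 := (div_lt_one hm).2 (by linarith)
  have hcontr : ContractingWith ⟨K / (K + ε), by positivity⟩ T := by
    refine ⟨by exact_mod_cast hKε, LipschitzWith.of_dist_le_mul fun θ η => ?_⟩
    refine (BoundedContinuousFunction.dist_le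
      (mul_nonneg (NNReal.coe_nonneg _) dist_nonneg)).2 fun s => ?_
    rw [Real.dist_eq, hTapp, hTapp, ← resolvent_sub_fun hm hh (hFm θ) (hFb θ) (hFm η) (hFb η)]
    refine (abs_resolvent_le hm hh (hFsub θ η) s).trans_eq ?_
    change _ = K / (K + ε) * dist θ η
    ring
  set θ := ContractingWith.fixedPoint T hcontr with hθ
  have hfix : T θ = θ := hcontr.fixedPoint_isFixedPt
  have hfix' : ∀ s, lineResolvent (K + ε) h (F θ) s = θ s := fun s => by rw [← hTapp, hfix]
  have hfun : lineResolvent (K + ε) h (F θ) = θ := funext hfix'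
  obtain ⟨W, hW1, hW2⟩ := hres θ
  rw [hfun] at hW1 hW2
  refine ⟨θ, W, hW1, fun a b => ?_, ?_, ?_⟩
  · rw [hW2]
    refine intervalIntegral.integral_congr fun s _ => ?_
    simp only [hF]
    ring
  · -- the translate of the solution solves the same equation
    set η : ℝ →ᵇ ℝ := θ.compContinuous ⟨fun s => s + 2 * π, by fun_prop⟩ with hη
    have hηapp : ∀ s, η s = θ (s + 2 * π) := fun s => rfl
    have h1 : T η = η := by
      ext s
      rw [hTapp, hηapp, ← hfix', ← resolvent_comp_add]
      congr 1
      funext t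
      simp only [hF, hηapp]
      rw [← add_assoc, hβper, hPper]
      ring
    have h2 : η = θ := hcontr.fixedPoint_unique h1
    intro s
    rw [← hηapp, h2]
  · have h1 : ‖θ‖ ≤ ((K - 1) * ‖θ‖ + (2 + B)) / (K + ε) := by
      refine (BoundedContinuousFunction.norm_le ?_).2 fun s => ?_
      · exact div_nonneg ((abs_nonneg _).trans (hFb θ 0)) hm.le
      · rw [← hfix' s]
        exact abs_resolvent_le hm hh (hFb θ) s
    rw [le_div_iff₀ hm] at h1
    intro s
    have h2 := θ.norm_coe_le_norm s
    rw [Real.norm_eq_abs] at h2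
    nlinarith [norm_nonneg θ]

/-! ### The inverse of the subdifferential and its regularization -/

/-- A single-valued selection of the inverse of `∂J`: the step function with value `α_j` between
the slopes `α_j - π/4` and `α_j + π/4`. -/
def stairs (x : ℝ) : ℝ := π / 2 * (⌊x / (π / 2)⌋ + 1 / 2)

theorem stairs_monotone : Monotone stairs := by
  intro x y hxy
  unfold stairs
  have : ⌊x / (π / 2)⌋ ≤ ⌊y / (π / 2)⌋ := Int.floor_mono (by gcongr)
  have h' : (⌊x / (π / 2)⌋ : ℝ) ≤ ⌊y / (π / 2)⌋ := by exact_mod_cast this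
  gcongr

theorem stairs_eq {j : ℤ} {x : ℝ} (hx : x ∈ Ico (facetSlope j) (facetSlope (j + 1))) :
    stairs x = prefAngle (j + 1) := by
  have hp : 0 < π / 2 := by positivity
  have h1 : ⌊x / (π / 2)⌋ = j - 1 := by
    rw [Int.floor_eq_iff, le_div_iff₀ hp, div_lt_iff₀ hp]
    unfold facetSlope at hx
    push_cast at hx ⊢
    exact ⟨by linarith [hx.1], by linarith [hx.2]⟩
  unfold stairs prefAngle
  rw [h1]
  push_cast
  ring

theorem facetSlope_add_one (j : ℤ) : facetSlope (j + 1) = facetSlope j + π / 2 := by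
  unfold facetSlope; push_cast; ring

theorem exists_mem_Ico_facetSlope (x : ℝ) :
    ∃ j : ℤ, x ∈ Ico (facetSlope j) (facetSlope (j + 1)) := by
  obtain ⟨j, h1, h2⟩ := exists_mem_Ico_prefAngle (x - π / 4)
  rw [prefAngle_eq] at h1 h2
  exact ⟨j, by linarith, by linarith⟩

theorem abs_stairs_sub_le (x : ℝ) : |stairs x - x| ≤ π / 4 := by
  obtain ⟨j, h1, h2⟩ := exists_mem_Ico_facetSlope x
  rw [stairs_eq ⟨h1, h2⟩, prefAngle_add_one]
  rw [facetSlope_add_one] at h2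
  exact abs_le.2 ⟨by linarith, by linarith⟩

theorem stairs_add_two_pi (x : ℝ) : stairs (x + 2 * π) = stairs x + 2 * π := by
  unfold stairs
  have : (x + 2 * π) / (π / 2) = x / (π / 2) + (4 : ℕ) := by
    field_simp; push_cast; ring
  rw [this, Int.floor_add_natCast]
  push_cast
  ring

/-- `∂J` is the inverse of the maximal monotone graph spanned by the step function. -/
theorem mem_subdiff_of_stairs {x q : ℝ}
    (h : ∀ η > 0, q ∈ Icc (stairs (x - η)) (stairs (x + η))) : x ∈ subdiff crystalJ q := by
  obtain ⟨j, h1, h2⟩ := exists_mem_Ico_facetSlope x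
  have hp := pi_pos
  have hup : q ≤ prefAngle (j + 1) := by
    have h3 := (h ((facetSlope (j + 1) - x) / 2) (by linarith)).2
    rwa [stairs_eq (j := j) ⟨by linarith, by linarith⟩] at h3
  rcases h1.eq_or_lt with h1 | h1
  · have h3 := (h (π / 4) (by positivity)).1
    have h4 := facetSlope_add_one (j - 1)
    rw [sub_add_cancel] at h4
    rw [stairs_eq (j := j - 1) ⟨by linarith, by rw [sub_add_cancel]; linarith⟩,
      sub_add_cancel] at h3
    rw [← h1]
    exact facetSlope_mem_subdiff ⟨h3, hup⟩
  · have h3 := (h ((x - facetSlope j) / 2) (by linarith)).1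
    rw [stairs_eq (j := j) ⟨by linarith, by linarith⟩] at h3
    rw [le_antisymm hup h3]
    refine mem_subdiff_prefAngle ?_
    rw [prefAngle_add_one]
    rw [facetSlope_add_one] at h2
    exact ⟨by linarith, by linarith⟩

/-- The step function averaged over an interval of length `δ`. -/
def smoothStairs (δ x : ℝ) : ℝ := δ⁻¹ * ∫ t in x..x + δ, stairs t

section Smooth

variable {δ : ℝ}

theorem stairs_intervalIntegrable (a b : ℝ) : IntervalIntegrable stairs volume a b :=
  stairs_monotone.intervalIntegrable

theorem smoothStairs_mem (hδ : 0 < δ) (x : ℝ) :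
    smoothStairs δ x ∈ Icc (stairs x) (stairs (x + δ)) := by
  have h0 : x ≤ x + δ := by linarith
  have h1 := intervalIntegral.integral_mono_on h0 intervalIntegrable_const
    (stairs_intervalIntegrable x (x + δ)) fun t ht => stairs_monotone ht.1
  have h2 := intervalIntegral.integral_mono_on h0 (stairs_intervalIntegrable x (x + δ))
    intervalIntegrable_const fun t ht => stairs_monotone ht.2
  simp only [intervalIntegral.integral_const, add_sub_cancel_left, smul_eq_mul] at h1 h2
  unfold smoothStairs
  rw [mem_Icc, le_inv_mul_iff₀ hδ, inv_mul_le_iff₀ hδ]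
  exact ⟨h1, h2⟩

theorem smoothStairs_sub (δ x y : ℝ) :
    smoothStairs δ y - smoothStairs δ x = δ⁻¹ * ∫ t in x..y, (stairs (t + δ) - stairs t) := by
  have hc : IntervalIntegrable (fun t => stairs (t + δ)) volume x y :=
    (stairs_monotone.comp (monotone_id.add_const δ)).intervalIntegrable
  rw [intervalIntegral.integral_sub hc (stairs_intervalIntegrable x y),
    intervalIntegral.integral_comp_add_right]
  have h2 := intervalIntegral.integral_add_adjacent_intervals (stairs_intervalIntegrable x y)
    (stairs_intervalIntegrable y (y + δ))
  have h3 := intervalIntegral.integral_add_adjacent_intervals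
    (stairs_intervalIntegrable x (x + δ)) (stairs_intervalIntegrable (x + δ) (y + δ))
  unfold smoothStairs
  rw [← mul_sub]
  congr 1
  linarith

theorem smoothStairs_sub_mem (hδ : 0 < δ) {x y : ℝ} (hxy : x ≤ y) :
    0 ≤ smoothStairs δ y - smoothStairs δ x ∧
      smoothStairs δ y - smoothStairs δ x ≤ δ⁻¹ * (δ + π / 2) * (y - x) := by
  have hc : IntervalIntegrable (fun t => stairs (t + δ) - stairs t) volume x y :=
    (stairs_monotone.comp (monotone_id.add_const δ)).intervalIntegrable.sub
      (stairs_intervalIntegrable x y)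
  rw [smoothStairs_sub]
  constructor
  · refine mul_nonneg (inv_pos.2 hδ).le (intervalIntegral.integral_nonneg hxy fun t _ => ?_)
    exact sub_nonneg.2 (stairs_monotone (by linarith))
  · rw [mul_assoc]
    refine mul_le_mul_of_nonneg_left ?_ (inv_pos.2 hδ).le
    have h1 := intervalIntegral.integral_mono_on hxy hc
      (intervalIntegrable_const (c := δ + π / 2)) fun t _ => by
        have h1 := abs_le.1 (abs_stairs_sub_le (t + δ))
        have h2 := abs_le.1 (abs_stairs_sub_le t)
        linarith
    rw [intervalIntegral.integral_const, smul_eq_mul] at h1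
    linarith

theorem smoothStairs_add_two_pi (hδ : 0 < δ) (x : ℝ) :
    smoothStairs δ (x + 2 * π) = smoothStairs δ x + 2 * π := by
  have h1 : ∫ t in x + 2 * π..x + 2 * π + δ, stairs t = ∫ t in x..x + δ, (stairs t + 2 * π) := by
    rw [show x + 2 * π + δ = x + δ + 2 * π by ring,
      ← intervalIntegral.integral_comp_add_right]
    exact intervalIntegral.integral_congr fun t _ => stairs_add_two_pi t
  unfold smoothStairs
  rw [h1, intervalIntegral.integral_add (stairs_intervalIntegrable _ _) intervalIntegrable_const,
    intervalIntegral.integral_const, add_sub_cancel_left, smul_eq_mul, mul_add,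
    inv_mul_cancel_left₀ hδ.ne']

theorem abs_smoothStairs_sub_le (hδ : 0 < δ) (hδ1 : δ ≤ 1) (x : ℝ) :
    |smoothStairs δ x - x| ≤ 2 := by
  obtain ⟨h1, h2⟩ := smoothStairs_mem hδ x
  have h3 := abs_le.1 (abs_stairs_sub_le x)
  have h4 := abs_le.1 (abs_stairs_sub_le (x + δ))
  have := pi_lt_four
  exact abs_le.2 ⟨by linarith, by linarith⟩

end Smooth

/-! ### Existence of one step -/

/-- One step of the scheme can be solved for every angle function. The flux is a limit, along an
ultrafilter, of solutions of regularized inclusions. -/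
theorem exists_isFluxStep {h : ℝ} {P : ℝ → ℝ} (hh : 0 < h) (hP : IsAngleFn P) :
    ∃ Q om W, IsAngleFn Q ∧ IsFluxStep h P Q om W := by
  obtain ⟨B, hB⟩ := hP.exists_abs_sub_id_le
  have hB0 : 0 ≤ B := (abs_nonneg _).trans (hB 0)
  have hPi := hP.locallyIntegrable.intervalIntegrable'
  set δ : ℕ → ℝ := fun n => 1 / ((n : ℝ) + 1) with hδdef
  have hδ0 : ∀ n, 0 < δ n := fun n => by positivity
  have hδ1 : ∀ n, δ n ≤ 1 := fun n =>
    (div_le_one (by positivity)).2 (by linarith [Nat.cast_nonneg (α := ℝ) n])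
  have hδlim : Tendsto δ (hyperfilter ℕ) (𝓝 0) :=
    tendsto_one_div_add_atTop_nhds_zero_nat.mono_left Nat.hyperfilter_le_atTop
  choose θ W hθW hW hθper hθB using fun n => exists_regularized_solution (β := smoothStairs (δ n))
    (K := (δ n)⁻¹ * (δ n + π / 2)) (ε := δ n) (mul_pos (inv_pos.2 (hδ0 n))
    (add_pos (hδ0 n) (by positivity))) (hδ0 n) hh (fun x y => smoothStairs_sub_mem (hδ0 n))
    (smoothStairs_add_two_pi (hδ0 n)) (abs_smoothStairs_sub_le (hδ0 n) (hδ1 n)) hP.bv.measurable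
    hP.add_two_pi hB
  have hθc : ∀ n, Continuous (θ n) := fun n =>
    continuous_iff_continuousAt.2 fun s => (hθW n s).continuousAt
  have hsm : ∀ n, Measurable (smoothStairs (δ n)) := fun n =>
    (show Monotone (smoothStairs (δ n)) from fun x y hxy => by
      linarith [(smoothStairs_sub_mem (hδ0 n) hxy).1]).measurable
  have hβi : ∀ n a b, IntervalIntegrable (fun s => smoothStairs (δ n) (θ n s + s)) volume a b := by
    intro n a b
    refine (((hθc n).norm.add (continuous_norm)).add (continuous_const (y := (2 : ℝ)))
      |>.intervalIntegrable a b).mono_fun'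
      ((hsm n).comp ((hθc n).add continuous_id).measurable).aestronglyMeasurable
      (.of_forall fun s => ?_)
    have h1 := abs_le.1 (abs_smoothStairs_sub_le (hδ0 n) (hδ1 n) (θ n s + s))
    have h2 := abs_le.1 (abs_add_le (θ n s) s)
    have h3 := le_abs_self (θ n s + s)
    have h4 := neg_abs_le (θ n s + s)
    simp only [Pi.add_apply, Real.norm_eq_abs]
    exact abs_le.2 ⟨by linarith, by linarith⟩
  have hεi : ∀ n a b, IntervalIntegrable (fun s => δ n * θ n s) volume a b := fun n a b =>
    ((hθc n).const_mul _).intervalIntegrable a b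
  -- uniform bounds
  set L : ℝ := (2 + (2 + B) + (2 + B) + B) / h with hLdef
  have hL0 : 0 ≤ L := by positivity
  have hWL : ∀ n a b, |W n b - W n a| ≤ L * |b - a| := by
    intro n a b
    have h1 : ‖∫ s in a..b, (smoothStairs (δ n) (θ n s + s) + δ n * θ n s - P s)‖ ≤
        (2 + (2 + B) + (2 + B) + B) * |b - a| := by
      refine intervalIntegral.norm_integral_le_of_norm_le_const fun s _ => ?_
      have h1 := abs_le.1 (abs_smoothStairs_sub_le (hδ0 n) (hδ1 n) (θ n s + s))
      have h2 := abs_le.1 (hθB n s)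
      have h3 := abs_le.1 (hB s)
      have h4 : |δ n * θ n s| ≤ 2 + B := by
        rw [abs_mul, abs_of_pos (hδ0 n)]
        nlinarith [hθB n s, abs_nonneg (θ n s), hδ1 n, hδ0 n]
      have h4 := abs_le.1 h4
      rw [Real.norm_eq_abs]
      exact abs_le.2 ⟨by linarith, by linarith⟩
    rw [← hW, Real.norm_eq_abs, abs_mul, abs_of_pos hh] at h1
    rw [hLdef, div_mul_eq_mul_div, le_div_iff₀ hh]
    linarith
  have hmvt : ∀ n s t, ∃ ξ, |ξ - s| ≤ |t - s| ∧ θ n t - θ n s = W n ξ * (t - s) := by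
    intro n s t
    rcases lt_trichotomy s t with hst | rfl | hst
    · obtain ⟨ξ, hξ, he⟩ := exists_hasDerivAt_eq_slope (θ n) (W n) hst
        (hθc n).continuousOn (fun x _ => hθW n x)
      refine ⟨ξ, ?_, ?_⟩
      · rw [abs_of_pos (by linarith [hξ.1]), abs_of_pos (by linarith)]; linarith [hξ.2]
      · rw [he, div_mul_cancel₀]; linarith
    · exact ⟨s, by simp, by simp⟩
    · obtain ⟨ξ, hξ, he⟩ := exists_hasDerivAt_eq_slope (θ n) (W n) hst
        (hθc n).continuousOn (fun x _ => hθW n x)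
      refine ⟨ξ, ?_, ?_⟩
      · rw [abs_of_neg (by linarith [hξ.2]), abs_of_neg (by linarith)]; linarith [hξ.1]
      · rw [he, div_mul_eq_mul_div, eq_div_iff (by linarith)]; ring
  set R : ℝ := 2 * (2 + B) + L with hRdef
  have hWR : ∀ n s, |W n s| ≤ R := by
    intro n s
    obtain ⟨ξ, h1, h2⟩ := hmvt n s (s + 1)
    rw [add_sub_cancel_left, mul_one] at h2
    rw [add_sub_cancel_left, abs_one] at h1
    have h3 := hWL n ξ s
    rw [abs_sub_comm s ξ] at h3
    have h4 := abs_le.1 (h3.trans (mul_le_of_le_one_right hL0 h1))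
    have h5 := abs_le.1 (hθB n (s + 1))
    have h6 := abs_le.1 (hθB n s)
    exact abs_le.2 ⟨by linarith, by linarith⟩
  have hθR : ∀ n s t, |θ n t - θ n s| ≤ R * |t - s| := by
    intro n s t
    obtain ⟨ξ, -, h2⟩ := hmvt n s t
    rw [h2, abs_mul]
    exact mul_le_mul_of_nonneg_right (hWR n ξ) (abs_nonneg _)
  have htaylor : ∀ n s t, |θ n t - θ n s - W n s * (t - s)| ≤ L * (t - s) ^ 2 := by
    intro n s t
    obtain ⟨ξ, h1, h2⟩ := hmvt n s t
    rw [h2, ← sub_mul, abs_mul, ← sq_abs (t - s), pow_two, ← mul_assoc]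
    refine mul_le_mul_of_nonneg_right ((hWL n s ξ).trans ?_) (abs_nonneg _)
    exact mul_le_mul_of_nonneg_left h1 hL0
  -- the limits
  choose Θ hΘ using fun s => exists_tendsto_hyperfilter (fun n => hθB n s)
  choose V hV using fun s => exists_tendsto_hyperfilter (fun n => hWR n s)
  have hVL : ∀ a b, |V b - V a| ≤ L * |b - a| := fun a b =>
    le_of_tendsto ((hV b).sub (hV a)).abs (.of_forall fun n => hWL n a b)
  have hΘV : ∀ s, HasDerivAt Θ (V s) s := by
    intro s
    have h1 : ∀ t, |Θ t - Θ s - V s * (t - s)| ≤ L * (t - s) ^ 2 := fun t =>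
      le_of_tendsto (((hΘ t).sub (hΘ s)).sub ((hV s).mul_const (t - s))).abs
        (.of_forall fun n => htaylor n s t)
    refine .of_isLittleO (Asymptotics.IsBigO.trans_isLittleO (g := fun t => (t - s) ^ 2)
      (Asymptotics.IsBigO.of_bound L (.of_forall fun t => ?_)) ?_)
    · rw [Real.norm_eq_abs, Real.norm_eq_abs, abs_of_nonneg (sq_nonneg (t - s)), smul_eq_mul,
        mul_comm (t - s)]
      exact h1 t
    · have h2 := Asymptotics.isLittleO_pow_id (𝕜 := ℝ) one_lt_two
      refine (h2.comp_tendsto (k := fun t => t - s) (l' := 𝓝 s) ?_)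
      have : Tendsto (fun t => t - s) (𝓝 s) (𝓝 (s - s)) := (continuous_sub_right s).tendsto s
      rwa [sub_self] at this
  have hΘper : ∀ s, Θ (s + 2 * π) = Θ s := fun s =>
    tendsto_nhds_unique (hΘ _) (by simpa only [hθper] using hΘ s)
  have hVper : ∀ s, V (s + 2 * π) = V s := by
    intro s
    have h1 := (hΘV (s + 2 * π)).comp_add_const s (2 * π)
    rw [funext hΘper] at h1
    exact h1.unique (hΘV s)
  have hVlip : LipschitzWith L.toNNReal V := LipschitzWith.of_dist_le_mul fun x y => by
    rw [Real.dist_eq, Real.dist_eq, Real.coe_toNNReal _ hL0]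
    exact hVL y x
  have hVac : ∀ a b, AbsolutelyContinuousOnInterval V a b := fun a b =>
    hVlip.lipschitzOnWith.absolutelyContinuousOnInterval
  have hVd : LocallyIntegrable (deriv V) volume :=
    locallyIntegrable_of_intervalIntegrable fun a b => (hVac a b).intervalIntegrable_deriv
  set Q : ℝ → ℝ := fun s => P s + h * deriv V s with hQdef
  have hQi : LocallyIntegrable Q volume := hP.locallyIntegrable.add (hVd.smul h)
  have hmem : ∀ᵐ s, Θ s + s ∈ subdiff crystalJ (Q s) := by
    filter_upwards [LocallyIntegrable.ae_hasDerivAt_integral hP.locallyIntegrable,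
      hVlip.ae_differentiableAt_real] with s hs1 hs2
    refine mem_subdiff_of_stairs fun η hη => ?_
    set x := Θ s + s
    -- the derivative of this function at `s` is the new angle
    have hF : HasDerivAt (fun t => h * V t + ∫ y in (0 : ℝ)..t, P y) (Q s) s := by
      have := (hs2.hasDerivAt.const_mul h).add (hs1 0)
      rwa [add_comm (h * _)] at this
    have hslope : Tendsto (slope (fun t => h * V t + ∫ y in (0 : ℝ)..t, P y) s) (𝓝[>] s)
        (𝓝 (Q s)) :=
      (hasDerivAt_iff_tendsto_slope.1 hF).mono_left (nhdsWithin_mono _ fun t ht => ht.ne')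
    set r := η / (4 * (R + 1)) with hr
    have hR0 : 0 ≤ R := by positivity
    have hr0 : 0 < r := by positivity
    have hev : ∀ t ∈ Ioo s (s + r), ∀ᶠ n in (hyperfilter ℕ : Filter ℕ),
        (stairs (x - η) - δ n * (2 + B)) * (t - s) ≤
          h * (W n t - W n s) + ∫ y in s..t, P y ∧
        h * (W n t - W n s) + ∫ y in s..t, P y ≤
          (stairs (x + η) + δ n * (2 + B)) * (t - s) := by
      intro t ht
      have h1 : ∀ᶠ n in (hyperfilter ℕ : Filter ℕ), |θ n s - Θ s| < η / 4 := by
        have := (hΘ s).eventually (Metric.ball_mem_nhds (Θ s) (by positivity : 0 < η / 4))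
        simpa [Real.dist_eq] using this
      have h2 : ∀ᶠ n in (hyperfilter ℕ : Filter ℕ), δ n < η / 4 :=
        hδlim.eventually (gt_mem_nhds (by positivity))
      filter_upwards [h1, h2] with n h1 h2
      have hb : ∀ y ∈ Icc s t, smoothStairs (δ n) (θ n y + y) + δ n * θ n y ∈
          Icc (stairs (x - η) - δ n * (2 + B)) (stairs (x + η) + δ n * (2 + B)) := by
        intro y hy
        have h3 : R * |y - s| + |y - s| ≤ η / 4 := by
          rw [abs_of_nonneg (by linarith [hy.1])]
          have : (R + 1) * (y - s) ≤ (R + 1) * r :=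
            mul_le_mul_of_nonneg_left (by linarith [hy.2, ht.2]) (by linarith)
          have h5 : (R + 1) * r = η / 4 := by rw [hr]; field_simp
          linarith
        have h4 := abs_le.1 (hθR n s y)
        have h5 := abs_le.1 (le_refl |y - s|)
        have h6 := abs_lt.1 h1
        obtain ⟨h7, h8⟩ := smoothStairs_mem (hδ0 n) (θ n y + y)
        have h9 := stairs_monotone (by linarith : x - η ≤ θ n y + y)
        have h10 := stairs_monotone (by linarith : θ n y + y + δ n ≤ x + η)
        have h11 := abs_le.1 (hθB n y)
        have h12 := hδ0 n
        exact ⟨by nlinarith, by nlinarith⟩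
      have hi := (hβi n s t).add (hεi n s t)
      have heq : h * (W n t - W n s) + ∫ y in s..t, P y =
          ∫ y in s..t, (smoothStairs (δ n) (θ n y + y) + δ n * θ n y) := by
        rw [hW, intervalIntegral.integral_sub hi (hPi s t)]
        ring
      rw [heq]
      have h3 := intervalIntegral.integral_mono_on ht.1.le intervalIntegrable_const hi
        fun y hy => (hb y hy).1
      have h4 := intervalIntegral.integral_mono_on ht.1.le hi intervalIntegrable_const
        fun y hy => (hb y hy).2
      rw [intervalIntegral.integral_const, smul_eq_mul, mul_comm] at h3 h4
      exact ⟨h3, h4⟩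
    have hlim : ∀ t ∈ Ioo s (s + r), slope (fun t => h * V t + ∫ y in (0 : ℝ)..t, P y) s t ∈
        Icc (stairs (x - η)) (stairs (x + η)) := by
      intro t ht
      have h1 : Tendsto (fun n => h * (W n t - W n s) + ∫ y in s..t, P y) (hyperfilter ℕ)
          (𝓝 (h * (V t - V s) + ∫ y in s..t, P y)) :=
        (((hV t).sub (hV s)).const_mul h).add_const _
      have h2 : Tendsto (fun n => (stairs (x - η) - δ n * (2 + B)) * (t - s)) (hyperfilter ℕ)
          (𝓝 ((stairs (x - η) - 0 * (2 + B)) * (t - s))) :=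
        ((hδlim.mul_const _).const_sub _).mul_const _
      have h3 : Tendsto (fun n => (stairs (x + η) + δ n * (2 + B)) * (t - s)) (hyperfilter ℕ)
          (𝓝 ((stairs (x + η) + 0 * (2 + B)) * (t - s))) :=
        ((hδlim.mul_const _).const_add _).mul_const _
      have h4 := le_of_tendsto_of_tendsto h2 h1 ((hev t ht).mono fun n hn => hn.1)
      have h5 := le_of_tendsto_of_tendsto h1 h3 ((hev t ht).mono fun n hn => hn.2)
      have h6 : 0 < t - s := by linarith [ht.1]
      have h7 := intervalIntegral.integral_add_adjacent_intervals (hPi 0 s) (hPi s t)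
      rw [slope_def_field, mem_Icc, le_div_iff₀ h6, div_le_iff₀ h6]
      exact ⟨by linarith, by linarith⟩
    exact isClosed_Icc.mem_of_tendsto hslope
      (mem_of_superset (Ioo_mem_nhdsGT (by linarith)) hlim)
  have S : IsFluxStep h P Q (fun s => Θ s + s) (fun s => V s + 1) :=
    { hasDerivAt := fun s => (hΘV s).add (hasDerivAt_id s)
      sub_eq := fun a b => by
        have h1 : ∫ s in a..b, (Q s - P s) = ∫ s in a..b, h * deriv V s :=
          intervalIntegral.integral_congr fun s _ => by simp only [hQdef]; ring
        rw [h1, intervalIntegral.integral_const_mul, (hVac a b).integral_deriv_eq_sub]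
        ring
      add_two_pi := fun s => by rw [hΘper]; ring
      mem_subdiff := hmem
      locInt_old := hP.locallyIntegrable
      locInt_new := hQi }
  have hdper : ∀ s, deriv V (s + 2 * π) = deriv V s := fun s => by
    rw [← deriv_comp_add_const, funext hVper]
  obtain ⟨Q', hQ', hae, -⟩ := S.exists_isAngleFn hh hP (B := B + h * L)
    (fun s => by simp only [hQdef]; rw [hP.add_two_pi, hdper]; ring)
    (fun s => by
      have h1 : ‖deriv V s‖ ≤ L.toNNReal := norm_deriv_le_of_lipschitz hVlip
      rw [Real.coe_toNNReal _ hL0, Real.norm_eq_abs] at h1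
      calc |Q s - s| = |(P s - s) + h * deriv V s| := by simp only [hQdef]; ring_nf
        _ ≤ |P s - s| + |h * deriv V s| := abs_add_le _ _
        _ ≤ B + h * L := by
          rw [abs_mul, abs_of_pos hh]
          exact add_le_add (hB s) (mul_le_mul_of_nonneg_left h1 hh.le))
  exact ⟨Q', _, _, hQ', S.congr_new hae hQ'.locallyIntegrable⟩

/-! ### Facets of an angle function -/

theorem notMem_facets_iff {P : ℝ → ℝ} {s : ℝ} :
    s ∉ facets (filledGraph P) ↔
      ∃ j : ℤ, filledGraph P s ⊆ Ioo (prefAngle j) (prefAngle (j + 1)) := by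
  constructor
  · intro hs
    have hne : ∀ j, prefAngle j ∉ filledGraph P s := fun j hj => hs (mem_iUnion.2 ⟨j, hj⟩)
    have hl : Function.leftLim P s ∈ filledGraph P s := left_mem_uIcc
    obtain ⟨j, h1, h2⟩ := exists_mem_Ico_prefAngle (Function.leftLim P s)
    refine ⟨j, fun x hx => ⟨?_, ?_⟩⟩
    · by_contra! hc
      exact hne j (ordConnected_uIcc.out hx hl ⟨hc, h1⟩)
    · by_contra! hc
      exact hne (j + 1) (ordConnected_uIcc.out hl hx ⟨h2.le, hc⟩)
  · rintro ⟨j, hj⟩ hs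
    obtain ⟨i, hi⟩ := mem_iUnion.1 hs
    obtain ⟨h1, h2⟩ := hj hi
    have h3 := prefAngle_strictMono.lt_iff_lt.1 h1
    have h4 := prefAngle_strictMono.lt_iff_lt.1 h2
    lia

theorem eq_of_subset_Ioo_prefAngle {A : Set ℝ} (hA : A.Nonempty) {i j : ℤ}
    (hi : A ⊆ Ioo (prefAngle i) (prefAngle (i + 1)))
    (hj : A ⊆ Ioo (prefAngle j) (prefAngle (j + 1))) : i = j := by
  obtain ⟨x, hx⟩ := hA
  have h1 := prefAngle_strictMono.lt_iff_lt.1 ((hi hx).1.trans (hj hx).2)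
  have h2 := prefAngle_strictMono.lt_iff_lt.1 ((hj hx).1.trans (hi hx).2)
  lia

theorem filledGraph_nonempty (P : ℝ → ℝ) (s : ℝ) : (filledGraph P s).Nonempty := nonempty_uIcc

namespace IsAngleFn

variable {P : ℝ → ℝ}

theorem isClosed_facets (hP : IsAngleFn P) : IsClosed (facets (filledGraph P)) := by
  rw [← isOpen_compl_iff, isOpen_iff_mem_nhds]
  intro s hs
  obtain ⟨j, hj⟩ := notMem_facets_iff.1 hs
  filter_upwards [hP.bv.eventually_filledGraph_subset hj] with t ht
  exact notMem_facets_iff.2 ⟨j, ht⟩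

/-- Away from its facets an angle function stays between two consecutive preferred angles. -/
theorem exists_subset_Ioo (hP : IsAngleFn P) {I : Set ℝ} (hI : I ⊆ (facets (filledGraph P))ᶜ)
    (hc : IsPreconnected I) :
    ∃ j : ℤ, ∀ s ∈ I, filledGraph P s ⊆ Ioo (prefAngle j) (prefAngle (j + 1)) := by
  rcases I.eq_empty_or_nonempty with rfl | ⟨s₀, hs₀⟩
  · exact ⟨0, by simp⟩
  have hex := fun s : ℝ => fun hs : s ∈ I => notMem_facets_iff.1 (hI hs)
  choose! J hJ using hex
  have hcont : ContinuousOn J I := by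
    intro s hs
    refine ContinuousWithinAt.congr_of_eventuallyEq (f := fun _ => J s)
      continuousWithinAt_const ?_ rfl
    filter_upwards [self_mem_nhdsWithin,
      mem_nhdsWithin_of_mem_nhds (hP.bv.eventually_filledGraph_subset (hJ s hs))] with t ht h2
    exact eq_of_subset_Ioo_prefAngle (filledGraph_nonempty P t) (hJ t ht) h2
  exact ⟨J s₀, fun s hs => hc.constant hcont hs hs₀ ▸ hJ s hs⟩

theorem mem_filledGraph (hP : IsAngleFn P) (s : ℝ) : P s ∈ filledGraph P s := by
  have h := congrFun hP.upperSelection_eq s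
  exact ⟨min_le_max.trans h.le, h.ge⟩

theorem ae_filledGraph_eq (hP : IsAngleFn P) : ∀ᵐ s, filledGraph P s = {P s} := by
  filter_upwards [hP.bv.ae_continuousAt] with s hs using hP.bv.filledGraph_eq hs

theorem facetSet_add_two_pi (hP : IsAngleFn P) {s : ℝ} {j : ℤ} :
    s + 2 * π ∈ facetSet (filledGraph P) (j + 4) ↔ s ∈ facetSet (filledGraph P) j := by
  simp only [facetSet, mem_ofPred_eq, hP.filledGraph_add_two_pi, prefAngle_add_four]
  exact (add_left_injective (2 * π)).mem_set_image

theorem facets_add_two_pi (hP : IsAngleFn P) {s : ℝ} :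
    s + 2 * π ∈ facets (filledGraph P) ↔ s ∈ facets (filledGraph P) := by
  simp only [facets, mem_iUnion]
  constructor
  · rintro ⟨j, hj⟩
    exact ⟨j - 4, hP.facetSet_add_two_pi.1 (by rwa [sub_add_cancel])⟩
  · rintro ⟨j, hj⟩
    exact ⟨j + 4, hP.facetSet_add_two_pi.2 hj⟩

theorem facets_nonempty (hP : IsAngleFn P) : (facets (filledGraph P)).Nonempty := by
  by_contra hne
  rw [not_nonempty_iff_eq_empty] at hne
  obtain ⟨j, hj⟩ := hP.exists_subset_Ioo (I := univ) (by simp [hne]) isPreconnected_univ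
  have h1 := hj 0 (mem_univ _) (hP.mem_filledGraph 0)
  have h2 := hj (0 + 2 * π) (mem_univ _) (hP.mem_filledGraph _)
  rw [hP.add_two_pi] at h2
  have h3 := prefAngle_add_one j
  have h4 := prefAngle_eq j
  linarith [h1.1, h2.2, pi_pos]

theorem exists_mem_facets_le_ge (hP : IsAngleFn P) (x : ℝ) :
    (∃ a ∈ facets (filledGraph P), a ≤ x) ∧ ∃ b ∈ facets (filledGraph P), x ≤ b := by
  obtain ⟨s, hs⟩ := hP.facets_nonempty
  have hper : Function.Periodic (fun s => s ∈ facets (filledGraph P)) (2 * π) :=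
    fun s => propext hP.facets_add_two_pi
  have hn : ∀ n : ℤ, s + n * (2 * π) ∈ facets (filledGraph P) := fun n =>
    (hper.int_mul n s).symm ▸ hs
  constructor
  · obtain ⟨n, hn1⟩ := exists_int_lt ((x - s) / (2 * π))
    rw [lt_div_iff₀ two_pi_pos] at hn1
    exact ⟨_, hn n, by linarith⟩
  · obtain ⟨n, hn1⟩ := exists_int_gt ((x - s) / (2 * π))
    rw [div_lt_iff₀ two_pi_pos] at hn1
    exact ⟨_, hn n, by linarith⟩

end IsAngleFn

namespace IsFluxStep

variable {h : ℝ} {P Q om W : ℝ → ℝ}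

/-- Off the new facets the flux is locally one of the slopes. -/
theorem eventually_eq_facetSlope (H : IsFluxStep h P Q om W) (hQ : IsAngleFn Q) {s : ℝ} {j : ℤ}
    (hs : filledGraph Q s ⊆ Ioo (prefAngle j) (prefAngle (j + 1))) :
    ∀ᶠ t in 𝓝 s, om t = facetSlope j := by
  obtain ⟨U, hU, hUo, hsU⟩ := eventually_nhds_iff.1 (hQ.bv.eventually_filledGraph_subset hs)
  have hae : om =ᵐ[volume.restrict U] fun _ => facetSlope j := by
    refine (ae_restrict_iff' hUo.measurableSet).2 ?_
    filter_upwards [H.mem_subdiff] with t ht htU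
    exact eq_facetSlope_of_mem_subdiff ht (hU t htU (hQ.mem_filledGraph t))
  filter_upwards [hUo.mem_nhds hsU] with t ht
  exact Measure.eqOn_open_of_ae_eq hae hUo H.continuous_flux.continuousOn continuousOn_const ht

/-- Off the new facets the angle has not changed. -/
theorem filledGraph_eq (hh : 0 < h) (H : IsFluxStep h P Q om W) (hP : IsAngleFn P)
    (hQ : IsAngleFn Q) {s : ℝ} (hs : s ∉ facets (filledGraph Q)) :
    filledGraph Q s = filledGraph P s := by
  obtain ⟨j, hj⟩ := notMem_facets_iff.1 hs
  refine hQ.bv.filledGraph_congr hP.bv (H.eventually_eq_facetSlope hQ hj) ?_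
  exact H.ae_eq_of_eq hh _

theorem facets_subset (hh : 0 < h) (H : IsFluxStep h P Q om W) (hP : IsAngleFn P)
    (hQ : IsAngleFn Q) : facets (filledGraph P) ⊆ facets (filledGraph Q) := by
  intro s hs
  by_contra hc
  obtain ⟨j, hj⟩ := mem_iUnion.1 hs
  refine hc (mem_iUnion.2 ⟨j, ?_⟩)
  change prefAngle j ∈ filledGraph Q s
  rw [H.filledGraph_eq hh hP hQ hc]
  exact hj

/-- Every new facet point is joined to an old one by a segment of new facet points: otherwise the
flux would take the same slope on both sides of it within one gap of the old facets, and the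
maximum principle would make it constant in between. -/
theorem exists_uIcc_subset_facets (hh : 0 < h) (H : IsFluxStep h P Q om W) (hP : IsAngleFn P)
    (hQ : IsAngleFn Q) {x : ℝ} (hx : x ∈ facets (filledGraph Q)) :
    ∃ a ∈ facets (filledGraph P), uIcc a x ⊆ facets (filledGraph Q) := by
  have hsub := H.facets_subset hh hP hQ
  by_cases hxP : x ∈ facets (filledGraph P)
  · exact ⟨x, hxP, by simpa using hx⟩
  by_contra! hcon
  set F := facets (filledGraph P) with hF
  obtain ⟨⟨a₀, ha₀, hax⟩, b₀, hb₀, hbx⟩ := hP.exists_mem_facets_le_ge x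
  have hFc := hP.isClosed_facets
  -- the end points of the gap of the old facets around `x`
  have ha : sSup (F ∩ Iic x) ∈ F ∩ Iic x :=
    IsClosed.csSup_mem (hFc.inter isClosed_Iic) ⟨a₀, ha₀, hax⟩ ⟨x, fun y hy => hy.2⟩
  have hb : sInf (F ∩ Ici x) ∈ F ∩ Ici x :=
    IsClosed.csInf_mem (hFc.inter isClosed_Ici) ⟨b₀, hb₀, hbx⟩ ⟨x, fun y hy => hy.2⟩
  set a := sSup (F ∩ Iic x) with ha'
  set b := sInf (F ∩ Ici x) with hb'
  have hax : a < x := lt_of_le_of_ne ha.2 fun h => hxP (h ▸ ha.1)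
  have hxb : x < b := lt_of_le_of_ne hb.2 fun h => hxP (h ▸ hb.1)
  have hgap : Ioo a b ⊆ Fᶜ := by
    intro t ht htF
    rcases le_total t x with htx | hxt
    · exact absurd (le_csSup (s := F ∩ Iic x) ⟨x, fun y hy => hy.2⟩ ⟨htF, htx⟩) (not_le.2 ht.1)
    · exact absurd (csInf_le (s := F ∩ Ici x) ⟨x, fun y hy => hy.2⟩ ⟨htF, hxt⟩) (not_le.2 ht.2)
  obtain ⟨j, hj⟩ := hP.exists_subset_Ioo hgap isPreconnected_Ioo
  have hslope : ∀ t ∈ Ioo a b, t ∉ facets (filledGraph Q) → om t = facetSlope j := by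
    intro t ht htQ
    have h1 := hj t ht
    rw [← H.filledGraph_eq hh hP hQ htQ] at h1
    exact (H.eventually_eq_facetSlope hQ h1).self_of_nhds
  obtain ⟨y, hy, hyQ⟩ := not_subset.1 (hcon a ha.1)
  obtain ⟨z, hz, hzQ⟩ := not_subset.1 (hcon b hb.1)
  rw [uIcc_of_le hax.le] at hy
  rw [uIcc_of_ge hxb.le] at hz
  have hya : a < y := lt_of_le_of_ne hy.1 fun h => hyQ (h ▸ hsub ha.1)
  have hyx : y < x := lt_of_le_of_ne hy.2 fun h => hyQ (h ▸ hx)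
  have hzb : z < b := lt_of_le_of_ne hz.2 fun h => hzQ (h ▸ hsub hb.1)
  have hxz : x < z := lt_of_le_of_ne hz.1 fun h => hzQ (h ▸ hx)
  have hy' := hslope y ⟨hya, hyx.trans hxb⟩ hyQ
  have hz' := hslope z ⟨hax.trans hxz, hzb⟩ hzQ
  have hyz : y < z := hyx.trans hxz
  have hWc := H.continuous_W hh
  have hW0 : ∀ t ∈ Icc y z, W t = 0 := by
    have hWs : ∀ a b, W b - W a = ∫ s in a..b, (Q s - P s) / h := by
      intro a b
      rw [intervalIntegral.integral_div, ← H.sub_eq]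
      field_simp
    have hg : LocallyIntegrable (fun s => (Q s - P s) / h) volume :=
      locallyIntegrable_of_intervalIntegrable fun a b =>
        (H.locallyIntegrable_sub.intervalIntegrable' a b).div_const h
    -- integrate `(om - c) om''` by parts
    have h1 := integral_comp_mul_second_deriv (k := fun x => x - facetSlope j) (k' := fun _ => 1)
      H.hasDerivAt hWs hg (fun x => (hasDerivAt_id x).sub_const _) continuous_const y z
    rw [hy', hz'] at h1
    simp only [sub_self, zero_mul, zero_sub, one_mul] at h1
    have h2 : 0 ≤ ∫ s in y..z, (om s - facetSlope j) * ((Q s - P s) / h) := by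
      refine intervalIntegral.integral_nonneg_of_ae_restrict hyz.le ?_
      refine (ae_restrict_iff' measurableSet_Icc).2 ?_
      filter_upwards [H.mem_subdiff] with t ht htI
      have h3 := hj t ⟨hya.trans_le htI.1, htI.2.trans_lt hzb⟩ (hP.mem_filledGraph t)
      have h4 := subdiff_monotone ht (facetSlope_mem_subdiff (Ioo_subset_Icc_self h3))
      change 0 ≤ (om t - facetSlope j) * ((Q t - P t) / h)
      rw [← mul_div_assoc]
      exact div_nonneg h4 hh.le
    by_contra! hne
    obtain ⟨t, ht, hWt⟩ := hne
    have h3 := intervalIntegral.integral_pos (f := fun s => W s ^ 2) hyz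
      (hWc.pow 2).continuousOn (fun s _ => sq_nonneg _) ⟨t, ht, by positivity⟩
    linarith
  have hom : ∀ t ∈ Icc y z, om t = facetSlope j := by
    intro t ht
    have h1 : ∀ s ∈ uIcc y t, HasDerivAt om 0 s := by
      intro s hs
      rw [uIcc_of_le ht.1] at hs
      have := H.hasDerivAt s
      rwa [hW0 s ⟨hs.1, hs.2.trans ht.2⟩] at this
    have h2 := intervalIntegral.integral_eq_sub_of_hasDerivAt h1 intervalIntegrable_const
    rw [intervalIntegral.integral_zero, hy'] at h2
    linarith
  have heq : filledGraph Q x = filledGraph P x := by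
    refine hQ.bv.filledGraph_congr hP.bv (Icc_mem_nhds hyx hxz) ?_
    filter_upwards [H.ae_eq_of_eq hh (facetSlope j)] with t ht htI using ht (hom t htI)
  obtain ⟨i, hi⟩ := mem_iUnion.1 hx
  refine hxP (mem_iUnion.2 ⟨i, ?_⟩)
  change prefAngle i ∈ filledGraph P x
  rw [← heq]
  exact hi

theorem circleFacets_subset (hh : 0 < h) (H : IsFluxStep h P Q om W) (hP : IsAngleFn P)
    (hQ : IsAngleFn Q) : circleFacets (filledGraph P) ⊆ circleFacets (filledGraph Q) :=
  image_mono (H.facets_subset hh hP hQ)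

/-- Every component of the new facets contains one of the old facets. -/
theorem connectedComponentsMap_surjective (hh : 0 < h) (H : IsFluxStep h P Q om W)
    (hP : IsAngleFn P) (hQ : IsAngleFn Q) :
    Function.Surjective
      (continuous_inclusion (H.circleFacets_subset hh hP hQ)).connectedComponentsMap := by
  intro c
  obtain ⟨⟨_, x, hx, rfl⟩, rfl⟩ := ConnectedComponents.surjective_coe c
  obtain ⟨a, ha, hax⟩ := H.exists_uIcc_subset_facets hh hP hQ hx
  refine ⟨((⟨(a : AddCircle (2 * π)), a, ha, rfl⟩ : circleFacets (filledGraph P)) :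
    ConnectedComponents (circleFacets (filledGraph P))), ?_⟩
  have : PreconnectedSpace (uIcc a x) := Subtype.preconnectedSpace isPreconnected_uIcc
  set g : uIcc a x → circleFacets (filledGraph Q) :=
    fun t => ⟨((t : ℝ) : AddCircle (2 * π)), t, hax t.2, rfl⟩ with hg
  have hgc : Continuous g :=
    ((AddCircle.continuous_mk' (2 * π)).comp continuous_subtype_val).subtype_mk _
  have h1 := (isPreconnected_range hgc).subset_connectedComponent
    (mem_range_self (⟨x, right_mem_uIcc⟩ : uIcc a x))
  exact ConnectedComponents.coe_eq_coe'.2 (h1 (mem_range_self (⟨a, left_mem_uIcc⟩ : uIcc a x)))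

theorem finite_components (hh : 0 < h) (H : IsFluxStep h P Q om W) (hP : IsAngleFn P)
    (hQ : IsAngleFn Q) (hfin : Finite (ConnectedComponents (circleFacets (filledGraph P)))) :
    Finite (ConnectedComponents (circleFacets (filledGraph Q))) :=
  Finite.of_surjective _ (H.connectedComponentsMap_surjective hh hP hQ)

theorem facetCount_le (hh : 0 < h) (H : IsFluxStep h P Q om W) (hP : IsAngleFn P)
    (hQ : IsAngleFn Q) (hfin : Finite (ConnectedComponents (circleFacets (filledGraph P)))) :
    facetCount (filledGraph Q) ≤ facetCount (filledGraph P) :=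
  Nat.card_le_card_of_surjective _ (H.connectedComponentsMap_surjective hh hP hQ)

theorem isJR (hh : 0 < h) (H : IsFluxStep h P Q om W) (hP : IsAngleFn P) (hQ : IsAngleFn Q)
    (hJ : IsJR (filledGraph P)) : IsJR (filledGraph Q) where
  maximalTV := isMaximalTV_filledGraph hQ.bv
  angle_add_two_pi := hQ.filledGraph_add_two_pi
  finite_components := H.finite_components hh hP hQ hJ.finite_components
  between _ hI hc := hQ.exists_subset_Ioo hI hc

theorem jrNorm_le (hh : 0 < h) (H : IsFluxStep h P Q om W) (hP : IsAngleFn P) (hQ : IsAngleFn Q)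
    (hJ : IsJR (filledGraph P)) : jrNorm (filledGraph Q) ≤ jrNorm (filledGraph P) := by
  unfold jrNorm
  rw [hP.circleTV_filledGraph, hQ.circleTV_filledGraph]
  exact add_le_add (H.eVariationOn_le hh hP hQ)
    (by exact_mod_cast H.facetCount_le hh hP hQ hJ.finite_components)

/-- On the part of the old facets that no new facet has entered, the angle has not changed. -/
theorem ae_eq_of_mem_oldFacets (hh : 0 < h) (H : IsFluxStep h P Q om W) (hP : IsAngleFn P)
    (hQ : IsAngleFn Q) : ∀ᵐ s, s ∈ oldFacets (filledGraph P) (filledGraph Q) → Q s = P s := by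
  filter_upwards [hP.ae_filledGraph_eq, hQ.ae_filledGraph_eq] with s h1 h2 hs
  obtain ⟨l, hl⟩ := mem_iUnion.1 (H.facets_subset hh hP hQ hs.1)
  have hlP : s ∈ facetSet (filledGraph P) l := by
    by_contra hc
    exact hs.2 (mem_iUnion.2 ⟨l, hl, hc⟩)
  simp only [facetSet, mem_ofPred_eq, h1, h2, mem_singleton_iff] at hl hlP
  rw [← hl, ← hlP]

theorem W_eq_of_mem_connectedComponentIn (hh : 0 < h) (H : IsFluxStep h P Q om W)
    (hP : IsAngleFn P) (hQ : IsAngleFn Q) {s t : ℝ}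
    (hs : s ∈ oldFacets (filledGraph P) (filledGraph Q))
    (ht : t ∈ connectedComponentIn (oldFacets (filledGraph P) (filledGraph Q)) s) :
    W t = W s := by
  have hsub : uIcc s t ⊆ oldFacets (filledGraph P) (filledGraph Q) :=
    (isPreconnected_connectedComponentIn.ordConnected.uIcc_subset
      (mem_connectedComponentIn hs) ht).trans (connectedComponentIn_subset _ _)
  have h1 : ∫ y in s..t, (Q y - P y) = 0 := by
    rw [← intervalIntegral.integral_zero (a := s) (b := t) (μ := volume)]
    refine intervalIntegral.integral_congr_ae ?_
    filter_upwards [H.ae_eq_of_mem_oldFacets hh hP hQ] with y hy hyI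
    rw [hy (hsub (uIoc_subset_uIcc hyI)), sub_self]
  rw [← H.sub_eq] at h1
  linarith [(mul_eq_zero.1 h1).resolve_left hh.ne']

end IsFluxStep

/-! ### Displacement in one step -/

theorem IsAngleFn.abs_translate_sub_le_turnVar {P : ℝ → ℝ} (hP : IsAngleFn P) {t : ℝ}
    (ht : t ∈ Icc 0 (2 * π)) (s : ℝ) : |P (s + t) - P s| ≤ turnVar P := by
  have h1 := hP.abs_sub_le (a := s) (b := s + t) (by linarith [ht.1])
  have h2 := hP.variation_monotone (show s + t ≤ s + 2 * π by linarith [ht.2])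
  have h3 := hP.variation_add_two_pi s
  linarith

/-- The parameters of one turn at which the angle function `P` is `ε`-close, but not equal, to a
preferred angle. -/
def nearFacets (P : ℝ → ℝ) (ε : ℝ) : Set ℝ :=
  {s ∈ Ioc 0 (2 * π) | ∃ l, P s ≠ prefAngle l ∧ |P s - prefAngle l| < ε}

theorem measurableSet_nearFacets {P : ℝ → ℝ} (hP : IsAngleFn P) (ε : ℝ) :
    MeasurableSet (nearFacets P ε) := by
  have hm := hP.bv.measurable
  have : nearFacets P ε =
      Ioc 0 (2 * π) ∩ ⋃ l, ({s | P s = prefAngle l}ᶜ ∩ {s | |P s - prefAngle l| < ε}) := by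
    ext s
    simp [nearFacets]
  rw [this]
  exact measurableSet_Ioc.inter <| .iUnion fun l =>
    (measurableSet_eq_fun hm measurable_const).compl.inter
      (measurableSet_lt (hm.sub_const _).abs measurable_const)

theorem volume_nearFacets_ne_top (P : ℝ → ℝ) (ε : ℝ) : volume (nearFacets P ε) ≠ ⊤ :=
  ((measure_mono (t := Ioc 0 (2 * π)) fun _ hs => hs.1).trans_lt measure_Ioc_lt_top).ne

theorem tendsto_volume_nearFacets {P : ℝ → ℝ} (hP : IsAngleFn P) :
    Tendsto (fun ε => volume (nearFacets P ε)) (𝓝[>] 0) (𝓝 0) := by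
  have h1 := tendsto_measure_biInter_gt (μ := volume) (s := nearFacets P) (a := (0 : ℝ))
    (fun r _ => (measurableSet_nearFacets hP r).nullMeasurableSet)
    (fun i j _ hij s hs => ⟨hs.1, hs.2.imp fun l hl => ⟨hl.1, hl.2.trans_le hij⟩⟩)
    ⟨1, one_pos, volume_nearFacets_ne_top P 1⟩
  have h2 : ⋂ r : ℝ, ⋂ (_ : r > 0), nearFacets P r = ∅ := by
    refine eq_empty_of_forall_notMem fun s hs => ?_
    simp only [mem_iInter] at hs
    obtain ⟨l, hl, hl1⟩ := (hs (π / 4) (by positivity)).2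
    have hpos : 0 < |P s - prefAngle l| := abs_pos.2 (sub_ne_zero.2 hl)
    obtain ⟨m, hm, hm1⟩ := (hs _ hpos).2
    rcases eq_or_ne l m with rfl | hlm
    · exact lt_irrefl _ hm1
    · have h3 := pi_div_two_le_abs_prefAngle_sub hlm
      have h4 := abs_sub_le (prefAngle l) (P s) (prefAngle m)
      rw [abs_sub_comm (prefAngle l) (P s)] at h4
      linarith
  rw [h2, measure_empty] at h1
  exact h1

namespace IsFluxStep

variable {h : ℝ} {P Q om W : ℝ → ℝ}

theorem abs_flux_translate_sub_le (H : IsFluxStep h P Q om W) (hQ : IsAngleFn Q) {t : ℝ}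
    (ht : t ∈ Icc 0 (2 * π)) (s : ℝ) : |om (s + t) - om s| ≤ π / 2 + turnVar Q := by
  have hcl : IsClosed {s | |om (s + t) - om s| ≤ π / 2 + turnVar Q} :=
    isClosed_le ((H.continuous_flux.comp (continuous_id.add_const t)).sub H.continuous_flux).abs
      continuous_const
  have hd : Dense {s | |om (s + t) - om s| ≤ π / 2 + turnVar Q} := by
    refine Measure.dense_of_ae (μ := volume) ?_
    filter_upwards [H.mem_subdiff, ae_add_two_pi H.mem_subdiff t] with s h1 h2
    have h3 := abs_le.1 (abs_sub_le_of_mem_subdiff h1)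
    have h4 := abs_le.1 (abs_sub_le_of_mem_subdiff h2)
    have h5 := abs_le.1 (hQ.abs_translate_sub_le_turnVar ht s)
    exact abs_le.2 ⟨by linarith, by linarith⟩
  exact hcl.closure_subset (hd s)

/-- Averaging `h om'' = Q - P` twice over intervals of length `δ` turns it into a second difference
of the flux, which is bounded, while the error is controlled by the variations. -/
theorem sq_mul_abs_sub_le (hh : 0 < h) (H : IsFluxStep h P Q om W) (hP : IsAngleFn P)
    (hQ : IsAngleFn Q) {δ : ℝ} (hδ : δ ∈ Icc 0 (2 * π)) (s : ℝ) :
    δ ^ 2 * |Q s - P s| ≤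
      δ ^ 2 * ((variationOnFromTo P univ 0 (s + 2 * δ) - variationOnFromTo P univ 0 s) +
        (variationOnFromTo Q univ 0 (s + 2 * δ) - variationOnFromTo Q univ 0 s)) +
      h * (π + 2 * turnVar Q) := by
  set ε := (variationOnFromTo P univ 0 (s + 2 * δ) - variationOnFromTo P univ 0 s) +
        (variationOnFromTo Q univ 0 (s + 2 * δ) - variationOnFromTo Q univ 0 s) with hε
  set g := Q s - P s with hg
  have hδ0 := hδ.1
  have hpt : ∀ u ∈ Icc s (s + 2 * δ), |Q u - P u - g| ≤ ε := by
    intro u hu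
    have h1 := abs_le.1 (hP.abs_sub_le hu.1)
    have h2 := abs_le.1 (hQ.abs_sub_le hu.1)
    have h3 := hP.variation_monotone hu.2
    have h4 := hQ.variation_monotone hu.2
    exact abs_le.2 ⟨by linarith, by linarith⟩
  have hav : ∀ t ∈ Icc s (s + δ), |h * (W (t + δ) - W t) - δ * g| ≤ ε * δ := by
    intro t ht
    have h1 := intervalIntegral.norm_integral_le_of_norm_le_const (a := t) (b := t + δ) (C := ε)
      (f := fun u => Q u - P u - g) fun u hu => by
        rw [uIoc_of_le (by linarith)] at hu
        exact hpt u ⟨by linarith [ht.1, hu.1], by linarith [ht.2, hu.2]⟩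
    rw [intervalIntegral.integral_sub (H.locallyIntegrable_sub.intervalIntegrable' _ _)
      intervalIntegrable_const, ← H.sub_eq, intervalIntegral.integral_const, add_sub_cancel_left,
      abs_of_nonneg hδ0] at h1
    simpa using h1
  have hWc := H.continuous_W hh
  have hWi : ∀ a b, ∫ t in a..b, W t = om b - om a := fun a b =>
    intervalIntegral.integral_eq_sub_of_hasDerivAt (fun x _ => H.hasDerivAt x)
      (hWc.intervalIntegrable _ _)
  have h2 := intervalIntegral.norm_integral_le_of_norm_le_const (a := s) (b := s + δ) (C := ε * δ)
    (f := fun t => h * (W (t + δ) - W t) - δ * g) fun t ht => by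
      rw [uIoc_of_le (by linarith)] at ht
      exact hav t ⟨ht.1.le, ht.2⟩
  have hWt : Continuous fun t => W (t + δ) := hWc.comp (continuous_id.add_const δ)
  rw [intervalIntegral.integral_sub (f := fun t => h * (W (t + δ) - W t))
      (((hWt.sub hWc).const_mul h).intervalIntegrable _ _)
      intervalIntegrable_const, intervalIntegral.integral_const_mul,
    intervalIntegral.integral_sub (hWt.intervalIntegrable _ _) (hWc.intervalIntegrable _ _),
    intervalIntegral.integral_comp_add_right, hWi, hWi, intervalIntegral.integral_const,
    add_sub_cancel_left, abs_of_nonneg hδ0, smul_eq_mul, Real.norm_eq_abs] at h2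
  have h3 := abs_le.1 (H.abs_flux_translate_sub_le hQ hδ s)
  have h4 := abs_le.1 (H.abs_flux_translate_sub_le hQ hδ (s + δ))
  have h5 := abs_le.1 h2
  have h6 : h * (om (s + δ + δ) - om (s + δ) - (om (s + δ) - om s)) ≤
      h * (π + 2 * turnVar Q) := by gcongr; linarith
  have h7 : -(h * (π + 2 * turnVar Q)) ≤
      h * (om (s + δ + δ) - om (s + δ) - (om (s + δ) - om s)) := by
    rw [← mul_neg]; gcongr; linarith
  rw [show δ ^ 2 * |g| = |δ * (δ * g)| by
    rw [abs_mul, abs_mul, abs_of_nonneg hδ0]; ring]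
  exact abs_le.2 ⟨by linarith, by linarith⟩

/-- The mean displacement in one step. -/
theorem integral_abs_displacement_le (hh : 0 < h) (H : IsFluxStep h P Q om W) (hP : IsAngleFn P)
    (hQ : IsAngleFn Q) {M : ℝ} (hPM : turnVar P ≤ M) (hQM : turnVar Q ≤ M) {δ : ℝ} (hδ0 : 0 < δ)
    (hδ : δ ≤ 2 * π) :
    ∫ s in (0 : ℝ)..2 * π, |Q s - P s| ≤ 4 * M * δ + 2 * π * (π + 2 * M) * (h / δ ^ 2) := by
  have hi1 := hP.intervalIntegrable_variation_translate_sub (2 * δ) 0 (2 * π)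
  have hi2 := hQ.intervalIntegrable_variation_translate_sub (2 * δ) 0 (2 * π)
  calc ∫ s in (0 : ℝ)..2 * π, |Q s - P s|
      ≤ ∫ s in (0 : ℝ)..2 * π,
        (((variationOnFromTo P univ 0 (s + 2 * δ) - variationOnFromTo P univ 0 s) +
          (variationOnFromTo Q univ 0 (s + 2 * δ) - variationOnFromTo Q univ 0 s)) +
        (π + 2 * M) * (h / δ ^ 2)) := by
        refine intervalIntegral.integral_mono_on two_pi_pos.le
          (H.locallyIntegrable_sub.intervalIntegrable' _ _).abs
          ((hi1.add hi2).add intervalIntegrable_const) fun s _ => ?_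
        have h1 := H.sq_mul_abs_sub_le hh hP hQ ⟨hδ0.le, hδ⟩ s
        have h2 : h * (π + 2 * turnVar Q) ≤ h * (π + 2 * M) := by gcongr
        refine le_of_mul_le_mul_left ?_ (pow_pos hδ0 2)
        have h3 : δ ^ 2 * ((π + 2 * M) * (h / δ ^ 2)) = h * (π + 2 * M) := by
          field_simp
        rw [mul_add _ _ ((π + 2 * M) * _), h3]
        linarith
    _ = 2 * δ * turnVar P + 2 * δ * turnVar Q + 2 * π * ((π + 2 * M) * (h / δ ^ 2)) := by
        rw [intervalIntegral.integral_add (hi1.add hi2) intervalIntegrable_const,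
          intervalIntegral.integral_add hi1 hi2, hP.integral_variation_translate_sub,
          hQ.integral_variation_translate_sub, intervalIntegral.integral_const]
        simp
    _ ≤ 2 * δ * M + 2 * δ * M + 2 * π * ((π + 2 * M) * (h / δ ^ 2)) := by gcongr
    _ = _ := by ring

/-- If the old angle agrees with `P₀` off its facets, then the angle can only change where it is
displaced by at least `ε`, or where `P₀` is `ε`-close to a preferred angle. -/
theorem volume_ne_le (hh : 0 < h) (H : IsFluxStep h P Q om W) (hP : IsAngleFn P)
    (hQ : IsAngleFn Q) {P₀ : ℝ → ℝ} (hP₀ : IsAngleFn P₀)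
    (hoff : ∀ s, s ∉ facets (filledGraph P) → filledGraph P s = filledGraph P₀ s) {ε : ℝ}
    (hε0 : 0 < ε) (hε : ε ≤ π / 2) :
    volume {s ∈ Ioc 0 (2 * π) | Q s ≠ P s} ≤ ENNReal.ofReal ((volume (nearFacets P₀ ε)).toReal +
      (∫ s in (0 : ℝ)..2 * π, |Q s - P s|) / ε) := by
  set I : Set ℝ := Ioc 0 (2 * π) with hI
  set μ := volume.restrict I with hμ
  have hsub : {s ∈ I | Q s ≠ P s} ≤ᵐ[volume]
      (nearFacets P₀ ε ∪ ({s | ε ≤ |Q s - P s|} ∩ I) : Set ℝ) := by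
    filter_upwards [hP.ae_filledGraph_eq, hP₀.ae_filledGraph_eq, H.ae_eq_or_exists_prefAngle hh]
      with s h1 h2 h3 hs
    obtain ⟨hsI, hne⟩ := hs
    obtain ⟨l, hl⟩ := h3.resolve_left hne
    rcases le_or_gt ε |Q s - P s| with hc | hc
    · exact .inr ⟨hc, hsI⟩
    refine .inl ⟨hsI, l, ?_⟩
    have hsF : s ∉ facets (filledGraph P) := by
      intro hsF
      obtain ⟨m, hm⟩ := mem_iUnion.1 hsF
      simp only [facetSet, mem_ofPred_eq, h1, mem_singleton_iff] at hm
      have hml : l ≠ m := by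
        rintro rfl
        exact hne (hl.trans hm)
      have h4 := pi_div_two_le_abs_prefAngle_sub hml
      rw [hl, ← hm] at hc
      linarith
    have h5 := hoff s hsF
    rw [h1, h2, singleton_eq_singleton_iff] at h5
    rw [← h5, ← hl]
    exact ⟨hne.symm, by rwa [abs_sub_comm]⟩
  have hint : Integrable (fun s => |Q s - P s|) μ :=
    ((intervalIntegrable_iff_integrableOn_Ioc_of_le two_pi_pos.le).1
      (H.locallyIntegrable_sub.intervalIntegrable' 0 (2 * π))).abs
  have hmarkov := mul_meas_ge_le_integral_of_nonneg (.of_forall fun s => abs_nonneg _) hint ε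
  rw [← intervalIntegral.integral_of_le two_pi_pos.le] at hmarkov
  have hmeas : MeasurableSet {s | ε ≤ |Q s - P s|} :=
    measurableSet_le measurable_const (hQ.bv.measurable.sub hP.bv.measurable).abs
  have hfin : volume ({s | ε ≤ |Q s - P s|} ∩ I) ≠ ⊤ :=
    measure_ne_top_of_subset inter_subset_right measure_Ioc_lt_top.ne
  have hreal : μ.real {s | ε ≤ |Q s - P s|} = (volume ({s | ε ≤ |Q s - P s|} ∩ I)).toReal := by
    rw [measureReal_def, hμ, Measure.restrict_apply hmeas]
  rw [hreal] at hmarkov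
  calc volume {s ∈ I | Q s ≠ P s}
      ≤ volume (nearFacets P₀ ε) + volume ({s | ε ≤ |Q s - P s|} ∩ I) :=
        (measure_mono_ae hsub).trans (measure_union_le _ _)
    _ = ENNReal.ofReal ((volume (nearFacets P₀ ε)).toReal +
          (volume ({s | ε ≤ |Q s - P s|} ∩ I)).toReal) := by
        rw [ENNReal.ofReal_add ENNReal.toReal_nonneg ENNReal.toReal_nonneg,
          ENNReal.ofReal_toReal (volume_nearFacets_ne_top _ _), ENNReal.ofReal_toReal hfin]
    _ ≤ _ := by
        refine ENNReal.ofReal_le_ofReal (add_le_add_right ?_ _)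
        rw [le_div_iff₀ hε0, mul_comm]
        exact hmarkov

open scoped Pointwise in
/-- A single `Ξ_l` on the line gains at most as much as the set on the circle where the angle has
changed, since the angle increases by `2π` from turn to turn. -/
theorem volume_facetSet_diff_le (hP : IsAngleFn P) (hQ : IsAngleFn Q) (l : ℤ) :
    volume (facetSet (filledGraph Q) l \ facetSet (filledGraph P) l) ≤
      volume {s ∈ Ioc 0 (2 * π) | Q s ≠ P s} := by
  set E : Set ℝ := {s | Q s = prefAngle l ∧ Q s ≠ P s} with hE
  have hEm : MeasurableSet E :=
    (measurableSet_eq_fun hQ.bv.measurable measurable_const).inter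
      (measurableSet_eq_fun hQ.bv.measurable hP.bv.measurable).compl
  have hsub : facetSet (filledGraph Q) l \ facetSet (filledGraph P) l ≤ᵐ[volume] E := by
    filter_upwards [hP.ae_filledGraph_eq, hQ.ae_filledGraph_eq] with s h1 h2 hs
    have h3 : s ∈ facetSet (filledGraph Q) l := hs.1
    have h4 : s ∉ facetSet (filledGraph P) l := hs.2
    simp only [facetSet, mem_ofPred_eq, h1, h2, mem_singleton_iff] at h3 h4
    exact ⟨h3.symm, fun h => h4 (h3.trans h)⟩
  refine (measure_mono_ae hsub).trans ?_
  have hfd := isAddFundamentalDomain_Ioc two_pi_pos 0 volume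
  have hperQ : ∀ (n : ℤ) s, Q (s - n * (2 * π)) = Q s - n * (2 * π) := fun n s => by
    have hp : Function.Periodic (fun s => Q s - s) (2 * π) := fun s => by
      simp only [hQ.add_two_pi]; ring
    have := hp.sub_int_mul_eq (x := s) n
    linarith
  have hperP : ∀ (n : ℤ) s, P (s - n * (2 * π)) = P s - n * (2 * π) := fun n s => by
    have hp : Function.Periodic (fun s => P s - s) (2 * π) := fun s => by
      simp only [hP.add_two_pi]; ring
    have := hp.sub_int_mul_eq (x := s) n
    linarith
  have hmem : ∀ (g : AddSubgroup.zmultiples (2 * π)) (s : ℝ), s ∈ g +ᵥ E →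
      Q s = prefAngle l + g ∧ Q s ≠ P s := by
    rintro ⟨_, n, rfl⟩ s hs
    rw [mem_vadd_set_iff_neg_vadd_mem] at hs
    have hs' : s - n * (2 * π) ∈ E := by
      convert hs using 1
      simp [AddSubgroup.vadd_def, sub_eq_neg_add]
    have h1 := hs'.1
    have h2 := hs'.2
    rw [hperQ] at h1 h2
    rw [hperP] at h2
    refine ⟨?_, fun h => h2 (by rw [h])⟩
    simp only [zsmul_eq_mul]
    linarith
  rw [hfd.measure_eq_tsum, ← measure_iUnion]
  · refine measure_mono (iUnion_subset fun g s hs => ?_)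
    exact ⟨by simpa using hs.2, (hmem g s hs.1).2⟩
  · intro g g' hgg
    refine Set.disjoint_left.2 fun s hs hs' => hgg (Subtype.ext ?_)
    linarith [(hmem g s hs.1).1, (hmem g' s hs'.1).1]
  · exact fun g => (hEm.const_vadd g).inter measurableSet_Ioc

/-- The growth of each `Ξ_l` in one step, in terms of the sixth root `η` of the step size. -/
theorem volume_facetSet_diff_le_of_pow_six (hh : 0 < h) (H : IsFluxStep h P Q om W)
    (hP : IsAngleFn P) (hQ : IsAngleFn Q) {P₀ : ℝ → ℝ} (hP₀ : IsAngleFn P₀)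
    (hoff : ∀ s, s ∉ facets (filledGraph P) → filledGraph P s = filledGraph P₀ s) {M η : ℝ}
    (hPM : turnVar P ≤ M) (hQM : turnVar Q ≤ M) (hM : 0 ≤ M) (hη : 0 < η) (hηh : η ^ 6 = h)
    (l : ℤ) :
    volume (facetSet (filledGraph Q) l \ facetSet (filledGraph P) l) ≤
      ENNReal.ofReal ((volume (nearFacets P₀ η)).toReal +
        (4 * M + 2 * π * (π + 2 * M) + 2 * π) * η) := by
  refine (volume_facetSet_diff_le hP hQ l).trans ?_
  have hpi := pi_gt_three
  rcases le_or_gt η 1 with h1 | h1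
  · refine (H.volume_ne_le hh hP hQ hP₀ hoff hη (by linarith)).trans
      (ENNReal.ofReal_le_ofReal (add_le_add_right ?_ _))
    -- the averaging length `η ^ 2` balances both parts of the mean displacement
    have h2 := H.integral_abs_displacement_le hh hP hQ hPM hQM (δ := η ^ 2) (by positivity)
      (by nlinarith)
    rw [div_le_iff₀ hη]
    have h3 : h / (η ^ 2) ^ 2 = η ^ 2 := by
      rw [← hηh]; field_simp
    rw [h3] at h2
    have h4 : 0 ≤ 2 * π * η ^ 2 := by positivity
    linarith
  · calc volume {s ∈ Ioc 0 (2 * π) | Q s ≠ P s} ≤ volume (Ioc 0 (2 * π)) :=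
          measure_mono fun s hs => hs.1
      _ = ENNReal.ofReal (2 * π) := by simp
      _ ≤ _ := by
          refine ENNReal.ofReal_le_ofReal ?_
          have h2 : 0 ≤ (volume (nearFacets P₀ η)).toReal := ENNReal.toReal_nonneg
          have h3 : 0 ≤ (4 * M + 2 * π * (π + 2 * M)) * η := by positivity
          nlinarith

end IsFluxStep

/-! ### Solutions of the scheme -/

theorem IsJR.exists_isAngleFn {φ : ℝ → Set ℝ} (hφ : IsJR φ) :
    ∃ P, IsAngleFn P ∧ filledGraph P = φ := by
  obtain ⟨p, hp, hφp⟩ := hφ.maximalTV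
  have hpφ : filledGraph p = φ := funext fun s => (hφp s).symm
  subst hpφ
  have hper : ∀ᵐ s, p (s + 2 * π) = p s + 2 * π := by
    filter_upwards [hp.ae_continuousAt, ae_add_two_pi hp.ae_continuousAt (2 * π)] with s h1 h2
    have h3 := hφ.angle_add_two_pi s
    rwa [hp.filledGraph_eq h1, hp.filledGraph_eq h2, image_singleton,
      singleton_eq_singleton_iff] at h3
  refine ⟨upperSelection p, isAngleFn_upperSelection hp hper, funext fun s => ?_⟩
  refine hp.upperSelection.filledGraph_congr hp univ_mem ?_
  filter_upwards [hp.upperSelection_ae_eq] with x hx _ using hx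

theorem IsAngleFn.eq_of_filledGraph_eq {P Q : ℝ → ℝ} (hP : IsAngleFn P) (hQ : IsAngleFn Q)
    (h : filledGraph P = filledGraph Q) : P = Q := by
  rw [← hP.upperSelection_eq, ← hQ.upperSelection_eq]
  funext s
  rw [← sSup_filledGraph, ← sSup_filledGraph, h]

theorem IsProfile.exists_isFlux {h : ℝ} (hh : 0 < h) {v : ℝ → ℝ} (hv : IsProfile v) :
    ∃ u, IsProfile u ∧ ∃ om, IsFlux h v u om := by
  obtain ⟨P, hP, hvP⟩ := hv.exists_isAngleFn
  obtain ⟨Q, om, W, hQ, H⟩ := exists_isFluxStep hh hP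
  refine ⟨_, isProfile_of_isAngleDensity hQ.bv (H.isAngleDensity hvP) fun s => ?_, om,
    H.isFlux hh hvP⟩
  simp only [hv.periodic s, H.W_periodic]

theorem exists_isSemiDiscrete {h : ℝ} (hh : 0 < h) {v : ℝ → ℝ} (hv : IsProfile v) (N : ℕ) :
    ∃ lam, IsSemiDiscrete h N v lam := by
  have hex := fun w : {w // IsProfile w} => w.2.exists_isFlux hh
  choose next hprof hflux using hex
  set seq : ℕ → {w // IsProfile w} := fun n =>
    Nat.rec ⟨v, hv⟩ (fun _ w => ⟨next w, hprof w⟩) n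
  exact ⟨fun n => seq n, rfl, fun k _ => (seq k).2, fun k _ => hflux (seq k)⟩

theorem IsSemiDiscrete.unique {h : ℝ} (hh : 0 < h) {v : ℝ → ℝ} {N : ℕ} {lam lam' : ℕ → ℝ → ℝ}
    (H : IsSemiDiscrete h N v lam) (H' : IsSemiDiscrete h N v lam') :
    ∀ k ≤ N, lam k = lam' k := by
  intro k
  induction k with
  | zero => intro _; rw [H.initial, H'.initial]
  | succ k ih =>
    intro hk
    obtain ⟨om, hom⟩ := H.step k hk
    obtain ⟨om', hom'⟩ := H'.step k hk
    rw [← ih (by lia)] at hom'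
    exact hom.unique hh (H.profile k (by lia)) (H.profile _ hk) (H'.profile _ hk) hom'

/-- The angle functions of a solution: the properties that each step inherits from the previous
one. -/
theorem IsSemiDiscrete.exists_angleFn {h : ℝ} (hh : 0 < h) {v P₀ : ℝ → ℝ} {N : ℕ}
    {lam : ℕ → ℝ → ℝ} (H : IsSemiDiscrete h N v lam) (hP₀ : IsAngleFn P₀)
    (hv : angle v = filledGraph P₀) (hJ : IsJR (filledGraph P₀)) :
    ∀ k ≤ N, ∃ P, IsAngleFn P ∧ IsAngleDensity (lam k) P ∧ angle (lam k) = filledGraph P ∧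
      IsJR (filledGraph P) ∧ jrNorm (filledGraph P) ≤ jrNorm (filledGraph P₀) ∧
      turnVar P ≤ turnVar P₀ ∧
      ∀ s, s ∉ facets (filledGraph P) → filledGraph P s = filledGraph P₀ s := by
  intro k
  induction k with
  | zero =>
    intro hk
    obtain ⟨P, hP, hlP⟩ := (H.profile 0 hk).exists_isAngleFn
    have hPa := hlP.angle_eq hP.bv
    obtain rfl : P = P₀ := hP.eq_of_filledGraph_eq hP₀ (by rw [← hPa, H.initial, hv])
    exact ⟨P, hP, hlP, hPa, hJ, le_rfl, le_rfl, fun _ _ => rfl⟩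
  | succ k ih =>
    intro hk
    obtain ⟨P, hP, hlP, hPa, hPJ, hPn, hPt, hoff⟩ := ih (by lia)
    obtain ⟨Q, hQ, hlQ⟩ := (H.profile _ hk).exists_isAngleFn
    obtain ⟨om, hom⟩ := H.step k hk
    have S := hom.isFluxStep hh hP.locallyIntegrable hQ.locallyIntegrable hlP hlQ
    refine ⟨Q, hQ, hlQ, hlQ.angle_eq hQ.bv, S.isJR hh hP hQ hPJ,
      (S.jrNorm_le hh hP hQ hPJ).trans hPn, le_trans ?_ hPt, fun s hs => ?_⟩
    · refine ENNReal.toReal_mono (hP.eVariationOn_ne_top _ _) (S.eVariationOn_le hh hP hQ)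
    · rw [S.filledGraph_eq hh hP hQ hs, hoff s fun h => hs (S.facets_subset hh hP hQ h)]

end

theorem theorem4 (φ₀ : ℝ → Set ℝ) (hφ₀ : IsJR φ₀) :
    ∃ (C : ℝ) (V : ℝ → ℝ), 0 ≤ C ∧ (∀ h, 0 ≤ V h) ∧ Tendsto V (𝓝[>] 0) (𝓝 0) ∧
      ∀ lam₀ : ℝ → ℝ, IsProfile lam₀ → angle lam₀ = φ₀ →
      ∀ h T : ℝ, 0 < h → 0 < T →
        -- existence
        (∃ lam : ℕ → ℝ → ℝ, IsSemiDiscrete h ⌊T / h⌋₊ lam₀ lam) ∧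
        -- uniqueness
        (∀ lam lam' : ℕ → ℝ → ℝ, IsSemiDiscrete h ⌊T / h⌋₊ lam₀ lam →
          IsSemiDiscrete h ⌊T / h⌋₊ lam₀ lam' → ∀ k ≤ ⌊T / h⌋₊, lam k = lam' k) ∧
        -- properties of the solution
        (∀ lam : ℕ → ℝ → ℝ, IsSemiDiscrete h ⌊T / h⌋₊ lam₀ lam →
          (∀ k ≤ ⌊T / h⌋₊, IsJR (angle (lam k)) ∧ jrNorm (angle (lam k)) ≤ jrNorm φ₀) ∧
          ∀ k < ⌊T / h⌋₊,
            jrNorm (angle (lam (k + 1))) ≤ jrNorm (angle (lam k)) ∧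
            facets (angle (lam k)) ⊆ facets (angle (lam (k + 1))) ∧
            facetCount (angle (lam (k + 1))) ≤ facetCount (angle (lam k)) ∧
            (∀ l : ℤ, volume (facetSet (angle (lam (k + 1))) l \ facetSet (angle (lam k)) l) ≤
              ENNReal.ofReal (C * (V h + h ^ (1 / 2 : ℝ)))) ∧
            (∀ om : ℝ → ℝ, IsFlux h (lam k) (lam (k + 1)) om →
              ∀ s ∈ oldFacets (angle (lam k)) (angle (lam (k + 1))), ∃ c : ℝ,
                ∀ t ∈ connectedComponentIn
                    (oldFacets (angle (lam k)) (angle (lam (k + 1)))) s,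
                  HasDerivAt om c t)) := by
  obtain ⟨P₀, hP₀, rfl⟩ := hφ₀.exists_isAngleFn
  set M := turnVar P₀ with hM
  have hM0 : 0 ≤ M := ENNReal.toReal_nonneg
  set A := 4 * M + 2 * π * (π + 2 * M) + 2 * π with hA
  have hA0 : 0 ≤ A := by positivity
  -- the sixth root of the step size
  set η : ℝ → ℝ := fun h => |h| ^ (1 / 6 : ℝ) with hη
  have hη0 : ∀ h, 0 ≤ η h := fun h => by positivity
  have hηlim : Tendsto η (𝓝[>] 0) (𝓝[>] 0) := by
    refine tendsto_nhdsWithin_iff.2 ⟨?_, ?_⟩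
    · have h1 : Continuous η := continuous_abs.rpow_const fun _ => .inr (by norm_num)
      have h2 := h1.tendsto 0
      rw [show η 0 = 0 by rw [hη]; simp] at h2
      exact h2.mono_left nhdsWithin_le_nhds
    · filter_upwards [self_mem_nhdsWithin] with h hh
      have : 0 < |h| := abs_pos.2 (ne_of_gt hh)
      exact rpow_pos_of_pos this _
  refine ⟨1, fun h => (volume (nearFacets P₀ (η h))).toReal + A * η h, zero_le_one,
    fun h => add_nonneg ENNReal.toReal_nonneg (mul_nonneg hA0 (hη0 h)), ?_, ?_⟩
  · have h1 := (ENNReal.tendsto_toReal ENNReal.zero_ne_top).comp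
      ((tendsto_volume_nearFacets hP₀).comp hηlim)
    have h2 := (hηlim.mono_right nhdsWithin_le_nhds).const_mul A
    simpa using h1.add h2
  intro lam₀ hlam₀ hangle h T hh _
  refine ⟨exists_isSemiDiscrete hh hlam₀ _, fun lam lam' H H' => H.unique hh H',
    fun lam H => ⟨fun k hk => ?_, fun k hk => ?_⟩⟩
  · obtain ⟨P, -, -, hPa, hPJ, hPn, -⟩ := H.exists_angleFn hh hP₀ hangle hφ₀ k hk
    rw [hPa]
    exact ⟨hPJ, hPn⟩
  obtain ⟨P, hP, hlP, hPa, hPJ, -, hPt, hoff⟩ := H.exists_angleFn hh hP₀ hangle hφ₀ k hk.le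
  obtain ⟨Q, hQ, hlQ, hQa, -, -, hQt, -⟩ := H.exists_angleFn hh hP₀ hangle hφ₀ (k + 1) hk
  have hstep : ∀ om, IsFlux h (lam k) (lam (k + 1)) om →
      IsFluxStep h P Q om (fun s => (lam (k + 1) s - lam k s) / h) := fun om hom =>
    hom.isFluxStep hh hP.locallyIntegrable hQ.locallyIntegrable hlP hlQ
  obtain ⟨om₀, hom₀⟩ := H.step k hk
  have S := hstep om₀ hom₀
  rw [hPa, hQa]
  refine ⟨S.jrNorm_le hh hP hQ hPJ, S.facets_subset hh hP hQ,
    S.facetCount_le hh hP hQ hPJ.finite_components, fun l => ?_, fun om hom s hs => ?_⟩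
  · have hη6 : η h ^ 6 = h := by
      rw [hη]
      simp only
      rw [abs_of_pos hh, ← rpow_natCast, ← rpow_mul hh.le]
      norm_num
    refine (S.volume_facetSet_diff_le_of_pow_six hh hP hQ hP₀ hoff hPt hQt hM0
      (rpow_pos_of_pos (abs_pos.2 hh.ne') _) hη6 l).trans (ENNReal.ofReal_le_ofReal ?_)
    rw [one_mul]
    exact le_add_of_nonneg_right (rpow_nonneg hh.le _)
  · refine ⟨(lam (k + 1) s - lam k s) / h, fun t ht => ?_⟩
    have h1 := (hstep om hom).hasDerivAt t
    rwa [(hstep om hom).W_eq_of_mem_connectedComponentIn hh hP hQ hs ht] at h1
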